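/- Let $R$ be an infinite integral domain with a strict total order $<$ (no compatibility with the ring operations is assumed), and let $R^*=\bigcup_{k\ge 0}R^k$. **Circuits.** An $R$-circuit is a finite directed acyclic graph with input nodes, constant nodes (labelled by elements of $R$), arithmetic nodes ($+$ or $\times$, of any indegree $\ge 1$), comparison nodes (with two distinct predecessors, left and right, computing the characteristic function of $<$) and output nodes (indegree $1$). Its size is the number of nodes, its depth the length of a longest path from an input node to an output node. A family $(C_n)_{n\in\mathbb N}$, where $C_n$ has $n$ input nodes and one output node, decides $S\subseteq R^*$ if $C_n$ computes the characteristic function of $S\cap R^n$ for every $n$. $\mathrm{AC}^i_R$ is the class of sets decided by families of size $n^{O(1)}$ and depth $O((\log_2 n)^i)$; $\mathrm{NC}^i_R$ is defined in the same way with the indegree of arithmetic nodes bounded by $2$. **Logic.** A signature $(L_s,L_f,L_a)$ consists of finite ordered vocabularies of function symbols. An $R$-structure has a finite ordered universe $A$ and interprets $L_s$ by functions $A^k\to A$ and $L_f$ by functions $A^k\to R$. It is encoded in $R^*$ by replacing the functions for $L_s$ by the $0/1$-valued characteristic functions of their graphs and concatenating all value tables in lexicographic order; signatures for which the length of the encoding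 does not determine $|A|$ (those where $L_s$ is empty and $L_f$ has only $0$-ary symbols) are excluded. Symbols of $L_a$ are interpreted, for each encoding length (equivalently, for each $|A|$), by arbitrary functions $A^k\to R$. Index terms are built from variables (ranging over $A$) and $L_s$; number terms are the elements of $R$, applications of symbols of $L_f, L_a$ to index terms, and are closed under $+$, $\times$, $\mathrm{sign}$ (where $\mathrm{sign}(x)=1$ if $x>0$ and $0$ otherwise), characteristic functions $\chi[\varphi]$ of formulas, and $\mathrm{sum}_{\bar x}$, $\mathrm{prod}_{\bar x}$, $\mathrm{max}_{\bar x}$ over tuples from $A$. Formulas are built from $=,<$ between index terms and between number terms by Boolean connectives and quantification over $A$. Call this logic $\mathcal L=\mathrm{FO}_R[\mathrm{Arb}_R]+\mathrm{SUM}_R+\mathrm{PROD}_R$ (maximization and $\chi$ are definable in it). Relativized aggregators are $\mathrm{sum}_{\bar x}.(\varphi)t=\mathrm{sum}_{\bar x}(\chi[\varphi]\, t)$, likewise for $\mathrm{max}$, and $\mathrm{prod}_{\bar x}.(\varphi)t=\mathrm{prod}_{\bar x}(\chi[\varphi]\,t+\chi[\neg\varphi])$; the bounded ones restrict $\varphi$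 to the (at most) two lexicographically largest tuples satisfying $\varphi$. **Guarded functional recursion.** Read tuples over $A$ as base-$|A|$ numbers with digits $0,\dots,|A|-1$. $\mathcal L+\mathrm{GFR}^i_R$ extends the formation rules of $\mathcal L$ by formulas $$[f(\bar x,\bar y_1,\dots,\bar y_{i+1})\equiv t(\bar x,\bar y_1,\dots,\bar y_{i+1},f)]\,\psi(f),$$ where $\psi$ is an $\mathcal L$-formula that may use the new symbol $f$, $\bar y_1,\dots,\bar y_i$ have the same positive length, and $t$ is an $\mathcal L$ number term with free variables among those displayed, such that every occurrence of $f$ in $t$ has the form $f(\bar x,\bar z_1,\dots,\bar z_{i+1})$ with $\bar z_1,\dots,\bar z_{i+1}$ bound by a relativized aggregator (sum, prod or max) over $\bar z_1,\dots,\bar z_{i+1}$ with relativization $$\bigvee_{j=1}^{i}\Big(\bar z_j\le \bar y_j/2\ \wedge\ \bar z_j<\bar y_j\ \wedge\bigwedge_{k<j}\bar z_k\le\bar y_k\Big)\wedge\xi(\bar y_1,\dots,\bar y_{i+1},\bar z_1,\dots,\bar z_{i+1}),$$ where $\xi\in\mathcal L$ uses no symbol of $L_s\cup L_f$ (and not $f$),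 and $f$ occurs in the scope of no other aggregation or quantification in $t$. Such a formula holds if $\psi(f)$ holds for the (unique) function $f$ with $f(\bar a,\bar b)=t(\bar a,\bar b,f)$ for all $\bar a,\bar b$. In $\mathrm{GFR}^i_{R,\mathrm{bound}}$ the guarding aggregators are the bounded ones. A logic is identified with the class of sets $S\subseteq R^*$ for which there are a signature, a sentence and interpretations of $L_a$ such that $S$ is the set of the encodings of the structures that satisfy the sentence. **Theorem.** 1. For every $i\ge 0$: $\ \mathrm{AC}^i_R=\mathrm{FO}_R[\mathrm{Arb}_R]+\mathrm{SUM}_R+\mathrm{PROD}_R+\mathrm{GFR}^i_R$. 2. For every $i\ge 1$: $\ \mathrm{NC}^i_R=\mathrm{FO}_R[\mathrm{Arb}_R]+\mathrm{SUM}_R+\mathrm{PROD}_R+\mathrm{GFR}^i_{R,\mathrm{bound}}$. -/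

import Mathlib

open scoped BigOperators
open Asymptotics Filter

universe u v

namespace RCirc

/-! ## Algebraic circuits over an ordered integral domain

Throughout, the order on `R` is an arbitrary linear order; no compatibility with the ring
operations is assumed. -/

/-- `R^*`, the set of all finite tuples of elements of `R` (including the empty one). -/
abbrev RStar (R : Type u) : Type u := Σ n : ℕ, (Fin n → R)

/-- The possible labels, together with the predecessors, of a node in a circuit with `n` inputs
and `N` nodes.  A comparison node distinguishes its left and its right predecessor. -/
inductive Node (R : Type u) (n N : ℕ) : Type u
  | input (i : Fin n)
  | const (r : R)
  | add (P : Finset (Fin N))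
  | mul (P : Finset (Fin N))
  | lt (a b : Fin N)
  | output (a : Fin N)

/-- The set of predecessors of a node. -/
def Node.preds {R : Type u} {n N : ℕ} : Node R n N → Finset (Fin N)
  | .input _ => ∅
  | .const _ => ∅
  | .add P => P
  | .mul P => P
  | .lt a b => {a, b}
  | .output a => {a}

/-- An `R`-circuit with `n` input nodes and a single output node: a directed acyclic graph, whose
nodes are listed in a topological order. -/
structure Circuit (R : Type u) (n : ℕ) where
  size : ℕ
  node : Fin size → Node R n size
  /-- acyclicity: edges only lead from earlier to later nodes -/
  topological : ∀ g, ∀ p ∈ (node g).preds, p < g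
  add_indegree : ∀ g P, node g = .add P → P.Nonempty
  mul_indegree : ∀ g P, node g = .mul P → P.Nonempty
  /-- no node is twice a predecessor of the same node -/
  lt_indegree : ∀ g a b, node g = .lt a b → a ≠ b
  /-- there are exactly `n` input nodes, one for each input position -/
  input_unique : ∀ i : Fin n, ∃! g, node g = .input i
  out : Fin size
  /-- there is exactly one output node, namely `out` -/
  out_spec : ∀ g, (∃ a, node g = .output a) ↔ g = out

namespace Circuit

variable {R : Type u} {n : ℕ}

/-- The value of a node on the input `x`. -/
def val [CommRing R] [LinearOrder R] (C : Circuit R n) (x : Fin n → R) (g : Fin C.size) : R :=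
  match h : C.node g with
  | .input i => x i
  | .const r => r
  | .add P => ∑ p ∈ P.attach,
      have : p.1 < g := C.topological g p.1 (by rw [h]; exact p.2)
      C.val x p.1
  | .mul P => ∏ p ∈ P.attach,
      have : p.1 < g := C.topological g p.1 (by rw [h]; exact p.2)
      C.val x p.1
  | .lt a b =>
      have : a < g := C.topological g a (by rw [h]; simp [Node.preds])
      have : b < g := C.topological g b (by rw [h]; simp [Node.preds])
      if C.val x a < C.val x b then 1 else 0
  | .output a =>
      have : a < g := C.topological g a (by rw [h]; simp [Node.preds])
      C.val x a
termination_by g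

/-- The function `R^n → R` computed by the circuit. -/
def eval [CommRing R] [LinearOrder R] (C : Circuit R n) (x : Fin n → R) : R := C.val x C.out

/-- `C.Path g h k`: there is a directed path with `k` edges from `g` to `h`. -/
inductive Path (C : Circuit R n) (g : Fin C.size) : Fin C.size → ℕ → Prop
  | nil : Path C g g 0
  | cons {h h' : Fin C.size} {k : ℕ} : Path C g h k → h ∈ (C.node h').preds → Path C g h' (k + 1)

/-- The lengths of the paths from an input node to the output node. -/
def pathLengths (C : Circuit R n) : Set ℕ :=
  {k | ∃ i g, C.node g = .input i ∧ C.Path g C.out k}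

/-- The depth: the length of a longest path from an input node to the output node. -/
noncomputable def depth (C : Circuit R n) : ℕ := sSup C.pathLengths

theorem Path.le {C : Circuit R n} {g h : Fin C.size} {k : ℕ} (p : C.Path g h k) :
    g.val + k ≤ h.val := by
  induction p with
  | nil => simp
  | cons _ hm ih =>
    have := C.topological _ _ hm
    have : (_ : Fin C.size).val < _ := this
    omega

theorem bddAbove_pathLengths (C : Circuit R n) : BddAbove C.pathLengths := by
  refine ⟨C.size, ?_⟩
  rintro k ⟨i, g, -, p⟩
  have := p.le
  have := C.out.isLt
  omega

/-- Every addition and every multiplication node has at most two predecessors. -/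
def BoundedFanIn (C : Circuit R n) : Prop :=
  ∀ g P, (C.node g = .add P ∨ C.node g = .mul P) → P.card ≤ 2

end Circuit

/-- The circuit family `C` computes the characteristic function of `S`. -/
def Decides {R : Type u} [CommRing R] [LinearOrder R] (C : ∀ n, Circuit R n)
    (S : Set (RStar R)) : Prop :=
  ∀ (n : ℕ) (x : Fin n → R),
    ((⟨n, x⟩ : RStar R) ∈ S → (C n).eval x = 1) ∧ ((⟨n, x⟩ : RStar R) ∉ S → (C n).eval x = 0)

/-- The size of the family is `O(n^{O(1)})`. -/
def PolySize {R : Type u} (C : ∀ n, Circuit R n) : Prop :=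
  ∃ k : ℕ, (fun n : ℕ => ((C n).size : ℝ)) =O[atTop] (fun n : ℕ => (n : ℝ) ^ k)

/-- The depth of the family is `O((log₂ n)^i)`. -/
def PolylogDepth {R : Type u} (i : ℕ) (C : ∀ n, Circuit R n) : Prop :=
  (fun n : ℕ => ((C n).depth : ℝ)) =O[atTop] (fun n : ℕ => Real.logb 2 (n : ℝ) ^ i)

/-- The class `AC^i_R`. -/
def AC (R : Type u) [CommRing R] [LinearOrder R] (i : ℕ) : Set (Set (RStar R)) :=
  {S | ∃ C : ∀ n, Circuit R n, Decides C S ∧ PolySize C ∧ PolylogDepth i C}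

/-- The class `NC^i_R`. -/
def NC (R : Type u) [CommRing R] [LinearOrder R] (i : ℕ) : Set (Set (RStar R)) :=
  {S | ∃ C : ∀ n, Circuit R n,
    Decides C S ∧ PolySize C ∧ PolylogDepth i C ∧ ∀ n, (C n).BoundedFanIn}

/-! ## Syntax of first-order logic over `R` with sums, products and maxima

Formulas are well-scoped: `Formula V R E X` is the type of formulas whose free variables are among
the elements of the type `X`; binding a tuple indexed by `B` passes from `X` to `X ⊕ B`.  Arities of
function symbols are likewise given by index types. -/

/-- A vocabulary: function symbols with values in the universe (`Fn`) and function symbols with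
values in `R` (`Nm`), with their arities. -/
structure Vocab where
  Fn : Type
  fnAr : Fn → Type
  Nm : Type
  nmAr : Nm → Type

/-- Index terms, which take values in the universe. -/
inductive IdxTerm (V : Vocab) (X : Type) : Type
  | var (x : X) : IdxTerm V X
  | app (s : V.Fn) (h : V.fnAr s → IdxTerm V X) : IdxTerm V X

mutual

/-- Number terms, which take values in `R`.  `chi φ` is the characteristic function of `φ`;
`sum`, `prod`, `max` bind a tuple of `l` variables.  The family `E` provides further atomic
formulas. -/
inductive NumTerm (V : Vocab) (R : Type u) (E : Type → Type v) : Type → Type (max 1 u v)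
  | const {X : Type} (r : R) : NumTerm V R E X
  | app {X : Type} (s : V.Nm) (h : V.nmAr s → IdxTerm V X) : NumTerm V R E X
  | add {X : Type} (t₁ t₂ : NumTerm V R E X) : NumTerm V R E X
  | mul {X : Type} (t₁ t₂ : NumTerm V R E X) : NumTerm V R E X
  | sign {X : Type} (t : NumTerm V R E X) : NumTerm V R E X
  | chi {X : Type} (φ : Formula V R E X) : NumTerm V R E X
  | sum {X : Type} (l : ℕ) (t : NumTerm V R E (X ⊕ Fin l)) : NumTerm V R E X
  | prod {X : Type} (l : ℕ) (t : NumTerm V R E (X ⊕ Fin l)) : NumTerm V R E X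
  | max {X : Type} (l : ℕ) (t : NumTerm V R E (X ⊕ Fin l)) : NumTerm V R E X

/-- Formulas. The universe is ordered, and `idxLt` refers to this order. -/
inductive Formula (V : Vocab) (R : Type u) (E : Type → Type v) : Type → Type (max 1 u v)
  | idxEq {X : Type} (h₁ h₂ : IdxTerm V X) : Formula V R E X
  | idxLt {X : Type} (h₁ h₂ : IdxTerm V X) : Formula V R E X
  | numEq {X : Type} (t₁ t₂ : NumTerm V R E X) : Formula V R E X
  | numLt {X : Type} (t₁ t₂ : NumTerm V R E X) : Formula V R E X
  | not {X : Type} (φ : Formula V R E X) : Formula V R E X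
  | and {X : Type} (φ ψ : Formula V R E X) : Formula V R E X
  | or {X : Type} (φ ψ : Formula V R E X) : Formula V R E X
  | imp {X : Type} (φ ψ : Formula V R E X) : Formula V R E X
  | iff {X : Type} (φ ψ : Formula V R E X) : Formula V R E X
  | ex {X : Type} (φ : Formula V R E (X ⊕ Unit)) : Formula V R E X
  | all {X : Type} (φ : Formula V R E (X ⊕ Unit)) : Formula V R E X
  | extra {X : Type} (e : E X) : Formula V R E X

end

/-- The family without further atomic formulas. -/
abbrev NoExtra : Type → Type := fun _ => Empty

/-! ## Semantics -/

/-- An interpretation of a vocabulary in the ranked universe `{0, …, m - 1}`. -/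
structure Interp (V : Vocab) (R : Type u) (m : ℕ) where
  fn : ∀ s : V.Fn, (V.fnAr s → Fin m) → Fin m
  nm : ∀ s : V.Nm, (V.nmAr s → Fin m) → R

def IdxTerm.eval {V : Vocab} {R : Type u} {m : ℕ} (M : Interp V R m) {X : Type} :
    IdxTerm V X → (X → Fin m) → Fin m
  | .var x, ν => ν x
  | .app s h, ν => M.fn s (fun j => (h j).eval M ν)

/-- The characteristic value of a proposition in `R`. -/
noncomputable def chi (R : Type u) [CommRing R] (p : Prop) : R :=
  open Classical in if p then 1 else 0

/-- The maximum of finitely many values (`0` for an empty family, which can only arise in an empty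
universe). -/
noncomputable def maxOver {R : Type u} [CommRing R] [LinearOrder R] {ι : Type} [Fintype ι]
    (g : ι → R) : R :=
  open Classical in
  if h : (Finset.univ : Finset ι).Nonempty then Finset.univ.sup' h g else 0

section Semantics

variable {V : Vocab} {R : Type u} [CommRing R] [LinearOrder R] {E : Type → Type v} {m : ℕ}

mutual

noncomputable def NumTerm.eval (M : Interp V R m) (e : ∀ X : Type, E X → (X → Fin m) → Prop) :
    ∀ {X : Type}, NumTerm V R E X → (X → Fin m) → R
  | _, .const r, _ => r
  | _, .app s h, ν => M.nm s (fun j => (h j).eval M ν)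
  | _, .add t₁ t₂, ν => t₁.eval M e ν + t₂.eval M e ν
  | _, .mul t₁ t₂, ν => t₁.eval M e ν * t₂.eval M e ν
  | _, .sign t, ν => chi R (0 < t.eval M e ν)
  | _, .chi φ, ν => chi R ((φ.truth M e ν).down)
  | _, .sum l t, ν => ∑ a : Fin l → Fin m, t.eval M e (Sum.elim ν a)
  | _, .prod l t, ν => ∏ a : Fin l → Fin m, t.eval M e (Sum.elim ν a)
  | _, .max l t, ν => maxOver fun a : Fin l → Fin m => t.eval M e (Sum.elim ν a)

noncomputable def Formula.truth (M : Interp V R m) (e : ∀ X : Type, E X → (X → Fin m) → Prop) :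
    ∀ {X : Type}, Formula V R E X → (X → Fin m) → ULift.{u} Prop
  | _, .idxEq h₁ h₂, ν => ⟨h₁.eval M ν = h₂.eval M ν⟩
  | _, .idxLt h₁ h₂, ν => ⟨h₁.eval M ν < h₂.eval M ν⟩
  | _, .numEq t₁ t₂, ν => ⟨t₁.eval M e ν = t₂.eval M e ν⟩
  | _, .numLt t₁ t₂, ν => ⟨t₁.eval M e ν < t₂.eval M e ν⟩
  | _, .not φ, ν => ⟨¬ (φ.truth M e ν).down⟩
  | _, .and φ ψ, ν => ⟨(φ.truth M e ν).down ∧ (ψ.truth M e ν).down⟩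
  | _, .or φ ψ, ν => ⟨(φ.truth M e ν).down ∨ (ψ.truth M e ν).down⟩
  | _, .imp φ ψ, ν => ⟨(φ.truth M e ν).down → (ψ.truth M e ν).down⟩
  | _, .iff φ ψ, ν => ⟨(φ.truth M e ν).down ↔ (ψ.truth M e ν).down⟩
  | _, .ex φ, ν => ⟨∃ a : Fin m, (φ.truth M e (Sum.elim ν fun _ => a)).down⟩
  | _, .all φ, ν => ⟨∀ a : Fin m, (φ.truth M e (Sum.elim ν fun _ => a)).down⟩
  | X, .extra x, ν => ⟨e X x ν⟩

end

/-- `φ.Holds M e ν`: the formula `φ` is true under the assignment `ν`. -/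
def Formula.Holds (M : Interp V R m) (e : ∀ X : Type, E X → (X → Fin m) → Prop) {X : Type}
    (φ : Formula V R E X) (ν : X → Fin m) : Prop :=
  (φ.truth M e ν).down

end Semantics

/-- The (only) interpretation of the empty family of further atomic formulas. -/
def noExtra {m : ℕ} (X : Type) (x : NoExtra X) (_ : X → Fin m) : Prop := x.elim

/-! ## Guards -/

/-- The `k`-tuples over `{0, …, m - 1}` in lexicographic order, the first entry being the most
significant digit. -/
def tupleEquiv (m k : ℕ) : (Fin k → Fin m) ≃ Fin (m ^ k) :=
  (Equiv.arrowCongr Fin.revPerm (Equiv.refl (Fin m))).trans finFunctionFinEquiv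

/-- The numerical interpretation of a tuple as a base `m` number. -/
def num {m k : ℕ} (a : Fin k → Fin m) : ℕ := (tupleEquiv m k a).val

theorem num_eq_sum {m k : ℕ} (a : Fin k → Fin m) :
    num a = ∑ j : Fin k, (a j : ℕ) * m ^ (k - 1 - (j : ℕ)) := by
  unfold num tupleEquiv
  simp only [Equiv.trans_apply, finFunctionFinEquiv_apply]
  rw [← Equiv.sum_comp Fin.revPerm]
  refine Finset.sum_congr rfl fun j _ => ?_
  simp only [Equiv.arrowCongr_apply, Function.comp, Equiv.refl_apply, Fin.revPerm_symm,
    Fin.revPerm_apply, Fin.rev_rev, Fin.val_rev]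
  congr 2
  omega

/-- The index type of the variables in `ȳ₁, …, ȳᵢ, ȳᵢ₊₁`, where `ȳ₁, …, ȳᵢ` have length `w` and
`ȳᵢ₊₁` has length `r`. -/
abbrev Block (i w r : ℕ) : Type := (Fin i × Fin w) ⊕ Fin r

/-- The numerical interpretation of the `j`-th tuple of a block. -/
def digit {m i w r : ℕ} (b : Block i w r → Fin m) (j : Fin i) : ℕ :=
  num fun l : Fin w => b (.inl (j, l))

/-- `⋁ⱼ (z̄ⱼ ≤ ȳⱼ / 2 ∧ ⋀_{k < j} z̄ₖ ≤ ȳₖ)`, where halving is a proper decrease: a tuple with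
numerical interpretation `0` cannot be halved any further. -/
def Guard {m i w r : ℕ} (y z : Block i w r → Fin m) : Prop :=
  ∃ j : Fin i, digit z j + digit z j ≤ digit y j ∧ digit z j < digit y j ∧
    ∀ k < j, digit z k ≤ digit y k

/-- The lexicographic order on the tuples `(z̄₁, …, z̄ᵢ, z̄ᵢ₊₁)`. -/
def BlockLT {m i w r : ℕ} (a b : Block i w r → Fin m) : Prop :=
  Pi.Lex (Sum.Lex (Prod.Lex (· < ·) (· < ·)) (· < ·)) (· < ·) a b

/-- `z` is one of the (at most two) largest tuples that satisfy `φ`. -/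
def AmongTwoLargest {m i w r : ℕ} (φ : (Block i w r → Fin m) → Prop)
    (z : Block i w r → Fin m) : Prop :=
  φ z ∧ ∀ a b, a ≠ b → BlockLT z a → BlockLT z b → ¬ φ a ∨ ¬ φ b

/-! ## Aggregators -/

inductive Aggregator
  | sum
  | prod
  | max

/-- The relativized aggregator `A_z.(φ(z)) t(z)`. -/
noncomputable def Aggregator.relEval {R : Type u} [CommRing R] [LinearOrder R] {ι : Type}
    [Fintype ι] : Aggregator → (ι → Prop) → (ι → R) → R
  | .sum, φ, t => ∑ z, chi R (φ z) * t z
  | .prod, φ, t => ∏ z, (chi R (φ z) * t z + chi R (¬ φ z) * 1)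
  | .max, φ, t => maxOver fun z => chi R (φ z) * t z

/-! ## Number terms admissible in guarded recursion -/

mutual

/-- The number terms `t(x̄, ȳ, f)` in which every occurrence of `f` is of the form `f(x̄, z̄)`, where
the block `z̄` is bound by a guarded aggregation, and in which `f` does not occur in the scope of any
other aggregation or quantification.

`P` and `B` index the variables in `x̄` and in `ȳ = (ȳ₁, …, ȳᵢ₊₁)`; the elements of `D` stand for the
enclosing guarded aggregations, so that the variables of the bound blocks are indexed by `D × B`.
`pure` embeds the terms without `f`, which have no restriction and are over the vocabulary `V`.  The
formulas `ξ(ȳ, z̄)` are over the vocabulary `W`, which contains no symbols of the input structure. -/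
inductive RecTerm (V W : Vocab) (R : Type u) (P B : Type) : Type → Type (max 1 u)
  | pure {D : Type} (t : NumTerm V R NoExtra ((P ⊕ B) ⊕ (D × B))) : RecTerm V W R P B D
  | call {D : Type} (d : D) : RecTerm V W R P B D
  | add {D : Type} (t₁ t₂ : RecTerm V W R P B D) : RecTerm V W R P B D
  | mul {D : Type} (t₁ t₂ : RecTerm V W R P B D) : RecTerm V W R P B D
  | sign {D : Type} (t : RecTerm V W R P B D) : RecTerm V W R P B D
  | chi {D : Type} (φ : RecFormula V W R P B D) : RecTerm V W R P B D
  | guarded {D : Type} (A : Aggregator) (ξ : Formula W R NoExtra (B ⊕ B))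
      (t : RecTerm V W R P B (D ⊕ Unit)) : RecTerm V W R P B D

/-- The formulas that may occur in the terms `RecTerm` as arguments of characteristic functions. -/
inductive RecFormula (V W : Vocab) (R : Type u) (P B : Type) : Type → Type (max 1 u)
  | pure {D : Type} (φ : Formula V R NoExtra ((P ⊕ B) ⊕ (D × B))) : RecFormula V W R P B D
  | numEq {D : Type} (t₁ t₂ : RecTerm V W R P B D) : RecFormula V W R P B D
  | numLt {D : Type} (t₁ t₂ : RecTerm V W R P B D) : RecFormula V W R P B D
  | not {D : Type} (φ : RecFormula V W R P B D) : RecFormula V W R P B D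
  | and {D : Type} (φ ψ : RecFormula V W R P B D) : RecFormula V W R P B D
  | or {D : Type} (φ ψ : RecFormula V W R P B D) : RecFormula V W R P B D
  | imp {D : Type} (φ ψ : RecFormula V W R P B D) : RecFormula V W R P B D
  | iff {D : Type} (φ ψ : RecFormula V W R P B D) : RecFormula V W R P B D

end

section RecSemantics

variable {V W : Vocab} {R : Type u} [CommRing R] [LinearOrder R] {m i w r : ℕ} {P : Type}

/-- The tuples over which a guarded aggregation `A_z̄.(guard(ȳ, z̄) ∧ ξ(ȳ, z̄))` ranges; for a bounded
aggregation (`bounded = true`) only the two largest of them. -/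
def InRange (bounded : Bool) (N : Interp W R m) (ξ : Formula W R NoExtra (Block i w r ⊕ Block i w r))
    (y z : Block i w r → Fin m) : Prop :=
  match bounded with
  | false => Guard y z ∧ ξ.Holds N noExtra (Sum.elim y z)
  | true => AmongTwoLargest (fun z' => Guard y z' ∧ ξ.Holds N noExtra (Sum.elim y z')) z

mutual

/-- The value of `t(x̄, ȳ, f)`; `ζ` assigns values to the blocks bound by the enclosing guarded
aggregations. -/
noncomputable def RecTerm.eval (bounded : Bool) (M : Interp V R m) (N : Interp W R m)
    (f : (P → Fin m) → (Block i w r → Fin m) → R) (x : P → Fin m) (y : Block i w r → Fin m) :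
    ∀ {D : Type}, RecTerm V W R P (Block i w r) D → (D → Block i w r → Fin m) → R
  | _, .pure t, ζ => t.eval M noExtra (Sum.elim (Sum.elim x y) fun p => ζ p.1 p.2)
  | _, .call d, ζ => f x (ζ d)
  | _, .add t₁ t₂, ζ => t₁.eval bounded M N f x y ζ + t₂.eval bounded M N f x y ζ
  | _, .mul t₁ t₂, ζ => t₁.eval bounded M N f x y ζ * t₂.eval bounded M N f x y ζ
  | _, .sign t, ζ => chi R (0 < t.eval bounded M N f x y ζ)
  | _, .chi φ, ζ => chi R ((φ.truth bounded M N f x y ζ).down)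
  | _, .guarded A ξ t, ζ =>
      A.relEval (InRange bounded N ξ y)
        fun z => t.eval bounded M N f x y (Sum.elim ζ fun _ => z)

noncomputable def RecFormula.truth (bounded : Bool) (M : Interp V R m) (N : Interp W R m)
    (f : (P → Fin m) → (Block i w r → Fin m) → R) (x : P → Fin m) (y : Block i w r → Fin m) :
    ∀ {D : Type}, RecFormula V W R P (Block i w r) D → (D → Block i w r → Fin m) → ULift.{u} Prop
  | _, .pure φ, ζ => ⟨φ.Holds M noExtra (Sum.elim (Sum.elim x y) fun p => ζ p.1 p.2)⟩
  | _, .numEq t₁ t₂, ζ => ⟨t₁.eval bounded M N f x y ζ = t₂.eval bounded M N f x y ζ⟩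
  | _, .numLt t₁ t₂, ζ => ⟨t₁.eval bounded M N f x y ζ < t₂.eval bounded M N f x y ζ⟩
  | _, .not φ, ζ => ⟨¬ (φ.truth bounded M N f x y ζ).down⟩
  | _, .and φ ψ, ζ => ⟨(φ.truth bounded M N f x y ζ).down ∧ (ψ.truth bounded M N f x y ζ).down⟩
  | _, .or φ ψ, ζ => ⟨(φ.truth bounded M N f x y ζ).down ∨ (ψ.truth bounded M N f x y ζ).down⟩
  | _, .imp φ ψ, ζ => ⟨(φ.truth bounded M N f x y ζ).down → (ψ.truth bounded M N f x y ζ).down⟩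
  | _, .iff φ ψ, ζ => ⟨(φ.truth bounded M N f x y ζ).down ↔ (ψ.truth bounded M N f x y ζ).down⟩

end

/-- Truth of the formulas occurring in `t(x̄, ȳ, f)`. -/
def RecFormula.Holds (bounded : Bool) (M : Interp V R m) (N : Interp W R m)
    (f : (P → Fin m) → (Block i w r → Fin m) → R) (x : P → Fin m) (y : Block i w r → Fin m)
    {D : Type} (φ : RecFormula V W R P (Block i w r) D) (ζ : D → Block i w r → Fin m) : Prop :=
  (φ.truth bounded M N f x y ζ).down

/-- `f` satisfies the recursion `f(x̄, ȳ) = t(x̄, ȳ, f)`. -/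
def IsRecSolution (bounded : Bool) (M : Interp V R m) (N : Interp W R m)
    (t : RecTerm V W R P (Block i w r) Empty) (f : (P → Fin m) → (Block i w r → Fin m) → R) : Prop :=
  ∀ x y, f x y = t.eval bounded M N f x y fun d => d.elim

theorem wellFounded_guard : WellFounded fun z y : Block i w r → Fin m => Guard y z := by
  have hwf : WellFounded (Pi.Lex (· < ·) (fun {_ : Fin i} => (· < · : ℕ → ℕ → Prop))) :=
    Pi.Lex.wellFounded _ (fun _ => wellFounded_lt)
  refine Subrelation.wf (r := InvImage _ (fun b : Block i w r → Fin m => digit b))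
    (fun {z y} h => ?_) (InvImage.wf _ hwf)
  obtain ⟨j, -, hj, hk⟩ := h
  have hne : ∃ k, digit z k < digit y k ∧ ∀ l < k, ¬ digit z l < digit y l := by
    obtain ⟨k, hk1, hk2⟩ := (wellFounded_lt (α := Fin i)).has_min
      {k | digit z k < digit y k} ⟨j, hj⟩
    exact ⟨k, hk1, fun l hl h => hk2 l h hl⟩
  obtain ⟨k, hk1, hk2⟩ := hne
  have hkj : k ≤ j := by
    by_contra h
    exact hk2 j (not_le.mp h) hj
  refine ⟨k, fun l hl => ?_, hk1⟩
  exact le_antisymm (hk l (lt_of_lt_of_le hl hkj)) (not_lt.mp (hk2 l hl))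

theorem InRange.guard {bounded : Bool} {N : Interp W R m}
    {ξ : Formula W R NoExtra (Block i w r ⊕ Block i w r)} {y z : Block i w r → Fin m}
    (h : InRange bounded N ξ y z) : Guard y z := by
  cases bounded with
  | false => exact h.1
  | true => exact h.1.1

theorem Aggregator.relEval_congr {ι : Type} [Fintype ι] (A : Aggregator) {φ : ι → Prop}
    {s t : ι → R} (h : ∀ z, φ z → s z = t z) : A.relEval φ s = A.relEval φ t := by
  have h' : ∀ z, chi R (φ z) * s z = chi R (φ z) * t z := by
    intro z
    by_cases hz : φ z
    · rw [h z hz]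
    · simp [chi, hz]
  cases A <;> simp only [Aggregator.relEval, h']

mutual

theorem RecTerm.eval_congr (bounded : Bool) (M : Interp V R m) (N : Interp W R m)
    {f g : (P → Fin m) → (Block i w r → Fin m) → R} {x : P → Fin m} {y : Block i w r → Fin m}
    (hfg : ∀ z, Guard y z → f x z = g x z) :
    ∀ {D : Type} (t : RecTerm V W R P (Block i w r) D) (ζ : D → Block i w r → Fin m),
      (∀ d, Guard y (ζ d)) → t.eval bounded M N f x y ζ = t.eval bounded M N g x y ζ
  | _, .pure t, ζ, _ => by simp only [RecTerm.eval]
  | _, .call d, ζ, h => by simp only [RecTerm.eval]; exact hfg _ (h d)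
  | _, .add t₁ t₂, ζ, h => by
      simp only [RecTerm.eval, t₁.eval_congr bounded M N hfg ζ h, t₂.eval_congr bounded M N hfg ζ h]
  | _, .mul t₁ t₂, ζ, h => by
      simp only [RecTerm.eval, t₁.eval_congr bounded M N hfg ζ h, t₂.eval_congr bounded M N hfg ζ h]
  | _, .sign t, ζ, h => by
      simp only [RecTerm.eval, t.eval_congr bounded M N hfg ζ h]
  | _, .chi φ, ζ, h => by
      simp only [RecTerm.eval, φ.truth_congr bounded M N hfg ζ h]
  | _, .guarded A ξ t, ζ, h => by
      simp only [RecTerm.eval]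
      refine A.relEval_congr fun z hz => ?_
      refine t.eval_congr bounded M N hfg _ ?_
      rintro (d | u)
      · exact h d
      · exact hz.guard

theorem RecFormula.truth_congr (bounded : Bool) (M : Interp V R m) (N : Interp W R m)
    {f g : (P → Fin m) → (Block i w r → Fin m) → R} {x : P → Fin m} {y : Block i w r → Fin m}
    (hfg : ∀ z, Guard y z → f x z = g x z) :
    ∀ {D : Type} (φ : RecFormula V W R P (Block i w r) D) (ζ : D → Block i w r → Fin m),
      (∀ d, Guard y (ζ d)) → φ.truth bounded M N f x y ζ = φ.truth bounded M N g x y ζ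
  | _, .pure φ, ζ, _ => by simp only [RecFormula.truth]
  | _, .numEq t₁ t₂, ζ, h => by
      simp only [RecFormula.truth, t₁.eval_congr bounded M N hfg ζ h,
        t₂.eval_congr bounded M N hfg ζ h]
  | _, .numLt t₁ t₂, ζ, h => by
      simp only [RecFormula.truth, t₁.eval_congr bounded M N hfg ζ h,
        t₂.eval_congr bounded M N hfg ζ h]
  | _, .not φ, ζ, h => by
      simp only [RecFormula.truth, φ.truth_congr bounded M N hfg ζ h]
  | _, .and φ ψ, ζ, h => by
      simp only [RecFormula.truth, φ.truth_congr bounded M N hfg ζ h,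
        ψ.truth_congr bounded M N hfg ζ h]
  | _, .or φ ψ, ζ, h => by
      simp only [RecFormula.truth, φ.truth_congr bounded M N hfg ζ h,
        ψ.truth_congr bounded M N hfg ζ h]
  | _, .imp φ ψ, ζ, h => by
      simp only [RecFormula.truth, φ.truth_congr bounded M N hfg ζ h,
        ψ.truth_congr bounded M N hfg ζ h]
  | _, .iff φ ψ, ζ, h => by
      simp only [RecFormula.truth, φ.truth_congr bounded M N hfg ζ h,
        ψ.truth_congr bounded M N hfg ζ h]

end

/-- The recursion defines exactly one function. -/
theorem existsUnique_isRecSolution (bounded : Bool) (M : Interp V R m) (N : Interp W R m)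
    (t : RecTerm V W R P (Block i w r) Empty) : ∃! f, IsRecSolution bounded M N t f := by
  classical
  let F : (P → Fin m) → ∀ y : Block i w r → Fin m, (∀ z, Guard y z → R) → R := fun x y ih =>
    t.eval bounded M N (fun _ z => if h : Guard y z then ih z h else 0) x y fun d => d.elim
  let f : (P → Fin m) → (Block i w r → Fin m) → R := fun x => wellFounded_guard.fix (F x)
  have hf : IsRecSolution bounded M N t f := by
    intro x y
    have h1 : f x y = F x y fun z _ => f x z := WellFounded.fix_eq _ _ _
    rw [h1]
    refine t.eval_congr bounded M N (fun z hz => ?_) _ fun d => d.elim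
    simp [hz]
  refine ⟨f, hf, fun g hg => ?_⟩
  funext x y
  induction y using wellFounded_guard.induction with
  | _ y ih =>
    rw [hg x y, hf x y]
    exact t.eval_congr bounded M N (fun z hz => ih z hz) _ fun d => d.elim

end RecSemantics

/-! ## Signatures, structures and the extended logics -/

/-- A signature `(L_s, L_f, L_a)` of finite ordered vocabularies of function symbols: `L_s` with
values in the universe, `L_f` and the auxiliary vocabulary `L_a` with values in `R`.  At least one
symbol of the input structure has a table whose length depends on the universe, so that the size of
the universe is determined by the length of the encoding of a structure. -/
structure Signature where
  numS : ℕ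
  arS : Fin numS → ℕ
  numF : ℕ
  arF : Fin numF → ℕ
  numA : ℕ
  arA : Fin numA → ℕ
  nondegenerate : 0 < numS ∨ ∃ s, 0 < arF s

/-- The vocabulary of all symbols of a signature. -/
abbrev Signature.vocab (σ : Signature) : Vocab where
  Fn := Fin σ.numS
  fnAr s := Fin (σ.arS s)
  Nm := Fin σ.numF ⊕ Fin σ.numA
  nmAr s := Fin (Sum.elim σ.arF σ.arA s)

/-- The vocabulary of the auxiliary symbols only. -/
abbrev Signature.auxVocab (σ : Signature) : Vocab where
  Fn := Empty
  fnAr _ := Empty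
  Nm := Fin σ.numA
  nmAr s := Fin (σ.arA s)

/-- A vocabulary extended by one symbol with values in `R` whose arguments are indexed by `Q`. -/
abbrev Vocab.extend (V : Vocab) (Q : Type) : Vocab where
  Fn := V.Fn
  fnAr := V.fnAr
  Nm := V.Nm ⊕ Unit
  nmAr := Sum.elim V.nmAr fun _ => Q

/-- A (ranked) `R`-structure with universe `{0, …, m - 1}`. -/
structure RStructure (σ : Signature) (R : Type u) (m : ℕ) where
  fn : ∀ s : Fin σ.numS, (Fin (σ.arS s) → Fin m) → Fin m
  nm : ∀ s : Fin σ.numF, (Fin (σ.arF s) → Fin m) → R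

/-- The encoding of an `R`-structure as a tuple over `R`: functions with values in the universe are
replaced by the characteristic functions of their graphs, and the value tables of all functions, in
lexicographic order, are concatenated. -/
noncomputable def RStructure.encode {σ : Signature} {R : Type u} [CommRing R] {m : ℕ}
    (D : RStructure σ R m) : RStar R :=
  ⟨(∑ s, m ^ (σ.arS s + 1)) + ∑ s, m ^ σ.arF s,
    Fin.append
      (fun p =>
        let q := finSigmaFinEquiv.symm p
        let a := (tupleEquiv m (σ.arS q.1 + 1)).symm q.2
        chi R (D.fn q.1 (Fin.init a) = a (Fin.last _)))
      (fun p =>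
        let q := finSigmaFinEquiv.symm p
        D.nm q.1 ((tupleEquiv m (σ.arF q.1)).symm q.2))⟩

/-- Arbitrary functions interpreting the auxiliary symbols on a universe of size `m`. -/
abbrev ArbInterp (σ : Signature) (R : Type u) (m : ℕ) : Type u :=
  ∀ a : Fin σ.numA, (Fin (σ.arA a) → Fin m) → R

def RStructure.interp {σ : Signature} {R : Type u} {m : ℕ} (D : RStructure σ R m)
    (I : ArbInterp σ R m) : Interp σ.vocab R m where
  fn := D.fn
  nm := fun
    | .inl s => D.nm s
    | .inr a => I a

def auxInterp {σ : Signature} {R : Type u} {m : ℕ} (I : ArbInterp σ R m) :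
    Interp σ.auxVocab R m where
  fn s := s.elim
  nm := I

def Interp.extend {V : Vocab} {R : Type u} {m : ℕ} (M : Interp V R m) {Q : Type}
    (f : (Q → Fin m) → R) : Interp (V.extend Q) R m where
  fn := M.fn
  nm := fun
    | .inl s => M.nm s
    | .inr _ => f

/-- A formula `[f(x̄, ȳ₁, …, ȳᵢ, ȳᵢ₊₁) ≡ t(x̄, ȳ₁, …, ȳᵢ, ȳᵢ₊₁, f)] ψ(f)` with free variables in `X`:
`t` and `ψ` are a number term and a formula of `FO_R + SUM_R + PROD_R`. -/
structure GFR (σ : Signature) (R : Type u) (i : ℕ) (X : Type) : Type (max 1 u) where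
  /-- the length of `x̄` -/
  p : ℕ
  /-- the common length of `ȳ₁, …, ȳᵢ` -/
  w : ℕ
  w_pos : 0 < w
  /-- the length of `ȳᵢ₊₁` -/
  r : ℕ
  t : RecTerm σ.vocab σ.auxVocab R (Fin p) (Block i w r) Empty
  ψ : Formula (σ.vocab.extend (Fin p ⊕ Block i w r)) R NoExtra X

/-- Semantics of the recursion operator: `ψ` holds for the function `f` defined by the recursion
`f(x̄, ȳ) = t(x̄, ȳ, f)` (see `existsUnique_isRecSolution`). -/
def GFR.Holds {σ : Signature} {R : Type u} [CommRing R] [LinearOrder R] {i m : ℕ}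
    (bounded : Bool) (D : RStructure σ R m) (I : ArbInterp σ R m) (X : Type) (g : GFR σ R i X)
    (ν : X → Fin m) : Prop :=
  ∃ f : (Fin g.p → Fin m) → (Block i g.w g.r → Fin m) → R,
    IsRecSolution bounded (D.interp I) (auxInterp I) g.t f ∧
    g.ψ.Holds ((D.interp I).extend fun q => f (q ∘ Sum.inl) (q ∘ Sum.inr)) noExtra ν

/-- Sentences of `FO_R + SUM_R + PROD_R`, extended by the recursion operator. -/
abbrev Sentence (σ : Signature) (R : Type u) (i : ℕ) : Type (max 1 u) :=
  Formula σ.vocab R (GFR σ R i) Empty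

/-- `D ⊨ φ` when the auxiliary symbols are interpreted by `I`. -/
def Models {σ : Signature} {R : Type u} [CommRing R] [LinearOrder R] {i m : ℕ}
    (bounded : Bool) (D : RStructure σ R m) (I : ArbInterp σ R m) (φ : Sentence σ R i) : Prop :=
  φ.Holds (D.interp I) (GFR.Holds bounded D I) fun x => x.elim

/-- The sets definable by a sentence with arbitrary auxiliary functions, one interpretation for each
size of the universe (equivalently, for each length of the encoding). -/
def Definable (R : Type u) [CommRing R] [LinearOrder R] (i : ℕ) (bounded : Bool) :
    Set (Set (RStar R)) :=
  {S | ∃ (σ : Signature) (φ : Sentence σ R i) (I : ∀ m, ArbInterp σ R m), ∀ s : RStar R,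
    s ∈ S ↔ ∃ (m : ℕ) (D : RStructure σ R m), D.encode = s ∧ Models bounded D (I m) φ}

/-- `FO_R[Arb_R] + SUM_R + PROD_R + GFR^i_R`. -/
def FOArbGFR (R : Type u) [CommRing R] [LinearOrder R] (i : ℕ) : Set (Set (RStar R)) :=
  Definable R i false

/-- `FO_R[Arb_R] + SUM_R + PROD_R + GFR^i_{R,bound}`. -/
def FOArbGFRBound (R : Type u) [CommRing R] [LinearOrder R] (i : ℕ) : Set (Set (RStar R)) :=
  Definable R i true

end RCirc

universe w

namespace RCirc

/-! ## Straight line programs -/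

/-- The sum or the product over a finite set. -/
def bigOp {R : Type u} [CommRing R] {A : Type v} (mul : Bool) (P : Finset A) (f : A → R) : R :=
  if mul then ∏ p ∈ P, f p else ∑ p ∈ P, f p

section bigOp

variable {R : Type u} [CommRing R] {A A' : Type v} (o : Bool)

theorem bigOp_congr {P : Finset A} {f g : A → R} (h : ∀ p ∈ P, f p = g p) :
    bigOp o P f = bigOp o P g := by
  cases o
  · simpa [bigOp] using Finset.sum_congr rfl h
  · simpa [bigOp] using Finset.prod_congr rfl h

theorem bigOp_map {w : Type*} (e : A ↪ w) (P : Finset A) (f : w → R) :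
    bigOp o (P.map e) f = bigOp o P fun a => f (e a) := by
  cases o <;> simp [bigOp]

theorem bigOp_singleton (a : A) (f : A → R) : bigOp o {a} f = f a := by
  cases o <;> simp [bigOp]

theorem bigOp_empty (f : A → R) : bigOp o ∅ f = if o then 1 else 0 := by
  cases o <;> simp [bigOp]

theorem bigOp_disjUnion [DecidableEq A] {s t : Finset A} (h : Disjoint s t) (f : A → R) :
    bigOp o (s ∪ t) f = bigOp o (Finset.univ : Finset Bool)
      fun c => if c then bigOp o s f else bigOp o t f := by
  cases o
  · simp [bigOp, Finset.sum_union h]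
  · simp [bigOp, Finset.prod_union h]

end bigOp

section SLP

variable {R : Type u} [CommRing R] [LinearOrder R]

/-- The value of step `g` of a straight line program is obtained from inputs, constants and the
values of earlier steps of smaller depth. -/
inductive Justified (b : Bool) {n : ℕ} (fn : ℕ → (Fin n → R) → R) (dep : ℕ → ℕ) (g : ℕ) : Prop
  | input (i : Fin n) (h : ∀ x, fn g x = x i)
  | const (r : R) (h : ∀ x, fn g x = r)
  | arith (o : Bool) (P : Finset ℕ) (hne : P.Nonempty) (hlt : ∀ p ∈ P, p < g ∧ dep p < dep g)
      (hb : b = true → P.card ≤ 2) (h : ∀ x, fn g x = bigOp o P fun p => fn p x)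
  | lt (p q : ℕ) (hne : p ≠ q) (hp : p < g ∧ dep p < dep g) (hq : q < g ∧ dep q < dep g)
      (h : ∀ x, fn g x = if fn p x < fn q x then 1 else 0)

/-- Straight line programs, as lists of the functions that are computed and of their depths. -/
structure SLP (R : Type u) [CommRing R] [LinearOrder R] (b : Bool) (n : ℕ) where
  size : ℕ
  fn : ℕ → (Fin n → R) → R
  dep : ℕ → ℕ
  justified : ∀ g < size, Justified b fn dep g

namespace SLP

variable {b : Bool} {n : ℕ}

/-- The program with no steps. -/
def nil : SLP R b n := ⟨0, fun _ _ => 0, fun _ => 0, fun _ h => absurd h (Nat.not_lt_zero _)⟩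

/-- `Γ'` extends `Γ` by further steps. -/
def Ext (Γ Γ' : SLP R b n) : Prop :=
  Γ.size ≤ Γ'.size ∧ ∀ g < Γ.size, Γ'.fn g = Γ.fn g ∧ Γ'.dep g = Γ.dep g

theorem Ext.refl (Γ : SLP R b n) : Ext Γ Γ := ⟨le_rfl, fun _ _ => ⟨rfl, rfl⟩⟩

theorem Ext.trans {Γ₁ Γ₂ Γ₃ : SLP R b n} (h : Ext Γ₁ Γ₂) (h' : Ext Γ₂ Γ₃) : Ext Γ₁ Γ₃ :=
  ⟨h.1.trans h'.1, fun g hg => by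
    have h1 := h.2 g hg
    have h2 := h'.2 g (hg.trans_le h.1)
    exact ⟨h2.1.trans h1.1, h2.2.trans h1.2⟩⟩

end SLP

theorem Justified.congr {b : Bool} {n : ℕ} {fn fn' : ℕ → (Fin n → R) → R} {dep dep' : ℕ → ℕ}
    {g : ℕ} (h : Justified b fn dep g) (hfn : ∀ p ≤ g, fn' p = fn p)
    (hdep : ∀ p ≤ g, dep' p = dep p) : Justified b fn' dep' g := by
  cases h with
  | input i h => exact .input i (by rw [hfn g le_rfl]; exact h)
  | const r h => exact .const r (by rw [hfn g le_rfl]; exact h)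
  | arith o P hne hlt hb h =>
    refine .arith o P hne (fun p hp => ?_) hb fun x => ?_
    · rw [hdep g le_rfl, hdep p (hlt p hp).1.le]; exact hlt p hp
    · rw [hfn g le_rfl, h]
      exact bigOp_congr o fun p hp => by rw [hfn p (hlt p hp).1.le]
  | lt p q hne hp hq h =>
    refine .lt p q hne ?_ ?_ fun x => ?_
    · rw [hdep g le_rfl, hdep p hp.1.le]; exact hp
    · rw [hdep g le_rfl, hdep q hq.1.le]; exact hq
    · rw [hfn g le_rfl, hfn p hp.1.le, hfn q hq.1.le, h]

/-- A program can be extended by a further step. -/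
theorem SLP.exists_snoc {b : Bool} {n : ℕ} (Γ : SLP R b n) (f : (Fin n → R) → R) (d : ℕ)
    (h : Justified b (Function.update Γ.fn Γ.size f) (Function.update Γ.dep Γ.size d) Γ.size) :
    ∃ Γ' : SLP R b n, Γ.Ext Γ' ∧ Γ'.size = Γ.size + 1 ∧ Γ'.fn Γ.size = f ∧ Γ'.dep Γ.size = d := by
  refine ⟨⟨Γ.size + 1, Function.update Γ.fn Γ.size f, Function.update Γ.dep Γ.size d, ?_⟩,
    ⟨Nat.le_succ _, ?_⟩, rfl, by simp, by simp⟩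
  · intro g hg
    rcases Nat.lt_succ_iff_lt_or_eq.mp hg with hg | rfl
    · refine (Γ.justified g hg).congr (fun p hp => ?_) fun p hp => ?_ <;>
      · rw [Function.update_of_ne]; omega
    · exact h
  · intro g hg
    constructor <;> · dsimp only; rw [Function.update_of_ne]; omega

variable {b : Bool} {n : ℕ} {Y : Type v} (io : Y → Fin n → R)

/-- The program `Γ` computes `f` in depth at most `d`, on inputs of the form `io y`. -/
def SLP.Has (Γ : SLP R b n) (f : Y → R) (d : ℕ) : Prop :=
  ∃ g < Γ.size, (∀ y, Γ.fn g (io y) = f y) ∧ Γ.dep g ≤ d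

variable {io}

theorem SLP.Has.ext {Γ Γ' : SLP R b n} {f : Y → R} {d d' : ℕ} (h : Γ.Has io f d) (hΓ : Γ.Ext Γ')
    (hd : d ≤ d') : Γ'.Has io f d' := by
  obtain ⟨g, hg, hf, hdep⟩ := h
  exact ⟨g, hg.trans_le hΓ.1, fun y => by rw [(hΓ.2 g hg).1]; exact hf y,
    by rw [(hΓ.2 g hg).2]; exact hdep.trans hd⟩

variable (b io)

/-- Every program that computes the functions in `B` can be extended by at most `s` steps to a
program that computes `f` in depth at most `d`. -/
def Cost (B : Set ((Y → R) × ℕ)) (s d : ℕ) (f : Y → R) : Prop :=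
  ∀ Γ : SLP R b n, (∀ p ∈ B, Γ.Has io p.1 p.2) →
    ∃ Γ' : SLP R b n, Γ.Ext Γ' ∧ Γ'.size ≤ Γ.size + s ∧ Γ'.Has io f d

variable {b io} {B B' : Set ((Y → R) × ℕ)} {s d s' d' : ℕ} {f f' : Y → R}

theorem Cost.mono (h : Cost b io B s d f) (hs : s ≤ s') (hd : d ≤ d') : Cost b io B s' d' f := by
  intro Γ hΓ
  obtain ⟨Γ', h1, h2, h3⟩ := h Γ hΓ
  exact ⟨Γ', h1, by omega, h3.ext (.refl _) hd⟩

theorem Cost.base_mono (h : Cost b io B s d f)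
    (hB : ∀ p ∈ B, ∃ q ∈ B', q.1 = p.1 ∧ q.2 ≤ p.2) : Cost b io B' s d f := by
  intro Γ hΓ
  refine h Γ fun p hp => ?_
  obtain ⟨q, hq, h1, h2⟩ := hB p hp
  rw [← h1]
  exact (hΓ q hq).ext (.refl _) h2

theorem Cost.subset (h : Cost b io B s d f) (hB : B ⊆ B') : Cost b io B' s d f :=
  h.base_mono fun p hp => ⟨p, hB hp, rfl, le_rfl⟩

theorem cost_base (h : (f, d) ∈ B) : Cost b io B 0 d f := fun Γ hΓ =>
  ⟨Γ, .refl _, le_rfl, hΓ _ h⟩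

theorem cost_const (r : R) : Cost b io B 1 0 fun _ => r := by
  intro Γ _
  obtain ⟨Γ', h1, h2, h3, h4⟩ := Γ.exists_snoc (fun _ => r) 0 (.const r (by simp))
  exact ⟨Γ', h1, h2.le, Γ.size, by omega, by simp [h3], h4.le⟩

theorem cost_input (i : Fin n) : Cost b io B 1 0 fun y => io y i := by
  intro Γ _
  obtain ⟨Γ', h1, h2, h3, h4⟩ := Γ.exists_snoc (fun x => x i) 0 (.input i (by simp))
  exact ⟨Γ', h1, h2.le, Γ.size, by omega, by simp [h3], h4.le⟩

/-- Finitely many functions can be computed by distinct steps. -/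
theorem exists_steps {A : Type*} [DecidableEq A] (T : Finset A) (F : A → Y → R)
    (h : ∀ a ∈ T, Cost b io B s d (F a)) (Γ : SLP R b n) (hΓ : ∀ p ∈ B, Γ.Has io p.1 p.2) :
    ∃ Γ' : SLP R b n, Γ.Ext Γ' ∧ Γ'.size ≤ Γ.size + T.card * (s + 1) ∧
      ∃ pos : A → ℕ, Set.InjOn pos T ∧ ∀ a ∈ T, pos a < Γ'.size ∧
        (∀ y, Γ'.fn (pos a) (io y) = F a y) ∧ Γ'.dep (pos a) ≤ d + 1 := by
  induction T using Finset.induction_on with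
  | empty => exact ⟨Γ, .refl _, by simp, fun _ => 0, by simp, by simp⟩
  | insert a T ha ih =>
    obtain ⟨Γ₁, h1, hs1, pos, hinj, hpos⟩ := ih fun c hc => h c (Finset.mem_insert_of_mem hc)
    obtain ⟨Γ₂, h2, hs2, g, hg, hf, hdep⟩ := h a (Finset.mem_insert_self a T) Γ₁
      fun p hp => (hΓ p hp).ext h1 le_rfl
    obtain ⟨Γ₃, h3, hs3, hf3, hd3⟩ := Γ₂.exists_snoc (Γ₂.fn g) (Γ₂.dep g + 1)
      (.arith false {g} (by simp)
        (by
          intro p hp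
          rw [Finset.mem_singleton] at hp
          subst hp
          rw [Function.update_of_ne hg.ne, Function.update_self]
          exact ⟨hg, Nat.lt_succ_self _⟩)
        (by simp)
        (by
          intro x
          rw [bigOp_singleton, Function.update_of_ne hg.ne, Function.update_self]))
    refine ⟨Γ₃, (h1.trans h2).trans h3, ?_, Function.update pos a Γ₂.size, ?_, ?_⟩
    · rw [Finset.card_insert_of_notMem ha, hs3, add_mul]
      omega
    · have hlt : ∀ c ∈ T, pos c < Γ₂.size := fun c hc => (hpos c hc).1.trans_le h2.1
      have hne : ∀ c ∈ T, c ≠ a := fun c hc h => ha (h ▸ hc)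
      intro c hc c' hc' he
      rw [Finset.mem_coe, Finset.mem_insert] at hc hc'
      rcases hc with rfl | hc <;> rcases hc' with rfl | hc'
      · rfl
      · rw [Function.update_self, Function.update_of_ne (hne _ hc')] at he
        exact absurd he (hlt _ hc').ne'
      · rw [Function.update_self, Function.update_of_ne (hne _ hc)] at he
        exact absurd he (hlt _ hc).ne
      · rw [Function.update_of_ne (hne _ hc), Function.update_of_ne (hne _ hc')] at he
        exact hinj hc hc' he
    · intro c hc
      by_cases hca : c = a
      · subst hca
        rw [Function.update_self, hf3, hd3]
        exact ⟨by omega, hf, by omega⟩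
      · rw [Function.update_of_ne hca]
        obtain ⟨p1, p2, p3⟩ := hpos c (Finset.mem_of_mem_insert_of_ne hc hca)
        have h23 := (h2.trans h3).2 _ p1
        exact ⟨p1.trans_le (h2.trans h3).1, fun y => by rw [h23.1, p2], by rw [h23.2]; exact p3⟩

/-- A gate for a sum or a product. -/
theorem cost_bigOp_gate {A : Type*} (o : Bool) (T : Finset A) (F : A → Y → R)
    (h : ∀ a ∈ T, Cost b io B s d (F a)) (hb : b = true → T.card ≤ 2) :
    Cost b io B (T.card * (s + 1) + 1) (d + 2) fun y => bigOp o T fun a => F a y := by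
  classical
  rcases T.eq_empty_or_nonempty with rfl | hT
  · refine Cost.mono (s := 1) (d := 0) ?_ (by simp) (by simp)
    simpa only [bigOp_empty] using cost_const _
  intro Γ hΓ
  obtain ⟨Γ₁, h1, hs1, pos, hinj, hpos⟩ := exists_steps T F h Γ hΓ
  obtain ⟨Γ₂, h2, hs2, hf2, hd2⟩ := Γ₁.exists_snoc
      (fun x => bigOp o (T.image pos) fun p => Γ₁.fn p x) (d + 2)
      (.arith o (T.image pos) (hT.image pos)
        (by
          intro p hp
          obtain ⟨a, ha, rfl⟩ := Finset.mem_image.mp hp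
          rw [Function.update_of_ne (hpos a ha).1.ne, Function.update_self]
          exact ⟨(hpos a ha).1, Nat.lt_succ_of_le (hpos a ha).2.2⟩)
        (fun h => Finset.card_image_le.trans (hb h))
        (by
          intro x
          rw [Function.update_self]
          refine bigOp_congr o fun p hp => ?_
          obtain ⟨a, ha, rfl⟩ := Finset.mem_image.mp hp
          rw [Function.update_of_ne (hpos a ha).1.ne]))
  refine ⟨Γ₂, h1.trans h2, by omega, Γ₁.size, by omega, fun y => ?_, hd2.le⟩
  rw [hf2]
  cases o
  · simp only [bigOp, Bool.false_eq_true, if_false]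
    rw [Finset.sum_image hinj]
    exact Finset.sum_congr rfl fun a ha => (hpos a ha).2.1 y
  · simp only [bigOp, if_true]
    rw [Finset.prod_image hinj]
    exact Finset.prod_congr rfl fun a ha => (hpos a ha).2.1 y

theorem cost_bigOp_tree {A : Type} (o : Bool) (F : A → Y → R) (k : ℕ) (T : Finset A)
    (h : ∀ a ∈ T, Cost b io B s d (F a)) (hT : T.card ≤ 2 ^ k) :
    Cost b io B (2 ^ k * (s + 4) - 3) (d + 2 * k) fun y => bigOp o T fun a => F a y := by
  classical
  induction k generalizing T with
  | zero =>
    rw [pow_zero, one_mul, mul_zero, add_zero]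
    rw [pow_zero, Nat.le_one_iff_eq_zero_or_eq_one, Finset.card_eq_zero, Finset.card_eq_one] at hT
    rcases hT with rfl | ⟨a, rfl⟩
    · refine Cost.mono (s := 1) (d := 0) ?_ (by omega) (by omega)
      simpa only [bigOp_empty] using cost_const _
    · simp only [bigOp_singleton]
      exact (h a (by simp)).mono (by omega) le_rfl
  | succ k ih =>
    obtain ⟨T₁, hT₁, hc⟩ : ∃ T₁ ⊆ T, T₁.card = min T.card (2 ^ k) :=
      Finset.exists_subset_card_eq (min_le_left _ _)
    have hc₂ : (T \ T₁).card ≤ 2 ^ k := by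
      rw [Finset.card_sdiff_of_subset hT₁, hc]
      rw [pow_succ] at hT
      omega
    have h₁ := ih T₁ (fun a ha => h a (hT₁ ha)) (by omega)
    have h₂ := ih (T \ T₁) (fun a ha => h a (Finset.sdiff_subset ha)) hc₂
    have key := cost_bigOp_gate (b := b) (io := io) (B := B) o (Finset.univ : Finset Bool)
      (fun c y => if c then bigOp o T₁ fun a => F a y else bigOp o (T \ T₁) fun a => F a y)
      (s := 2 ^ k * (s + 4) - 3) (d := d + 2 * k)
      (by
        intro c _
        cases c
        · simpa using h₂
        · simpa using h₁)
      (by simp)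
    have he : (fun y => bigOp o T fun a => F a y) = fun y => bigOp o (Finset.univ : Finset Bool)
        fun c => if c then bigOp o T₁ fun a => F a y else bigOp o (T \ T₁) fun a => F a y := by
      funext y
      rw [← bigOp_disjUnion o Finset.disjoint_sdiff, Finset.union_sdiff_of_subset hT₁]
    rw [he]
    refine key.mono ?_ (by omega)
    have : 1 ≤ 2 ^ k := Nat.one_le_two_pow
    have h4 : 4 ≤ 2 ^ k * (s + 4) := by nlinarith
    rw [pow_succ, Finset.card_univ, Fintype.card_bool, mul_comm (2 ^ k) 2, mul_assoc]
    omega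

theorem cost_bigOp {A : Type} (o : Bool) (T : Finset A) (F : A → Y → R) (k : ℕ)
    (h : ∀ a ∈ T, Cost b io B s d (F a)) (hT : T.card ≤ 2 ^ k) :
    Cost b io B (2 ^ k * (s + 4)) (d + (2 + if b then 2 * k else 0))
      fun y => bigOp o T fun a => F a y := by
  cases b with
  | false =>
    refine (cost_bigOp_gate o T F h (by simp)).mono ?_ (by simp)
    have : 1 ≤ 2 ^ k := Nat.one_le_two_pow
    nlinarith
  | true =>
    refine (cost_bigOp_tree o F k T h hT).mono (Nat.sub_le _ _) ?_
    simp only [if_true]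
    omega

theorem cost_lt {f g : Y → R} (hf : Cost b io B s d f) (hg : Cost b io B s d g) :
    Cost b io B (2 * (s + 1) + 1) (d + 2) fun y => chi R (f y < g y) := by
  intro Γ hΓ
  obtain ⟨Γ₁, h1, hs1, pos, hinj, hpos⟩ := exists_steps (Finset.univ : Finset Bool)
    (fun c => if c then f else g) (by intro c _; cases c <;> simpa) Γ hΓ
  have ht := hpos true (by simp)
  have hf' := hpos false (by simp)
  simp only [if_true, Bool.false_eq_true, if_false] at ht hf'
  obtain ⟨Γ₂, h2, hs2, hf2, hd2⟩ := Γ₁.exists_snoc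
      (fun x => if Γ₁.fn (pos true) x < Γ₁.fn (pos false) x then 1 else 0) (d + 2)
      (.lt (pos true) (pos false) (fun he => by simpa using hinj (by simp) (by simp) he)
        ⟨ht.1, by
          rw [Function.update_of_ne ht.1.ne, Function.update_self]; exact Nat.lt_succ_of_le ht.2.2⟩
        ⟨hf'.1, by
          rw [Function.update_of_ne hf'.1.ne, Function.update_self]
          exact Nat.lt_succ_of_le hf'.2.2⟩
        (by
          intro x
          rw [Function.update_of_ne ht.1.ne, Function.update_of_ne hf'.1.ne,
            Function.update_self]))
  rw [Finset.card_univ, Fintype.card_bool] at hs1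
  refine ⟨Γ₂, h1.trans h2, by omega, Γ₁.size, by omega, fun y => ?_, hd2.le⟩
  rw [hf2]
  simp only [ht.2.1, hf'.2.1, chi]
  congr

/-- Functions that are computed from each other, according to a rank, need to be computed only
once. -/
theorem cost_of_rank {A : Type*} [Fintype A] (v : A → Y → R) (dv : A → ℕ) (rank : A → ℕ)
    (h : ∀ a, Cost b io (B ∪ {p | ∃ a', rank a' < rank a ∧ p = (v a', dv a')}) s (dv a) (v a))
    (hf : Cost b io (B ∪ Set.range fun a => (v a, dv a)) s' d f) :
    Cost b io B (Fintype.card A * (s + 1) + s') d f := by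
  classical
  intro Γ hΓ
  have key : ∀ k, ∃ Γ' : SLP R b n, Γ.Ext Γ' ∧
      Γ'.size ≤ Γ.size + (Finset.univ.filter fun a => rank a < k).card * (s + 1) ∧
      ∀ a, rank a < k → Γ'.Has io (v a) (dv a) := by
    intro k
    induction k with
    | zero => exact ⟨Γ, .refl _, by simp, by simp⟩
    | succ k ih =>
      obtain ⟨Γ₁, h1, hs1, hv⟩ := ih
      have key : ∀ T : Finset A, (∀ a ∈ T, rank a = k) → ∃ Γ' : SLP R b n, Γ₁.Ext Γ' ∧
          Γ'.size ≤ Γ₁.size + T.card * (s + 1) ∧ ∀ a ∈ T, Γ'.Has io (v a) (dv a) := by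
        intro T
        induction T using Finset.induction_on with
        | empty => exact fun _ => ⟨Γ₁, .refl _, by simp, by simp⟩
        | insert a T ha ih =>
          intro hT
          obtain ⟨Γ₂, h2, hs2, hv2⟩ := ih fun c hc => hT c (Finset.mem_insert_of_mem hc)
          obtain ⟨Γ₃, h3, hs3, hv3⟩ := h a Γ₂ (by
            rintro p (hp | ⟨a', ha', rfl⟩)
            · exact (hΓ p hp).ext (h1.trans h2) le_rfl
            · rw [hT a (Finset.mem_insert_self a T)] at ha'
              exact (hv a' ha').ext h2 le_rfl)
          refine ⟨Γ₃, h2.trans h3, ?_, fun c hc => ?_⟩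
          · rw [Finset.card_insert_of_notMem ha, add_mul]
            omega
          · rcases Finset.mem_insert.mp hc with rfl | hc
            · exact hv3
            · exact (hv2 c hc).ext h3 le_rfl
      obtain ⟨Γ₂, h2, hs2, hv2⟩ := key (Finset.univ.filter fun a => rank a = k) (by simp)
      refine ⟨Γ₂, h1.trans h2, ?_, fun a ha => ?_⟩
      · have : (Finset.univ.filter fun a => rank a < k + 1) =
            (Finset.univ.filter fun a => rank a < k) ∪ Finset.univ.filter fun a => rank a = k := by
          ext a
          simp only [Finset.mem_filter, Finset.mem_univ, true_and, Finset.mem_union]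
          omega
        rw [this, Finset.card_union_of_disjoint, add_mul]
        · omega
        · rw [Finset.disjoint_filter]
          intro a _ h1 h2
          omega
      · rcases Nat.lt_succ_iff_lt_or_eq.mp ha with ha | ha
        · exact (hv a ha).ext h2 le_rfl
        · exact hv2 a (by simpa using ha)
  obtain ⟨Γ₁, h1, hs1, hv⟩ := key (Finset.univ.sup rank + 1)
  obtain ⟨Γ₂, h2, hs2, hv2⟩ := hf Γ₁ (by
    rintro p (hp | ⟨a, rfl⟩)
    · exact (hΓ p hp).ext h1 le_rfl
    · exact hv a (Nat.lt_succ_of_le (Finset.le_sup (Finset.mem_univ a))))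
  refine ⟨Γ₂, h1.trans h2, ?_, hv2⟩
  have : (Finset.univ.filter fun a => rank a < Finset.univ.sup rank + 1).card ≤ Fintype.card A :=
    Finset.card_le_univ _
  have := Nat.mul_le_mul_right (s + 1) this
  omega

end SLP

/-! ## From straight line programs to circuits -/

theorem Circuit.depth_le {R : Type u} {n : ℕ} (C : Circuit R n) (dep : Fin C.size → ℕ)
    (h : ∀ g, ∀ p ∈ (C.node g).preds, dep p < dep g) : C.depth ≤ dep C.out := by
  have key : ∀ g g' k, C.Path g g' k → dep g + k ≤ dep g' := by
    intro g g' k p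
    induction p with
    | nil => simp
    | cons _ hm ih => have := h _ _ hm; omega
  rcases C.pathLengths.eq_empty_or_nonempty with he | hne
  · simp [Circuit.depth, he]
  · refine csSup_le hne ?_
    rintro k ⟨i, g, -, p⟩
    have := key _ _ _ p
    omega

section

variable {R : Type u} [CommRing R] [LinearOrder R]

/-- The value of a node, given the values of all nodes. -/
def Node.value {n N : ℕ} (x : Fin n → R) (v : Fin N → R) : Node R n N → R
  | .input i => x i
  | .const r => r
  | .add P => ∑ p ∈ P, v p
  | .mul P => ∏ p ∈ P, v p
  | .lt a b => if v a < v b then 1 else 0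
  | .output a => v a

theorem Circuit.val_eq {n : ℕ} (C : Circuit R n) (x : Fin n → R) (g : Fin C.size) :
    C.val x g = (C.node g).value x (C.val x) := by
  rw [Circuit.val]
  split <;> rename_i h <;> simp only [h, Node.value]
  · exact Finset.sum_attach _ _
  · exact Finset.prod_attach _ _

/-- The nodes that can be used for a step of a program. -/
structure GoodNode (b : Bool) {n N : ℕ} (q : ℕ) (dep : Fin N → ℕ) (d : ℕ) (nd : Node R n N) :
    Prop where
  lt : ∀ p ∈ nd.preds, p.1 < q ∧ dep p < d
  input : ∀ i, nd ≠ .input i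
  output : ∀ a, nd ≠ .output a
  add : ∀ P, nd = .add P → P.Nonempty ∧ (b = true → P.card ≤ 2)
  mul : ∀ P, nd = .mul P → P.Nonempty ∧ (b = true → P.card ≤ 2)
  ne : ∀ a c, nd = .lt a c → a ≠ c

theorem Justified.exists_node {b : Bool} {n : ℕ} {fn : ℕ → (Fin n → R) → R} {dep : ℕ → ℕ} {g N : ℕ}
    (h : Justified b fn dep g) (hN : n + g < N) :
    ∃ nd : Node R n N, GoodNode b (n + g)
        (fun q : Fin N => if q.1 < n then 0 else dep (q.1 - n) + 1) (dep g + 1) nd ∧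
      ∀ (x : Fin n → R) (v : Fin N → R), (∀ (i : Fin n) (hi : i.1 < N), v ⟨i, hi⟩ = x i) →
        (∀ (p : ℕ) (hp : n + p < N), p < g → v ⟨n + p, hp⟩ = fn p x) → nd.value x v = fn g x := by
  cases h with
  | input i h =>
    refine ⟨.add {⟨i, by omega⟩}, ⟨?_, by simp, by simp, ?_, by simp, by simp⟩, ?_⟩
    · intro p hp
      simp only [Node.preds, Finset.mem_singleton] at hp
      subst hp
      have := i.2
      simp only [Fin.is_lt, if_true]
      omega
    · rintro P ⟨⟩
      simp
    · intro x v hv _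
      simp only [Node.value, Finset.sum_singleton]
      rw [hv, h]
  | const r h =>
    exact ⟨.const r, ⟨by simp [Node.preds], by simp, by simp, by simp, by simp, by simp⟩,
      fun x v _ _ => by simp only [Node.value, h]⟩
  | arith o P hne hlt hb h =>
    classical
    let e : {p // p ∈ P} ↪ Fin N := ⟨fun p => ⟨n + p.1, by have := (hlt p.1 p.2).1; omega⟩, by
      intro p q hpq
      simp only [Fin.mk.injEq, Nat.add_left_cancel_iff] at hpq
      exact Subtype.ext hpq⟩
    have hP : ∀ p ∈ P.attach.map e, p.1 < n + g ∧
        (if p.1 < n then 0 else dep (p.1 - n) + 1) < dep g + 1 := by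
      intro p hp
      obtain ⟨p, -, rfl⟩ := Finset.mem_map.mp hp
      have := hlt p.1 p.2
      change n + p.1 < n + g ∧ (if n + p.1 < n then 0 else dep (n + p.1 - n) + 1) < dep g + 1
      rw [Nat.add_sub_cancel_left]
      rw [if_neg (by omega)]
      omega
    have hval : ∀ (x : Fin n → R) (v : Fin N → R),
        (∀ (p : ℕ) (hp : n + p < N), p < g → v ⟨n + p, hp⟩ = fn p x) →
        bigOp o (P.attach.map e) v = fn g x := by
      intro x v hv
      rw [h, bigOp_map]
      have : ∀ p : {p // p ∈ P}, v (e p) = fn p.1 x := fun p => hv _ _ (hlt p.1 p.2).1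
      simp only [this]
      cases o
      · exact Finset.sum_attach P fun p => fn p x
      · exact Finset.prod_attach P fun p => fn p x
    have hne' : (P.attach.map e).Nonempty := by simpa using hne
    have hb' : b = true → (P.attach.map e).card ≤ 2 := by simpa using hb
    cases o with
    | false =>
      refine ⟨.add (P.attach.map e), ⟨hP, by simp, by simp, ?_, by simp, by simp⟩, ?_⟩
      · rintro _ ⟨⟩
        exact ⟨hne', hb'⟩
      · exact fun x v _ hv => hval x v hv
    | true =>
      refine ⟨.mul (P.attach.map e), ⟨hP, by simp, by simp, by simp, ?_, by simp⟩, ?_⟩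
      · rintro _ ⟨⟩
        exact ⟨hne', hb'⟩
      · exact fun x v _ hv => hval x v hv
  | lt p q hne hp hq h =>
    refine ⟨.lt ⟨n + p, by omega⟩ ⟨n + q, by omega⟩, ⟨?_, by simp, by simp, by simp, by simp, ?_⟩, ?_⟩
    · intro r hr
      simp only [Node.preds, Finset.mem_insert, Finset.mem_singleton] at hr
      rcases hr with rfl | rfl
      all_goals
        simp only [Nat.add_sub_cancel_left]
        rw [if_neg (by omega)]
        omega
    · rintro a c ⟨⟩ h
      simp only [Fin.mk.injEq, Nat.add_left_cancel_iff] at h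
      exact hne h
    · intro x v _ hv
      simp only [Node.value, h, hv p _ hp.1, hv q _ hq.1]

theorem SLP.exists_circuit {b : Bool} {n : ℕ} (Γ : SLP R b n) {o : ℕ} (ho : o < Γ.size) :
    ∃ C : Circuit R n, C.size = n + Γ.size + 1 ∧ (∀ x, C.eval x = Γ.fn o x) ∧
      C.depth ≤ Γ.dep o + 2 ∧ (b = true → C.BoundedFanIn) := by
  classical
  set N := n + Γ.size + 1 with hN
  have key : ∀ g : Fin Γ.size, _ := fun g =>
    (Γ.justified g g.2).exists_node (N := N) (by omega)
  choose nd hnd hval using key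
  let node : Fin N → Node R n N := fun q =>
    if h : q.1 < n then .input ⟨q, h⟩ else
      if h' : q.1 < n + Γ.size then nd ⟨q - n, by omega⟩ else .output ⟨n + o, by omega⟩
  have node_input : ∀ (q : Fin N) (h : q.1 < n), node q = .input ⟨q, h⟩ := fun q h => by
    simp [node, h]
  have node_step : ∀ (p : ℕ) (h : p < Γ.size) (h' : n + p < N),
      node ⟨n + p, h'⟩ = nd ⟨p, h⟩ := fun p h h' => by
    simp [node, h]
  have node_out : ∀ (h : n + Γ.size < N), node ⟨n + Γ.size, h⟩ = .output ⟨n + o, by omega⟩ :=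
    fun h => by simp [node]
  have cases_node : ∀ q : Fin N, q.1 < n ∨ (∃ (p : ℕ) (h' : n + p < N), p < Γ.size ∧
      q = ⟨n + p, h'⟩) ∨ ∃ (h : n + Γ.size < N), q = ⟨n + Γ.size, h⟩ := by
    intro q
    by_cases h : q.1 < n
    · exact .inl h
    · by_cases h' : q.1 < n + Γ.size
      · exact .inr (.inl ⟨q - n, by omega, by omega, Fin.ext (by simp; omega)⟩)
      · exact .inr (.inr ⟨by omega, Fin.ext (by simp; omega)⟩)
  let dep : Fin N → ℕ := fun q => if q.1 < n then 0 else
    if q.1 < n + Γ.size then Γ.dep (q.1 - n) + 1 else Γ.dep o + 2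
  have hdep : ∀ g, ∀ p ∈ (node g).preds, p < g ∧ dep p < dep g := by
    intro g p hp
    rcases cases_node g with h | ⟨q, h', hq, rfl⟩ | ⟨h, rfl⟩
    · rw [node_input g h] at hp
      simp [Node.preds] at hp
    · rw [node_step q hq] at hp
      obtain ⟨h1, h2⟩ := (hnd ⟨q, hq⟩).lt p hp
      refine ⟨h1, ?_⟩
      simp only at h1
      have : dep p = if p.1 < n then 0 else Γ.dep (p.1 - n) + 1 := by
        simp only [dep]
        rw [if_pos (show p.1 < n + Γ.size by omega)]
      rw [this]
      simpa [dep, hq] using h2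
    · rw [node_out] at hp
      simp only [Node.preds, Finset.mem_singleton] at hp
      subst hp
      refine ⟨by rw [Fin.lt_def]; simpa using ho, ?_⟩
      simp [dep, ho]
  let C : Circuit R n :=
    { size := N
      node := node
      topological := fun g p hp => (hdep g p hp).1
      add_indegree := by
        intro g P hg
        rcases cases_node g with h | ⟨q, h', hq, rfl⟩ | ⟨h, rfl⟩
        · rw [node_input g h] at hg; cases hg
        · rw [node_step q hq] at hg
          exact ((hnd ⟨q, hq⟩).add P hg).1
        · rw [node_out] at hg; cases hg
      mul_indegree := by
        intro g P hg
        rcases cases_node g with h | ⟨q, h', hq, rfl⟩ | ⟨h, rfl⟩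
        · rw [node_input g h] at hg; cases hg
        · rw [node_step q hq] at hg
          exact ((hnd ⟨q, hq⟩).mul P hg).1
        · rw [node_out] at hg; cases hg
      lt_indegree := by
        intro g a c hg
        rcases cases_node g with h | ⟨q, h', hq, rfl⟩ | ⟨h, rfl⟩
        · rw [node_input g h] at hg; cases hg
        · rw [node_step q hq] at hg
          exact (hnd ⟨q, hq⟩).ne a c hg
        · rw [node_out] at hg; cases hg
      input_unique := by
        intro i
        refine ⟨⟨i, by omega⟩, node_input _ i.2, fun g hg => ?_⟩
        replace hg : node g = .input i := hg
        rcases cases_node g with h | ⟨q, h', hq, rfl⟩ | ⟨h, rfl⟩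
        · rw [node_input g h] at hg
          simp only [Node.input.injEq] at hg
          subst hg
          rfl
        · rw [node_step q hq] at hg
          exact absurd hg ((hnd ⟨q, hq⟩).input i)
        · rw [node_out] at hg; cases hg
      out := ⟨n + Γ.size, by omega⟩
      out_spec := by
        intro g
        constructor
        · rintro ⟨a, hg⟩
          rcases cases_node g with h | ⟨q, h', hq, rfl⟩ | ⟨h, rfl⟩
          · rw [node_input g h] at hg; cases hg
          · rw [node_step q hq] at hg
            exact absurd hg ((hnd ⟨q, hq⟩).output a)
          · rfl
        · rintro rfl
          exact ⟨_, node_out _⟩ }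
  have hin : ∀ (x : Fin n → R) (i : Fin n) (hi : i.1 < N), C.val x ⟨i, hi⟩ = x i := by
    intro x i hi
    rw [C.val_eq, show C.node ⟨i, hi⟩ = _ from node_input _ i.2]
    rfl
  have hv : ∀ (x : Fin n → R) (p : ℕ) (hp : n + p < N), p < Γ.size →
      C.val x ⟨n + p, hp⟩ = Γ.fn p x := by
    intro x p
    induction p using Nat.strong_induction_on with
    | _ p ih =>
      intro hp hpΓ
      rw [C.val_eq, show C.node ⟨n + p, hp⟩ = _ from node_step p hpΓ hp]
      exact hval ⟨p, hpΓ⟩ x _ (hin x) fun q hq hqp => ih q hqp hq (lt_trans hqp hpΓ)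
  refine ⟨C, rfl, fun x => ?_, ?_, ?_⟩
  · rw [Circuit.eval, C.val_eq, show C.node C.out = _ from node_out _]
    exact hv x o _ ho
  · refine (C.depth_le dep fun g p hp => (hdep g p hp).2).trans ?_
    simp [C, dep]
  · rintro hb g P hg
    rcases cases_node g with h | ⟨q, h', hq, rfl⟩ | ⟨h, rfl⟩
    · rw [show C.node g = _ from node_input g h] at hg
      rcases hg with hg | hg <;> cases hg
    · rw [show C.node _ = _ from node_step q hq h'] at hg
      rcases hg with hg | hg
      · exact ((hnd ⟨q, hq⟩).add P hg).2 hb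
      · exact ((hnd ⟨q, hq⟩).mul P hg).2 hb
    · rw [show C.node _ = _ from node_out h] at hg
      rcases hg with hg | hg <;> cases hg

end

/-! ## Closure properties of the functions of small cost -/

section

variable {R : Type u} [CommRing R]

theorem chi_true {p : Prop} (h : p) : chi R p = 1 := by simp [chi, h]

theorem chi_false {p : Prop} (h : ¬ p) : chi R p = 0 := by simp [chi, h]

theorem chi_not (p : Prop) : chi R (¬ p) = 1 + -1 * chi R p := by
  by_cases h : p <;> simp [chi, h]

theorem chi_and (p q : Prop) : chi R (p ∧ q) = chi R p * chi R q := by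
  by_cases h : p <;> by_cases h' : q <;> simp [chi, h, h']

theorem chi_forall {A : Type v} [Fintype A] (p : A → Prop) :
    chi R (∀ a, p a) = ∏ a, chi R (p a) := by
  by_cases h : ∀ a, p a
  · rw [chi_true h, Finset.prod_eq_one fun a _ => chi_true (h a)]
  · rw [chi_false h]
    obtain ⟨a, ha⟩ := not_forall.mp h
    rw [Finset.prod_eq_zero (Finset.mem_univ a) (chi_false ha)]

theorem sum_chi_mul {A : Type v} [Fintype A] (a₀ : A) (f : A → R) :
    ∑ a, chi R (a₀ = a) * f a = f a₀ := by
  rw [Finset.sum_eq_single a₀ (fun a _ h => by rw [chi_false (Ne.symm h), zero_mul])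
    (fun h => absurd (Finset.mem_univ _) h), chi_true rfl, one_mul]

variable [LinearOrder R]

theorem maxOver_eq_of_isGreatest {A : Type} [Fintype A] {g : A → R} {r : R}
    (h : IsGreatest (Set.range g) r) : maxOver g = r := by
  obtain ⟨⟨a, rfl⟩, hr⟩ := h
  have hne : (Finset.univ : Finset A).Nonempty := ⟨a, Finset.mem_univ a⟩
  rw [maxOver, dif_pos hne]
  exact le_antisymm (Finset.sup'_le _ _ fun c _ => hr ⟨c, rfl⟩) (Finset.le_sup' g (Finset.mem_univ a))

theorem maxOver_of_isEmpty {A : Type} [Fintype A] [IsEmpty A] (g : A → R) : maxOver g = 0 := by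
  rw [maxOver, dif_neg]
  simp

theorem maxOver_congr_range {A A' : Type} [Fintype A] [Fintype A'] {g : A → R} {g' : A' → R}
    (h : Set.range g = Set.range g') : maxOver g = maxOver g' := by
  classical
  rcases isEmpty_or_nonempty A with hA | hA
  · have : IsEmpty A' := by
      rw [← Set.range_eq_empty_iff (f := g'), ← h]
      exact Set.range_eq_empty g
    rw [maxOver_of_isEmpty, maxOver_of_isEmpty]
  · obtain ⟨a, -, ha⟩ := Finset.exists_max_image Finset.univ g Finset.univ_nonempty
    have hg : IsGreatest (Set.range g) (g a) :=
      ⟨⟨a, rfl⟩, by rintro _ ⟨c, rfl⟩; exact ha c (Finset.mem_univ c)⟩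
    rw [maxOver_eq_of_isGreatest hg, maxOver_eq_of_isGreatest (h ▸ hg)]

theorem maxOver_eq_sum {A : Type} [Fintype A] (e : A → ℕ) (he : Function.Injective e) (g : A → R) :
    maxOver g = ∑ a, chi R (∀ c, if e c < e a then g c < g a else ¬ g a < g c) * g a := by
  classical
  rcases isEmpty_or_nonempty A with hA | hA
  · rw [maxOver_of_isEmpty, Finset.univ_eq_empty, Finset.sum_empty]
  · obtain ⟨a, -, ha⟩ := Finset.exists_max_image Finset.univ g Finset.univ_nonempty
    obtain ⟨a₀, h₀, hmin⟩ := Finset.exists_min_image (Finset.univ.filter fun c => g c = g a) e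
      ⟨a, by simp⟩
    simp only [Finset.mem_filter, Finset.mem_univ, true_and] at h₀ hmin
    have hmax : ∀ c, g c ≤ g a₀ := fun c => h₀ ▸ ha c (Finset.mem_univ c)
    have hg : IsGreatest (Set.range g) (g a₀) := ⟨⟨a₀, rfl⟩, by rintro _ ⟨c, rfl⟩; exact hmax c⟩
    rw [maxOver_eq_of_isGreatest hg, Finset.sum_eq_single a₀]
    · rw [chi_true, one_mul]
      intro c
      split_ifs with hc
      · refine lt_of_le_of_ne (hmax c) fun h => ?_
        exact absurd (hmin c (h.trans h₀)) (not_le.mpr hc)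
      · exact not_lt.mpr (hmax c)
    · intro c _ hc
      rw [chi_false, zero_mul]
      intro h
      rcases lt_trichotomy (e a₀) (e c) with hlt | heq | hlt
      · have := h a₀
        rw [if_pos hlt] at this
        exact absurd (hmax c) (not_le.mpr this)
      · exact hc (he heq).symm
      · have h1 := h a₀
        rw [if_neg (not_lt.mpr hlt.le)] at h1
        have h2 : g c = g a₀ := le_antisymm (hmax c) (not_lt.mp h1)
        exact absurd (hmin c (h2.trans h₀)) (not_le.mpr hlt)
    · exact fun h => absurd (Finset.mem_univ _) h

/-- `f` can be computed from `B` with `S ^ c` steps and depth `d + c * u`. -/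
def Feasible (b : Bool) {n : ℕ} {Y : Type v} (io : Y → Fin n → R) (B : Set ((Y → R) × ℕ))
    (S d u c : ℕ) (f : Y → R) : Prop :=
  Cost b io B (S ^ c) (d + c * u) f

variable {b : Bool} {n : ℕ} {Y : Type v} {io : Y → Fin n → R} {B : Set ((Y → R) × ℕ)}
  {S d u c c' : ℕ} {f g : Y → R} {p q : Y → Prop}

theorem Feasible.mono (h : Feasible b io B S d u c f) (hS : 2 ≤ S) (hc : c ≤ c') :
    Feasible b io B S d u c' f :=
  Cost.mono h (Nat.pow_le_pow_right (by omega) hc)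
    (Nat.add_le_add_left (Nat.mul_le_mul_right u hc) d)

theorem feasible_const (hS : 2 ≤ S) (r : R) : Feasible b io B S d u 1 fun _ => r :=
  (cost_const r).mono (by rw [pow_one]; omega) (Nat.zero_le _)

theorem feasible_input (hS : 2 ≤ S) (i : Fin n) : Feasible b io B S d u 1 fun y => io y i :=
  (cost_input i).mono (by rw [pow_one]; omega) (Nat.zero_le _)

theorem feasible_base {d' : ℕ} (h : (f, d') ∈ B) (hd : d' ≤ d + c * u) :
    Feasible b io B S d u c f :=
  (cost_base h).mono (Nat.zero_le _) hd

theorem feasible_bigOp {A : Type} [Fintype A] (o : Bool) {F : A → Y → R} {a : ℕ} (hS : 2 ≤ S)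
    (hu : 1 ≤ u) (h : ∀ a, Feasible b io B S d u c (F a)) (hA : Fintype.card A ≤ S ^ a)
    (hb : b = true → Fintype.card A ≤ 2 ^ (a * u)) :
    Feasible b io B S d u (c + 2 * a + 4) fun y => bigOp o Finset.univ fun a => F a y := by
  set k := Nat.clog 2 (Fintype.card A) with hk
  have hk1 : Fintype.card A ≤ 2 ^ k := Nat.le_pow_clog one_lt_two _
  have hS1 : 1 ≤ S ^ a := Nat.one_le_pow _ _ (by omega)
  have hk2 : 2 ^ k ≤ S ^ (a + 1) := by
    rcases Nat.lt_or_ge 1 (Fintype.card A) with h1 | h1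
    · have hk0 : 0 < k := Nat.clog_pos one_lt_two h1
      have hlt : 2 ^ (k - 1) < Fintype.card A := Nat.pow_pred_clog_lt_self one_lt_two h1
      obtain ⟨k', hk'⟩ := Nat.exists_eq_succ_of_ne_zero hk0.ne'
      rw [hk'] at hlt ⊢
      rw [Nat.succ_sub_one] at hlt
      rw [pow_succ, pow_succ]
      exact Nat.mul_le_mul (hlt.le.trans hA) hS
    · have : k = 0 := Nat.clog_of_right_le_one h1 2
      rw [this]
      exact Nat.one_le_pow _ _ (by omega)
  refine (cost_bigOp o Finset.univ F k (fun a _ => h a) hk1).mono ?_ ?_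
  · have h1 : 1 ≤ S ^ c := Nat.one_le_pow _ _ (by omega)
    have h8 : 8 ≤ S ^ 3 := Nat.pow_le_pow_left hS 3
    calc 2 ^ k * (S ^ c + 4) ≤ S ^ (a + 1) * (S ^ c * S ^ 3) := Nat.mul_le_mul hk2 (by nlinarith)
      _ = S ^ (a + 1 + (c + 3)) := by rw [← pow_add, ← pow_add]
      _ ≤ S ^ (c + 2 * a + 4) := Nat.pow_le_pow_right (by omega) (by omega)
  · have h1 : (2 + if b then 2 * k else 0) ≤ (2 * a + 2) * u := by
      split_ifs with h
      · have : k ≤ a * u := Nat.clog_le_of_le_pow (hb h)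
        nlinarith
      · nlinarith
    nlinarith

theorem feasible_sum {A : Type} [Fintype A] {F : A → Y → R} {a : ℕ} (hS : 2 ≤ S) (hu : 1 ≤ u)
    (h : ∀ a, Feasible b io B S d u c (F a)) (hA : Fintype.card A ≤ S ^ a)
    (hb : b = true → Fintype.card A ≤ 2 ^ (a * u)) :
    Feasible b io B S d u (c + 2 * a + 4) fun y => ∑ a, F a y :=
  feasible_bigOp false hS hu h hA hb

theorem feasible_prod {A : Type} [Fintype A] {F : A → Y → R} {a : ℕ} (hS : 2 ≤ S) (hu : 1 ≤ u)
    (h : ∀ a, Feasible b io B S d u c (F a)) (hA : Fintype.card A ≤ S ^ a)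
    (hb : b = true → Fintype.card A ≤ 2 ^ (a * u)) :
    Feasible b io B S d u (c + 2 * a + 4) fun y => ∏ a, F a y :=
  feasible_bigOp true hS hu h hA hb

theorem feasible_op_bool (o : Bool) (hS : 2 ≤ S) (hu : 1 ≤ u) (hf : Feasible b io B S d u c f)
    (hg : Feasible b io B S d u c' g) :
    Feasible b io B S d u (c + c' + 6)
      fun y => bigOp o (Finset.univ : Finset Bool) fun a : Bool => if a then f y else g y := by
  refine feasible_bigOp (F := fun (a : Bool) y => if a then f y else g y) (a := 1) (c := c + c') o hS hu ?_
    (by simpa using hS) fun _ => ?_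
  · intro a
    cases a
    · simpa using hg.mono hS (Nat.le_add_left _ _)
    · simpa using hf.mono hS (Nat.le_add_right _ _)
  · simpa using Nat.pow_le_pow_right (show 0 < 2 by norm_num) hu

theorem Feasible.add (hf : Feasible b io B S d u c f) (hg : Feasible b io B S d u c' g)
    (hS : 2 ≤ S) (hu : 1 ≤ u) : Feasible b io B S d u (c + c' + 6) fun y => f y + g y := by
  simpa [bigOp] using feasible_op_bool false hS hu hf hg

theorem Feasible.mul (hf : Feasible b io B S d u c f) (hg : Feasible b io B S d u c' g)
    (hS : 2 ≤ S) (hu : 1 ≤ u) : Feasible b io B S d u (c + c' + 6) fun y => f y * g y := by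
  simpa [bigOp] using feasible_op_bool true hS hu hf hg

theorem Feasible.lt (hf : Feasible b io B S d u c f) (hg : Feasible b io B S d u c' g)
    (hS : 2 ≤ S) (hu : 1 ≤ u) :
    Feasible b io B S d u (c + c' + 4) fun y => chi R (f y < g y) := by
  refine (cost_lt (hf.mono hS (Nat.le_add_right c c'))
    (hg.mono hS (Nat.le_add_left c' c))).mono ?_ ?_
  · have h1 : 1 ≤ S ^ (c + c') := Nat.one_le_pow _ _ (by omega)
    have h8 : 16 ≤ S ^ 4 := Nat.pow_le_pow_left hS 4
    rw [pow_add _ _ 4]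
    nlinarith
  · nlinarith

theorem Feasible.not (hp : Feasible b io B S d u c fun y => chi R (p y)) (hS : 2 ≤ S)
    (hu : 1 ≤ u) : Feasible b io B S d u (c + 14) fun y => chi R (¬ p y) := by
  simp only [chi_not]
  exact ((feasible_const hS 1).add ((feasible_const hS (-1)).mul hp hS hu) hS hu).mono hS (by omega)

theorem Feasible.and (hp : Feasible b io B S d u c fun y => chi R (p y))
    (hq : Feasible b io B S d u c' fun y => chi R (q y)) (hS : 2 ≤ S) (hu : 1 ≤ u) :
    Feasible b io B S d u (c + c' + 6) fun y => chi R (p y ∧ q y) := by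
  simp only [chi_and]
  exact hp.mul hq hS hu

theorem Feasible.or (hp : Feasible b io B S d u c fun y => chi R (p y))
    (hq : Feasible b io B S d u c' fun y => chi R (q y)) (hS : 2 ≤ S) (hu : 1 ≤ u) :
    Feasible b io B S d u (c + c' + 48) fun y => chi R (p y ∨ q y) := by
  simp only [or_iff_not_and_not]
  exact (((hp.not hS hu).and (hq.not hS hu) hS hu).not hS hu).mono hS (by omega)

theorem Feasible.imp (hp : Feasible b io B S d u c fun y => chi R (p y))
    (hq : Feasible b io B S d u c' fun y => chi R (q y)) (hS : 2 ≤ S) (hu : 1 ≤ u) :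
    Feasible b io B S d u (c + c' + 62) fun y => chi R (p y → q y) := by
  have : ∀ y, (p y → q y) = (¬ p y ∨ q y) := fun y => propext imp_iff_not_or
  simp only [this]
  exact ((hp.not hS hu).or hq hS hu).mono hS (by omega)

theorem Feasible.iff (hp : Feasible b io B S d u c fun y => chi R (p y))
    (hq : Feasible b io B S d u c' fun y => chi R (q y)) (hS : 2 ≤ S) (hu : 1 ≤ u) :
    Feasible b io B S d u (2 * (c + c') + 130) fun y => chi R (p y ↔ q y) := by
  simp only [iff_iff_implies_and_implies]
  exact ((hp.imp hq hS hu).and (hq.imp hp hS hu) hS hu).mono hS (by omega)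

theorem Feasible.eq (hf : Feasible b io B S d u c f) (hg : Feasible b io B S d u c' g)
    (hS : 2 ≤ S) (hu : 1 ≤ u) :
    Feasible b io B S d u (2 * (c + c') + 42) fun y => chi R (f y = g y) := by
  have : ∀ y, (f y = g y) = (¬ f y < g y ∧ ¬ g y < f y) := fun y => by
    rw [not_lt, not_lt, eq_iff_iff]
    exact ⟨fun h => ⟨h.ge, h.le⟩, fun h => le_antisymm h.2 h.1⟩
  simp only [this]
  exact (((hf.lt hg hS hu).not hS hu).and ((hg.lt hf hS hu).not hS hu) hS hu).mono hS (by omega)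

theorem feasible_forall {A : Type} [Fintype A] {P : A → Y → Prop} {a : ℕ} (hS : 2 ≤ S) (hu : 1 ≤ u)
    (h : ∀ a, Feasible b io B S d u c fun y => chi R (P a y)) (hA : Fintype.card A ≤ S ^ a)
    (hb : b = true → Fintype.card A ≤ 2 ^ (a * u)) :
    Feasible b io B S d u (c + 2 * a + 4) fun y => chi R (∀ a, P a y) := by
  simp only [chi_forall]
  exact feasible_prod hS hu h hA hb

theorem feasible_exists {A : Type} [Fintype A] {P : A → Y → Prop} {a : ℕ} (hS : 2 ≤ S) (hu : 1 ≤ u)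
    (h : ∀ a, Feasible b io B S d u c fun y => chi R (P a y)) (hA : Fintype.card A ≤ S ^ a)
    (hb : b = true → Fintype.card A ≤ 2 ^ (a * u)) :
    Feasible b io B S d u (c + 2 * a + 32) fun y => chi R (∃ a, P a y) := by
  have : ∀ y, (∃ a, P a y) = ¬ ∀ a, ¬ P a y := fun y => by simp
  simp only [this]
  exact ((feasible_forall hS hu (fun a => (h a).not hS hu) hA hb).not hS hu).mono hS (by omega)

theorem feasible_max {A : Type} [Fintype A] {F : A → Y → R} {a : ℕ} (hS : 2 ≤ S) (hu : 1 ≤ u)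
    (h : ∀ a, Feasible b io B S d u c (F a)) (hA : Fintype.card A ≤ S ^ a)
    (hb : b = true → Fintype.card A ≤ 2 ^ (a * u)) :
    Feasible b io B S d u (3 * c + 4 * a + 32) fun y => maxOver fun a => F a y := by
  classical
  let e : A → ℕ := fun a => Fintype.equivFin A a
  have he : Function.Injective e := Fin.val_injective.comp (Fintype.equivFin A).injective
  simp only [maxOver_eq_sum e he]
  refine (feasible_sum (c := 3 * c + 2 * a + 28) hS hu (fun a' => ?_) hA hb).mono hS (by omega)
  refine Feasible.mono (Feasible.mul (feasible_forall (c := 2 * c + 18) hS hu (fun c' => ?_) hA hb)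
    (h a') hS hu) hS (by omega)
  by_cases hlt : e c' < e a'
  · simp only [hlt, if_true]
    exact ((h c').lt (h a') hS hu).mono hS (by omega)
  · simp only [hlt, if_false]
    exact (((h a').lt (h c') hS hu).not hS hu).mono hS (by omega)

end

/-! ## Number terms and formulas are computed by circuits -/

section

variable {R : Type u} [CommRing R] [LinearOrder R]

/-- The functions `F m j` can be computed from `B m` with `m ^ O(1)` steps and depth
`O(u m)`. -/
def PolyFeasible (b : Bool) {n : ℕ → ℕ} {Y : ℕ → Type v} (io : ∀ m, Y m → Fin (n m) → R)
    (B : ∀ m, Set ((Y m → R) × ℕ)) (u : ℕ → ℕ) {J : ℕ → Type w} (F : ∀ m, J m → Y m → R) : Prop :=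
  ∃ c, ∀ m j, Feasible b (io m) (B m) (m + 2) 0 (u m) c (F m j)

/-- The unit `u` for the depth allows for binary trees with polynomially many leaves. -/
structure DepthUnit (b : Bool) (u : ℕ → ℕ) : Prop where
  one_le : ∀ m, 1 ≤ u m
  le_two_pow : b = true → ∀ m, m + 2 ≤ 2 ^ u m

theorem card_tuples_le {A : Type} [Fintype A] [DecidableEq A] (m : ℕ) :
    Fintype.card (A → Fin m) ≤ (m + 2) ^ Fintype.card A := by
  rw [Fintype.card_fun, Fintype.card_fin]
  exact Nat.pow_le_pow_left (Nat.le_add_right m 2) _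

theorem DepthUnit.card_tuples_le {b : Bool} {u : ℕ → ℕ} (hu : DepthUnit b u) {A : Type} [Fintype A]
    [DecidableEq A] (m : ℕ) (hb : b = true) :
    Fintype.card (A → Fin m) ≤ 2 ^ (Fintype.card A * u m) := by
  rw [Fintype.card_fun, Fintype.card_fin, mul_comm, pow_mul]
  exact Nat.pow_le_pow_left ((Nat.le_add_right m 2).trans (hu.le_two_pow hb m)) _

theorem DepthUnit.card_fin_le {b : Bool} {u : ℕ → ℕ} (hu : DepthUnit b u) (m : ℕ) (hb : b = true) :
    Fintype.card (Fin m) ≤ 2 ^ (1 * u m) := by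
  rw [Fintype.card_fin, one_mul]
  exact (Nat.le_add_right m 2).trans (hu.le_two_pow hb m)

theorem card_fin_le (m : ℕ) : Fintype.card (Fin m) ≤ (m + 2) ^ 1 := by
  rw [Fintype.card_fin, pow_one]
  exact Nat.le_add_right m 2

theorem le_pow_self (m k : ℕ) : k ≤ (m + 2) ^ k :=
  (Nat.lt_two_pow_self).le.trans (Nat.pow_le_pow_left (Nat.le_add_left 2 m) k)

theorem le_two_pow_mul {u : ℕ} (hu : 1 ≤ u) (k : ℕ) : k ≤ 2 ^ (k * u) :=
  (Nat.lt_two_pow_self).le.trans (Nat.pow_le_pow_right two_pos (Nat.le_mul_of_pos_right k hu))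

variable {b : Bool} {n : ℕ → ℕ} {Y : ℕ → Type v} {io : ∀ m, Y m → Fin (n m) → R}
  {B : ∀ m, Set ((Y m → R) × ℕ)} {u : ℕ → ℕ} {V : Vocab} {M : ∀ m, Y m → Interp V R m}

theorem PolyFeasible.exists_uniform {A : Type*} [Finite A] {J : ℕ → Type w}
    {F : A → ∀ m, J m → Y m → R} (h : ∀ a, PolyFeasible b io B u (F a)) :
    ∃ c, ∀ a m j, Feasible b (io m) (B m) (m + 2) 0 (u m) c (F a m j) := by
  cases nonempty_fintype A
  choose c hc using h
  exact ⟨∑ a, c a, fun a m j => (hc a m j).mono (by omega)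
    (Finset.single_le_sum (fun _ _ => Nat.zero_le _) (Finset.mem_univ a))⟩

theorem PolyFeasible.subst (hu : DepthUnit b u) {A : Type} [Fintype A] {J : ℕ → Type w}
    {f : ∀ m, (A → Fin m) → Y m → R} (hf : PolyFeasible b io B u f)
    {g : ∀ m, J m → Y m → A → Fin m}
    (hg : ∀ a, PolyFeasible b io B u (J := fun m => J m × Fin m)
      fun m p y => chi R (g m p.1 y a = p.2)) :
    PolyFeasible b io B u fun m j y => f m (g m j y) y := by
  classical
  obtain ⟨c, hc⟩ := PolyFeasible.exists_uniform hg
  obtain ⟨c', hc'⟩ := hf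
  refine ⟨c + 2 * Fintype.card A + 4 + c' + 6 + 2 * Fintype.card A + 4, fun m j => ?_⟩
  have : ∀ y, f m (g m j y) y = ∑ a : A → Fin m, (∏ i, chi R (g m j y i = a i)) * f m a y := by
    intro y
    rw [← sum_chi_mul (g m j y) fun a => f m a y]
    refine Finset.sum_congr rfl fun a _ => ?_
    rw [← chi_forall, funext_iff]
  simp only [this]
  refine feasible_sum (by omega) (hu.one_le m) (fun a => ?_) (RCirc.card_tuples_le m)
    (hu.card_tuples_le m)
  exact (feasible_prod (by omega) (hu.one_le m) (fun i => hc i m (j, a i)) (le_pow_self _ _)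
    (fun _ => le_two_pow_mul (hu.one_le m) _)).mul (hc' m a) (by omega) (hu.one_le m)

theorem IdxTerm.polyFeasible (hu : DepthUnit b u) [∀ s, Fintype (V.fnAr s)]
    (hfn : ∀ s, PolyFeasible b io B u (J := fun m => (V.fnAr s → Fin m) × Fin m)
      fun m p y => chi R ((M m y).fn s p.1 = p.2)) {X : Type} :
    ∀ h : IdxTerm V X, PolyFeasible b io B u (J := fun m => (X → Fin m) × Fin m)
      fun m p y => chi R (h.eval (M m y) p.1 = p.2)
  | .var x => ⟨1, fun m p => by
      simp only [IdxTerm.eval]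
      exact feasible_const (by omega) _⟩
  | .app s h => by
      classical
      simp only [IdxTerm.eval]
      have ih := fun j => IdxTerm.polyFeasible hu hfn (h j)
      obtain ⟨c, hc⟩ := PolyFeasible.exists_uniform ih
      obtain ⟨c', hc'⟩ := hfn s
      refine ⟨c + 2 * Fintype.card (V.fnAr s) + 4 + c' + 6 + 2 * Fintype.card (V.fnAr s) + 4,
        fun m p => ?_⟩
      have : ∀ y, chi R ((M m y).fn s (fun j => (h j).eval (M m y) p.1) = p.2) =
          ∑ a : V.fnAr s → Fin m, (∏ i, chi R ((h i).eval (M m y) p.1 = a i)) *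
            chi R ((M m y).fn s a = p.2) := by
        intro y
        rw [← sum_chi_mul (fun j => (h j).eval (M m y) p.1)
          fun a => chi R ((M m y).fn s a = p.2)]
        refine Finset.sum_congr rfl fun a _ => ?_
        rw [← chi_forall, funext_iff]
      simp only [this]
      refine feasible_sum (by omega) (hu.one_le m) (fun a => ?_) (RCirc.card_tuples_le m)
        (hu.card_tuples_le m)
      exact (feasible_prod (by omega) (hu.one_le m) (fun i => hc i m (p.1, a i)) (le_pow_self _ _)
        (fun _ => le_two_pow_mul (hu.one_le m) _)).mul (hc' m (a, p.2)) (by omega) (hu.one_le m)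

theorem polyFeasible_idxRel (hu : DepthUnit b u) {J : ℕ → Type w} {g₁ g₂ : ∀ m, J m → Y m → Fin m}
    (h₁ : PolyFeasible b io B u (J := fun m => J m × Fin m) fun m p y => chi R (g₁ m p.1 y = p.2))
    (h₂ : PolyFeasible b io B u (J := fun m => J m × Fin m) fun m p y => chi R (g₂ m p.1 y = p.2))
    (r : ∀ m, Fin m → Fin m → Prop) :
    PolyFeasible b io B u fun m j y => chi R (r m (g₁ m j y) (g₂ m j y)) :=
  PolyFeasible.subst (A := Bool) hu (f := fun m a _ => chi R (r m (a true) (a false)))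
    ⟨1, fun m a => feasible_const (by omega) _⟩
    (g := fun m j y a => if a then g₁ m j y else g₂ m j y)
    (by
      rintro (_ | _)
      · simpa using h₂
      · simpa using h₁)

variable {E : Type → Type w} {e : ∀ m, Y m → ∀ X : Type, E X → (X → Fin m) → Prop}

mutual

theorem NumTerm.polyFeasible (hu : DepthUnit b u) [∀ s, Fintype (V.fnAr s)]
    [∀ s, Fintype (V.nmAr s)]
    (hfn : ∀ s, PolyFeasible b io B u (J := fun m => (V.fnAr s → Fin m) × Fin m)
      fun m p y => chi R ((M m y).fn s p.1 = p.2))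
    (hnm : ∀ s, PolyFeasible b io B u fun m a y => (M m y).nm s a)
    (he : ∀ X x, PolyFeasible b io B u fun m ν y => chi R (e m y X x ν)) :
    ∀ {X : Type} (t : NumTerm V R E X),
      PolyFeasible b io B u fun m (ν : X → Fin m) y => t.eval (M m y) (e m y) ν
  | _, .const r => ⟨1, fun m ν => by
      simp only [NumTerm.eval]; exact feasible_const (by omega) _⟩
  | _, .app s h => by
      simp only [NumTerm.eval]
      exact (hnm s).subst hu fun j => (h j).polyFeasible hu hfn
  | _, .add t₁ t₂ => by
      simp only [NumTerm.eval]
      obtain ⟨c₁, h₁⟩ := t₁.polyFeasible hu hfn hnm he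
      obtain ⟨c₂, h₂⟩ := t₂.polyFeasible hu hfn hnm he
      exact ⟨_, fun m ν => (h₁ m ν).add (h₂ m ν) (by omega) (hu.one_le m)⟩
  | _, .mul t₁ t₂ => by
      simp only [NumTerm.eval]
      obtain ⟨c₁, h₁⟩ := t₁.polyFeasible hu hfn hnm he
      obtain ⟨c₂, h₂⟩ := t₂.polyFeasible hu hfn hnm he
      exact ⟨_, fun m ν => (h₁ m ν).mul (h₂ m ν) (by omega) (hu.one_le m)⟩
  | _, .sign t => by
      simp only [NumTerm.eval]
      obtain ⟨c, h⟩ := t.polyFeasible hu hfn hnm he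
      exact ⟨_, fun m ν => (feasible_const (by omega) 0).lt (h m ν) (by omega) (hu.one_le m)⟩
  | _, .chi φ => by
      simp only [NumTerm.eval]
      exact φ.polyFeasible hu hfn hnm he
  | _, .sum l t => by
      simp only [NumTerm.eval]
      obtain ⟨c, h⟩ := t.polyFeasible hu hfn hnm he
      exact ⟨_, fun m ν => feasible_sum (by omega) (hu.one_le m) (fun a => h m (Sum.elim ν a))
        (RCirc.card_tuples_le m) (hu.card_tuples_le m)⟩
  | _, .prod l t => by
      simp only [NumTerm.eval]
      obtain ⟨c, h⟩ := t.polyFeasible hu hfn hnm he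
      exact ⟨_, fun m ν => feasible_prod (by omega) (hu.one_le m) (fun a => h m (Sum.elim ν a))
        (RCirc.card_tuples_le m) (hu.card_tuples_le m)⟩
  | _, .max l t => by
      simp only [NumTerm.eval]
      obtain ⟨c, h⟩ := t.polyFeasible hu hfn hnm he
      exact ⟨_, fun m ν => feasible_max (by omega) (hu.one_le m) (fun a => h m (Sum.elim ν a))
        (RCirc.card_tuples_le m) (hu.card_tuples_le m)⟩

theorem Formula.polyFeasible (hu : DepthUnit b u) [∀ s, Fintype (V.fnAr s)]
    [∀ s, Fintype (V.nmAr s)]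
    (hfn : ∀ s, PolyFeasible b io B u (J := fun m => (V.fnAr s → Fin m) × Fin m)
      fun m p y => chi R ((M m y).fn s p.1 = p.2))
    (hnm : ∀ s, PolyFeasible b io B u fun m a y => (M m y).nm s a)
    (he : ∀ X x, PolyFeasible b io B u fun m ν y => chi R (e m y X x ν)) :
    ∀ {X : Type} (φ : Formula V R E X),
      PolyFeasible b io B u fun m (ν : X → Fin m) y => chi R (φ.truth (M m y) (e m y) ν).down
  | _, .idxEq h₁ h₂ => by
      simp only [Formula.truth]
      exact polyFeasible_idxRel hu (h₁.polyFeasible hu hfn) (h₂.polyFeasible hu hfn)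
        fun _ p q => p = q
  | _, .idxLt h₁ h₂ => by
      simp only [Formula.truth]
      exact polyFeasible_idxRel hu (h₁.polyFeasible hu hfn) (h₂.polyFeasible hu hfn)
        fun _ p q => p < q
  | _, .numEq t₁ t₂ => by
      simp only [Formula.truth]
      obtain ⟨c₁, h₁⟩ := t₁.polyFeasible hu hfn hnm he
      obtain ⟨c₂, h₂⟩ := t₂.polyFeasible hu hfn hnm he
      exact ⟨_, fun m ν => (h₁ m ν).eq (h₂ m ν) (by omega) (hu.one_le m)⟩
  | _, .numLt t₁ t₂ => by
      simp only [Formula.truth]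
      obtain ⟨c₁, h₁⟩ := t₁.polyFeasible hu hfn hnm he
      obtain ⟨c₂, h₂⟩ := t₂.polyFeasible hu hfn hnm he
      exact ⟨_, fun m ν => (h₁ m ν).lt (h₂ m ν) (by omega) (hu.one_le m)⟩
  | _, .not φ => by
      simp only [Formula.truth]
      obtain ⟨c, h⟩ := φ.polyFeasible hu hfn hnm he
      exact ⟨_, fun m ν => (h m ν).not (by omega) (hu.one_le m)⟩
  | _, .and φ ψ => by
      simp only [Formula.truth]
      obtain ⟨c₁, h₁⟩ := φ.polyFeasible hu hfn hnm he
      obtain ⟨c₂, h₂⟩ := ψ.polyFeasible hu hfn hnm he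
      exact ⟨_, fun m ν => (h₁ m ν).and (h₂ m ν) (by omega) (hu.one_le m)⟩
  | _, .or φ ψ => by
      simp only [Formula.truth]
      obtain ⟨c₁, h₁⟩ := φ.polyFeasible hu hfn hnm he
      obtain ⟨c₂, h₂⟩ := ψ.polyFeasible hu hfn hnm he
      exact ⟨_, fun m ν => (h₁ m ν).or (h₂ m ν) (by omega) (hu.one_le m)⟩
  | _, .imp φ ψ => by
      simp only [Formula.truth]
      obtain ⟨c₁, h₁⟩ := φ.polyFeasible hu hfn hnm he
      obtain ⟨c₂, h₂⟩ := ψ.polyFeasible hu hfn hnm he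
      exact ⟨_, fun m ν => (h₁ m ν).imp (h₂ m ν) (by omega) (hu.one_le m)⟩
  | _, .iff φ ψ => by
      simp only [Formula.truth]
      obtain ⟨c₁, h₁⟩ := φ.polyFeasible hu hfn hnm he
      obtain ⟨c₂, h₂⟩ := ψ.polyFeasible hu hfn hnm he
      exact ⟨_, fun m ν => (h₁ m ν).iff (h₂ m ν) (by omega) (hu.one_le m)⟩
  | _, .ex φ => by
      simp only [Formula.truth]
      obtain ⟨c, h⟩ := φ.polyFeasible hu hfn hnm he
      exact ⟨_, fun m ν => feasible_exists (by omega) (hu.one_le m)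
        (fun a => h m (Sum.elim ν fun _ => a)) (card_fin_le m) (hu.card_fin_le m)⟩
  | _, .all φ => by
      simp only [Formula.truth]
      obtain ⟨c, h⟩ := φ.polyFeasible hu hfn hnm he
      exact ⟨_, fun m ν => feasible_forall (by omega) (hu.one_le m)
        (fun a => h m (Sum.elim ν fun _ => a)) (card_fin_le m) (hu.card_fin_le m)⟩
  | _, .extra x => by
      simp only [Formula.truth]
      exact he _ x

end

end

/-! ## Guarded recursion is computed by circuits -/

section Guards

theorem AmongTwoLargest.card_le {m i w r : ℕ} (φ : (Block i w r → Fin m) → Prop)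
    [Fintype {z // AmongTwoLargest φ z}] : Fintype.card {z // AmongTwoLargest φ z} ≤ 2 := by
  by_contra hlt
  obtain ⟨a, c, d, hac, had, hcd⟩ := Fintype.two_lt_card_iff.mp (not_le.mp hlt)
  let e : (Block i w r → Fin m) → Lex (Lex (Lex (Fin i × Fin w) ⊕ Fin r) → Fin m) := toLex
  have he : ∀ x y, BlockLT x y ↔ e x < e y := fun _ _ => Iff.rfl
  have key : ∀ x y z : {z // AmongTwoLargest φ z}, y ≠ z → e x < e y → ¬ e x < e z := by
    intro x y z hyz hxy hxz
    rcases x.2.2 y z (fun h => hyz (Subtype.ext h)) ((he _ _).mpr hxy) ((he _ _).mpr hxz) with h | h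
    · exact h y.2.1
    · exact h z.2.1
  have inj : ∀ x y : {z // AmongTwoLargest φ z}, x ≠ y → e x < e y ∨ e y < e x := fun x y hxy =>
    lt_or_gt_of_ne fun h => hxy (Subtype.ext (toLex.injective h))
  rcases inj a c hac with h1 | h1 <;> rcases inj a d had with h2 | h2 <;>
    rcases inj c d hcd with h3 | h3
  · exact key a c d hcd h1 h2
  · exact key a c d hcd h1 h2
  · exact key a c d hcd h1 (h1.trans h3)
  · exact key d a c hac h2 h3
  · exact key c a d had h1 h3
  · exact key c a d had h1 (h1.trans h2)
  · exact key c a d had h1 h3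
  · exact key d a c hac h2 h3

theorem digit_lt {m i w r : ℕ} (y : Block i w r → Fin m) (j : Fin i) : digit y j < m ^ w :=
  (tupleEquiv m w _).isLt

theorem size_lt_size_of_add_self_le {y z : ℕ} (h : z + z ≤ y) (h' : z < y) :
    Nat.size z < Nat.size y := by
  have hy : 0 < Nat.size y := Nat.size_pos.mpr (by omega)
  obtain ⟨s, hs⟩ := Nat.exists_eq_succ_of_ne_zero hy.ne'
  have := Nat.lt_size_self y
  rw [hs, Nat.lt_succ_iff, Nat.size_le]
  rw [hs, pow_succ] at this
  omega

/-- The recursion depth of guarded recursion. -/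
theorem exists_rank_guard (m i w r W : ℕ) (hW : m ^ w ≤ 2 ^ W) :
    ∃ rank : (Block i w r → Fin m) → ℕ, (∀ y z, Guard y z → rank z < rank y) ∧
      ∀ y, rank y < (W + 1) ^ i := by
  have hcard : Fintype.card (Lex (Fin i → Fin (W + 1))) = (W + 1) ^ i := by
    rw [Fintype.card_lex]
    simp
  let iso := Fintype.orderIsoFinOfCardEq (Lex (Fin i → Fin (W + 1))) hcard
  have hsz : ∀ (y : Block i w r → Fin m) j, Nat.size (digit y j) < W + 1 := fun y j =>
    Nat.lt_succ_of_le (Nat.size_le.mpr ((digit_lt y j).trans_le hW))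
  let L : (Block i w r → Fin m) → Lex (Fin i → Fin (W + 1)) := fun y =>
    toLex fun j => ⟨Nat.size (digit y j), hsz y j⟩
  refine ⟨fun y => iso.symm (L y), fun y z h => ?_, fun y => (iso.symm (L y)).isLt⟩
  rw [Fin.val_fin_lt, OrderIso.lt_iff_lt]
  obtain ⟨j, hj, hj', hk⟩ := h
  have hlt : Nat.size (digit z j) < Nat.size (digit y j) := size_lt_size_of_add_self_le hj hj'
  obtain ⟨k, hk1, hk2⟩ := (wellFounded_lt (α := Fin i)).has_min
    {k | Nat.size (digit z k) < Nat.size (digit y k)} ⟨j, hlt⟩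
  have hkj : k ≤ j := not_lt.mp (hk2 j hlt)
  refine ⟨k, fun l hl => ?_, hk1⟩
  refine Fin.ext (le_antisymm (Nat.size_le_size (hk l (hl.trans_le hkj))) ?_)
  exact not_lt.mp fun h => hk2 l h hl

end Guards

section Aggregators

variable {R : Type u} [CommRing R] {A : Type} [Fintype A]

theorem sum_chi_mul_eq_sum_subtype (φ : A → Prop) [Fintype {z // φ z}] (t : A → R) :
    ∑ z, chi R (φ z) * t z = ∑ z : {z // φ z}, t z := by
  classical
  rw [← Finset.sum_subtype (Finset.univ.filter φ) (by simp) t, Finset.sum_filter]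
  refine Finset.sum_congr rfl fun z _ => ?_
  by_cases h : φ z <;> simp [chi, h]

theorem prod_chi_mul_eq_prod_subtype (φ : A → Prop) [Fintype {z // φ z}] (t : A → R) :
    ∏ z, (chi R (φ z) * t z + chi R (¬ φ z) * 1) = ∏ z : {z // φ z}, t z := by
  classical
  rw [← Finset.prod_subtype (Finset.univ.filter φ) (by simp) t, Finset.prod_filter]
  refine Finset.prod_congr rfl fun z _ => ?_
  by_cases h : φ z <;> simp [chi, h]

variable [LinearOrder R]

theorem maxOver_chi_mul_of_forall (φ : A → Prop) [Fintype {z // φ z}] (t : A → R)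
    (h : ∀ z, φ z) : maxOver (fun z => chi R (φ z) * t z) = maxOver fun z : {z // φ z} => t z := by
  refine maxOver_congr_range ?_
  ext r
  simp [chi, h]

theorem maxOver_chi_mul_of_not_forall (φ : A → Prop) [Fintype {z // φ z}] (t : A → R)
    (h : ∃ z, ¬ φ z) : maxOver (fun z => chi R (φ z) * t z) =
      maxOver fun o : Option {z // φ z} => o.elim 0 fun z => t z := by
  refine maxOver_congr_range ?_
  ext r
  constructor
  · rintro ⟨z, rfl⟩
    by_cases hz : φ z
    · exact ⟨some ⟨z, hz⟩, by simp [chi, hz]⟩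
    · exact ⟨none, by simp [chi, hz]⟩
  · rintro ⟨_ | z, rfl⟩
    · obtain ⟨z, hz⟩ := h
      exact ⟨z, by simp [chi, hz]⟩
    · exact ⟨z.1, by simp [chi, z.2]⟩

theorem Aggregator.feasible_relEval {b : Bool} {n : ℕ} {Y : Type v} {io : Y → Fin n → R}
    {B : Set ((Y → R) × ℕ)} {S d u c a : ℕ} (hS : 2 ≤ S) (hu : 1 ≤ u) (G : Aggregator)
    {φ : A → Prop} [Fintype {z // φ z}] {F : A → Y → R}
    (h : ∀ z, φ z → Feasible b io B S d u c (F z))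
    (hA : Fintype.card {z // φ z} + 1 ≤ S ^ a)
    (hb : b = true → Fintype.card {z // φ z} + 1 ≤ 2 ^ (a * u)) :
    Feasible b io B S d u (3 * c + 4 * a + 35) fun y => G.relEval φ fun z => F z y := by
  cases G with
  | sum =>
    simp only [Aggregator.relEval, sum_chi_mul_eq_sum_subtype]
    exact (feasible_sum (a := a) hS hu (fun z : {z // φ z} => h z z.2) (by omega)
      fun h => by have := hb h; omega).mono hS (by omega)
  | prod =>
    simp only [Aggregator.relEval, prod_chi_mul_eq_prod_subtype]
    exact (feasible_prod (a := a) hS hu (fun z : {z // φ z} => h z z.2) (by omega)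
      fun h => by have := hb h; omega).mono hS (by omega)
  | max =>
    by_cases hφ : ∀ z, φ z
    · simp only [Aggregator.relEval, maxOver_chi_mul_of_forall φ _ hφ]
      exact (feasible_max (a := a) hS hu (fun z : {z // φ z} => h z z.2) (by omega)
        fun h => by have := hb h; omega).mono hS (by omega)
    · simp only [Aggregator.relEval, maxOver_chi_mul_of_not_forall φ _ (not_forall.mp hφ)]
      refine (feasible_max (c := c + 1) (a := a) hS hu (fun o : Option {z // φ z} => ?_) ?_
        fun h => ?_).mono hS (by omega)
      · cases o with
        | none => exact (feasible_const hS 0).mono hS (by omega)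
        | some z => exact (h z z.2).mono hS (by omega)
      · rwa [Fintype.card_option]
      · rw [Fintype.card_option]
        exact hb h

end Aggregators

section Recursion

variable {R : Type u} [CommRing R] [LinearOrder R] {b : Bool} {n : ℕ → ℕ} {Y : ℕ → Type v}
  {io : ∀ m, Y m → Fin (n m) → R} {u : ℕ → ℕ} {V W : Vocab} {M : ∀ m, Y m → Interp V R m}
  {N : ∀ m, Interp W R m} {P : Type} {i w r : ℕ}
  {f : ∀ m, Y m → (P → Fin m) → (Block i w r → Fin m) → R}

/-- `G` can be computed, by circuits of constant depth, from the values of `f` at the smaller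
arguments. -/
def GuardedFeasible (b : Bool) (io : ∀ m, Y m → Fin (n m) → R) (u : ℕ → ℕ)
    (f : ∀ m, Y m → (P → Fin m) → (Block i w r → Fin m) → R) {D : Type}
    (G : ∀ m, (P → Fin m) → (Block i w r → Fin m) → (D → Block i w r → Fin m) → Y m → R) : Prop :=
  ∃ c, ∀ m x y ζ, (∀ d, Guard y (ζ d)) → ∀ (d : ℕ) (B : Set ((Y m → R) × ℕ)), c * u m ≤ d →
    (∀ z, Guard y z → ∃ d' ≤ d, ((fun s => f m s x z), d') ∈ B) →
      Feasible b (io m) B (m + 2) d 1 c (G m x y ζ)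

section closure

variable {D : Type}
  {G₁ G₂ : ∀ m, (P → Fin m) → (Block i w r → Fin m) → (D → Block i w r → Fin m) → Y m → R}
  {p₁ p₂ : ∀ m, (P → Fin m) → (Block i w r → Fin m) → (D → Block i w r → Fin m) → Y m → Prop}

theorem GuardedFeasible.of_pure (J : ℕ → Type)
    {g : ∀ m, J m → Y m → R}
    (h : PolyFeasible b io (fun _ => ∅) u g)
    (j : ∀ m, (P → Fin m) → (Block i w r → Fin m) → (D → Block i w r → Fin m) → J m) :
    GuardedFeasible b io u f fun m x y ζ => g m (j m x y ζ) := by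
  obtain ⟨c, hc⟩ := h
  refine ⟨c, fun m x y ζ _ d B hd _ => ?_⟩
  exact ((hc m (j m x y ζ)).subset (Set.empty_subset B)).mono le_rfl (by omega)

theorem GuardedFeasible.map₂ {G : ∀ m, (P → Fin m) → (Block i w r → Fin m) →
      (D → Block i w r → Fin m) → Y m → R} (k : ℕ → ℕ → ℕ) (hk : ∀ c c', c ≤ k c c' ∧ c' ≤ k c c')
    (h₁ : GuardedFeasible b io u f G₁) (h₂ : GuardedFeasible b io u f G₂)
    (H : ∀ m x y ζ d B c c', Feasible b (io m) B (m + 2) d 1 c (G₁ m x y ζ) →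
      Feasible b (io m) B (m + 2) d 1 c' (G₂ m x y ζ) →
        Feasible b (io m) B (m + 2) d 1 (k c c') (G m x y ζ)) :
    GuardedFeasible b io u f G := by
  obtain ⟨c, hc⟩ := h₁
  obtain ⟨c', hc'⟩ := h₂
  refine ⟨k c c', fun m x y ζ hζ d B hd hB => ?_⟩
  have h := hk c c'
  exact H _ _ _ _ _ _ _ _
    (hc m x y ζ hζ d B ((Nat.mul_le_mul_right _ h.1).trans hd) hB)
    (hc' m x y ζ hζ d B ((Nat.mul_le_mul_right _ h.2).trans hd) hB)

end closure

mutual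

theorem RecTerm.guardedFeasible (hu : DepthUnit b u) [∀ s, Fintype (V.fnAr s)]
    [∀ s, Fintype (V.nmAr s)]
    (hfn : ∀ s, PolyFeasible b io (fun _ => ∅) u (J := fun m => (V.fnAr s → Fin m) × Fin m)
      fun m p y => chi R ((M m y).fn s p.1 = p.2))
    (hnm : ∀ s, PolyFeasible b io (fun _ => ∅) u fun m a y => (M m y).nm s a) :
    ∀ {D : Type} (t : RecTerm V W R P (Block i w r) D),
      GuardedFeasible b io u f fun m x y ζ s => t.eval b (M m s) (N m) (f m s) x y ζ
  | D, .pure t => by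
      simp only [RecTerm.eval]
      exact .of_pure _ (t.polyFeasible (e := fun _ _ => noExtra) hu hfn hnm fun _ e => e.elim)
        fun m x y ζ => Sum.elim (Sum.elim x y) fun p => ζ p.1 p.2
  | D, .call d => by
      simp only [RecTerm.eval]
      refine ⟨0, fun m x y ζ hζ d' B _ hB => ?_⟩
      obtain ⟨d'', hd, h⟩ := hB (ζ d) (hζ d)
      exact feasible_base h (by omega)
  | D, .add t₁ t₂ => by
      simp only [RecTerm.eval]
      exact .map₂ _ (fun _ _ => by omega) (t₁.guardedFeasible hu hfn hnm)
        (t₂.guardedFeasible hu hfn hnm)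
        fun _ _ _ _ _ _ _ _ h₁ h₂ => h₁.add h₂ (by omega) le_rfl
  | D, .mul t₁ t₂ => by
      simp only [RecTerm.eval]
      exact .map₂ _ (fun _ _ => by omega) (t₁.guardedFeasible hu hfn hnm)
        (t₂.guardedFeasible hu hfn hnm)
        fun _ _ _ _ _ _ _ _ h₁ h₂ => h₁.mul h₂ (by omega) le_rfl
  | D, .sign t => by
      simp only [RecTerm.eval]
      have h := t.guardedFeasible hu hfn hnm
      exact .map₂ (fun c c' => 1 + c + c' + 4) (fun _ _ => by omega) h h
        fun _ _ _ _ _ _ _ _ h₁ _ =>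
          ((feasible_const (by omega) 0).lt h₁ (by omega) le_rfl).mono (by omega) (by omega)
  | D, .chi φ => by
      simp only [RecTerm.eval]
      exact φ.guardedFeasible hu hfn hnm
  | D, .guarded A ξ t => by
      simp only [RecTerm.eval]
      obtain ⟨c, hc⟩ := t.guardedFeasible hu hfn hnm
      refine ⟨3 * c + 4 * (Fintype.card (Block i w r) + 2) + 35, fun m x y ζ hζ d B hd hB => ?_⟩
      classical
      refine Aggregator.feasible_relEval (by omega) le_rfl A (fun z hz => ?_) ?_ fun hb => ?_
      · refine hc m x y (Sum.elim ζ fun _ => z) ?_ d B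
          ((Nat.mul_le_mul_right _ (by omega)).trans hd) hB
        rintro (e | _)
        · exact hζ e
        · exact hz.guard
      · have h1 := (Fintype.card_subtype_le (InRange b (N m) ξ y)).trans
          (RCirc.card_tuples_le (A := Block i w r) m)
        have h2 : 1 ≤ (m + 2) ^ Fintype.card (Block i w r) := Nat.one_le_pow _ _ (by omega)
        rw [pow_add]
        have h3 : 2 ^ 2 ≤ (m + 2) ^ 2 := Nat.pow_le_pow_left (by omega) 2
        nlinarith
      · subst hb
        have : Fintype.card {z // InRange true (N m) ξ y z} ≤ 2 := AmongTwoLargest.card_le _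
        calc _ ≤ 2 ^ 2 := by omega
          _ ≤ _ := Nat.pow_le_pow_right two_pos (by omega)

theorem RecFormula.guardedFeasible (hu : DepthUnit b u) [∀ s, Fintype (V.fnAr s)]
    [∀ s, Fintype (V.nmAr s)]
    (hfn : ∀ s, PolyFeasible b io (fun _ => ∅) u (J := fun m => (V.fnAr s → Fin m) × Fin m)
      fun m p y => chi R ((M m y).fn s p.1 = p.2))
    (hnm : ∀ s, PolyFeasible b io (fun _ => ∅) u fun m a y => (M m y).nm s a) :
    ∀ {D : Type} (φ : RecFormula V W R P (Block i w r) D),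
      GuardedFeasible b io u f
        fun m x y ζ s => chi R (φ.truth b (M m s) (N m) (f m s) x y ζ).down
  | D, .pure φ => by
      simp only [RecFormula.truth, Formula.Holds]
      exact .of_pure _ (φ.polyFeasible (e := fun _ _ => noExtra) hu hfn hnm fun _ e => e.elim)
        fun m x y ζ => Sum.elim (Sum.elim x y) fun p => ζ p.1 p.2
  | D, .numEq t₁ t₂ => by
      simp only [RecFormula.truth]
      exact .map₂ _ (fun _ _ => by omega) (t₁.guardedFeasible hu hfn hnm)
        (t₂.guardedFeasible hu hfn hnm)
        fun _ _ _ _ _ _ _ _ h₁ h₂ => h₁.eq h₂ (by omega) le_rfl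
  | D, .numLt t₁ t₂ => by
      simp only [RecFormula.truth]
      exact .map₂ _ (fun _ _ => by omega) (t₁.guardedFeasible hu hfn hnm)
        (t₂.guardedFeasible hu hfn hnm)
        fun _ _ _ _ _ _ _ _ h₁ h₂ => h₁.lt h₂ (by omega) le_rfl
  | D, .not φ => by
      simp only [RecFormula.truth]
      have h := φ.guardedFeasible hu hfn hnm
      exact .map₂ (fun c c' => c + c' + 14) (fun _ _ => by omega) h h
        fun _ _ _ _ _ _ _ _ h₁ _ => (h₁.not (by omega) le_rfl).mono (by omega) (by omega)
  | D, .and φ ψ => by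
      simp only [RecFormula.truth]
      exact .map₂ _ (fun _ _ => by omega) (φ.guardedFeasible hu hfn hnm)
        (ψ.guardedFeasible hu hfn hnm)
        fun _ _ _ _ _ _ _ _ h₁ h₂ => h₁.and h₂ (by omega) le_rfl
  | D, .or φ ψ => by
      simp only [RecFormula.truth]
      exact .map₂ _ (fun _ _ => by omega) (φ.guardedFeasible hu hfn hnm)
        (ψ.guardedFeasible hu hfn hnm)
        fun _ _ _ _ _ _ _ _ h₁ h₂ => h₁.or h₂ (by omega) le_rfl
  | D, .imp φ ψ => by
      simp only [RecFormula.truth]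
      exact .map₂ _ (fun _ _ => by omega) (φ.guardedFeasible hu hfn hnm)
        (ψ.guardedFeasible hu hfn hnm)
        fun _ _ _ _ _ _ _ _ h₁ h₂ => h₁.imp h₂ (by omega) le_rfl
  | D, .iff φ ψ => by
      simp only [RecFormula.truth]
      exact .map₂ _ (fun _ _ => by omega) (φ.guardedFeasible hu hfn hnm)
        (ψ.guardedFeasible hu hfn hnm)
        fun _ _ _ _ _ _ _ _ h₁ h₂ => h₁.iff h₂ (by omega) le_rfl

end

end Recursion

/-! ## Definable sets are decided by circuits -/

/-- The length of the binary representation of `m + 2`, which bounds `log₂ (m + 2)`. -/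
def lg (m : ℕ) : ℕ := Nat.log 2 (m + 2) + 1

theorem one_le_lg (m : ℕ) : 1 ≤ lg m := Nat.le_add_left _ _

theorem le_two_pow_lg (m : ℕ) : m + 2 ≤ 2 ^ lg m := (Nat.lt_pow_succ_log_self one_lt_two _).le

theorem lg_mono {m n : ℕ} (h : m ≤ n) : lg m ≤ lg n :=
  Nat.add_le_add_right (Nat.log_mono_right (Nat.add_le_add_right h 2)) 1

theorem depthUnit_lg_pow {b : Bool} {i : ℕ} (hb : b = true → 1 ≤ i) :
    DepthUnit b fun m => lg m ^ i where
  one_le m := Nat.one_le_pow _ _ (one_le_lg m)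
  le_two_pow h m := (le_two_pow_lg m).trans
    (Nat.pow_le_pow_right two_pos (Nat.le_self_pow (by have := hb h; omega) _))

/-- The length of the encoding of a structure of size `m`. -/
def Signature.len (σ : Signature) (m : ℕ) : ℕ :=
  (∑ s, m ^ (σ.arS s + 1)) + ∑ s, m ^ σ.arF s

theorem Signature.len_strictMono (σ : Signature) : StrictMono σ.len := by
  intro m m' h
  have h1 : ∀ s, m ^ (σ.arS s + 1) ≤ m' ^ (σ.arS s + 1) := fun s => Nat.pow_le_pow_left h.le _
  have h2 : ∀ s, m ^ σ.arF s ≤ m' ^ σ.arF s := fun s => Nat.pow_le_pow_left h.le _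
  rcases σ.nondegenerate with h0 | ⟨s, hs⟩
  · exact Nat.add_lt_add_of_lt_of_le
      (Finset.sum_lt_sum (fun s _ => h1 s)
        ⟨⟨0, h0⟩, Finset.mem_univ _, Nat.pow_lt_pow_left h (Nat.succ_ne_zero _)⟩)
      (Finset.sum_le_sum fun s _ => h2 s)
  · exact Nat.add_lt_add_of_le_of_lt (Finset.sum_le_sum fun s _ => h1 s)
      (Finset.sum_lt_sum (fun s _ => h2 s) ⟨s, Finset.mem_univ _, Nat.pow_lt_pow_left h hs.ne'⟩)

/-- The position, in the encoding of a structure, of the truth value of `s(a) = c`. -/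
def Signature.posS (σ : Signature) (m : ℕ) (s : Fin σ.numS) (a : Fin (σ.arS s) → Fin m)
    (c : Fin m) : Fin (σ.len m) :=
  Fin.castAdd _ (finSigmaFinEquiv (n := fun s => m ^ (σ.arS s + 1))
    ⟨s, tupleEquiv m (σ.arS s + 1) (Fin.snoc (α := fun _ => Fin m) a c)⟩)

/-- The position, in the encoding of a structure, of the value `s(a)`. -/
def Signature.posF (σ : Signature) (m : ℕ) (s : Fin σ.numF) (a : Fin (σ.arF s) → Fin m) :
    Fin (σ.len m) :=
  Fin.natAdd _ (finSigmaFinEquiv (n := fun s => m ^ σ.arF s) ⟨s, tupleEquiv m (σ.arF s) a⟩)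

theorem Signature.exists_pos (σ : Signature) (m : ℕ) (p : Fin (σ.len m)) :
    (∃ s a c, p = σ.posS m s a c) ∨ ∃ s a, p = σ.posF m s a := by
  refine Fin.addCases (fun q => .inl ?_) (fun q => .inr ?_) p
  · obtain ⟨⟨s, t⟩, rfl⟩ := (finSigmaFinEquiv (n := fun s => m ^ (σ.arS s + 1))).surjective q
    obtain ⟨a, rfl⟩ := (tupleEquiv m (σ.arS s + 1)).surjective t
    refine ⟨s, Fin.init a, a (Fin.last _), ?_⟩
    rw [Signature.posS, Fin.snoc_init_self]
  · obtain ⟨⟨s, t⟩, rfl⟩ := (finSigmaFinEquiv (n := fun s => m ^ σ.arF s)).surjective q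
    obtain ⟨a, rfl⟩ := (tupleEquiv m (σ.arF s)).surjective t
    exact ⟨s, a, rfl⟩

section

variable {R : Type u} [CommRing R] {σ : Signature} {m : ℕ}

/-- The encoding of a structure, as a tuple whose length is determined by the size. -/
noncomputable def RStructure.tuple (D : RStructure σ R m) : Fin (σ.len m) → R := D.encode.2

theorem RStructure.encode_eq (D : RStructure σ R m) : D.encode = ⟨σ.len m, D.tuple⟩ := rfl

theorem RStructure.tuple_posS (D : RStructure σ R m) (s : Fin σ.numS)
    (a : Fin (σ.arS s) → Fin m) (c : Fin m) :
    D.tuple (σ.posS m s a c) = chi R (D.fn s a = c) := by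
  let f : (Σ s : Fin σ.numS, Fin (m ^ (σ.arS s + 1))) → R := fun q =>
    chi R (D.fn q.1 (Fin.init ((tupleEquiv m (σ.arS q.1 + 1)).symm q.2)) =
      (tupleEquiv m (σ.arS q.1 + 1)).symm q.2 (Fin.last _))
  have h : D.tuple (σ.posS m s a c) = f (finSigmaFinEquiv.symm (finSigmaFinEquiv
      ⟨s, tupleEquiv m (σ.arS s + 1) (Fin.snoc (α := fun _ => Fin m) a c)⟩)) := by
    simp only [RStructure.tuple, RStructure.encode, Signature.posS, Fin.append_left, f]
  rw [h, Equiv.symm_apply_apply]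
  simp only [f, Equiv.symm_apply_apply]
  rw [Fin.init_snoc, Fin.snoc_last]

theorem RStructure.tuple_posF (D : RStructure σ R m) (s : Fin σ.numF)
    (a : Fin (σ.arF s) → Fin m) : D.tuple (σ.posF m s a) = D.nm s a := by
  let f : (Σ s : Fin σ.numF, Fin (m ^ σ.arF s)) → R := fun q =>
    D.nm q.1 ((tupleEquiv m (σ.arF q.1)).symm q.2)
  have h : D.tuple (σ.posF m s a) =
      f (finSigmaFinEquiv.symm (finSigmaFinEquiv ⟨s, tupleEquiv m (σ.arF s) a⟩)) := by
    simp only [RStructure.tuple, RStructure.encode, Signature.posF, Fin.append_right, f]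
  rw [h, Equiv.symm_apply_apply]
  simp only [f, Equiv.symm_apply_apply]

theorem RStructure.tuple_injective [Nontrivial R] :
    Function.Injective (RStructure.tuple : RStructure σ R m → Fin (σ.len m) → R) := by
  intro D D' h
  have hfn : D.fn = D'.fn := by
    funext s a
    by_contra hne
    have h1 := congrFun h (σ.posS m s a (D.fn s a))
    rw [tuple_posS, tuple_posS, chi_true rfl, chi_false (Ne.symm hne)] at h1
    exact one_ne_zero h1
  have hnm : D.nm = D'.nm := by
    funext s a
    rw [← tuple_posF, h, tuple_posF]
  cases D
  cases D'
  simp only at hfn hnm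
  subst hfn hnm
  rfl

theorem exists_tuple_eq_iff (x : Fin (σ.len m) → R) :
    (∃ D : RStructure σ R m, D.tuple = x) ↔
      ∀ s a, ∃ c, ∀ c', x (σ.posS m s a c') = chi R (c = c') := by
  constructor
  · rintro ⟨D, rfl⟩ s a
    exact ⟨D.fn s a, fun c' => D.tuple_posS s a c'⟩
  · intro h
    choose f hf using h
    refine ⟨⟨f, fun s a => x (σ.posF m s a)⟩, funext fun p => ?_⟩
    rcases σ.exists_pos m p with ⟨s, a, c, rfl⟩ | ⟨s, a, rfl⟩
    · rw [RStructure.tuple_posS, hf]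
    · rw [RStructure.tuple_posF]

variable [LinearOrder R] {b : Bool} {i : ℕ} {u : ℕ → ℕ}

theorem polyFeasible_isEncoding (σ : Signature) (hu : DepthUnit b u) :
    PolyFeasible b (Y := fun m => Fin (σ.len m) → R) (fun _ => id) (fun _ => ∅) u
      (J := fun _ => Unit) fun m _ x => chi R (∃ D : RStructure σ R m, D.tuple = x) := by
  simp only [exists_tuple_eq_iff]
  have key : ∀ s, PolyFeasible b (Y := fun m => Fin (σ.len m) → R) (fun _ => id) (fun _ => ∅) u
      (J := fun _ => Unit) fun m _ x =>
        chi R (∀ a, ∃ c, ∀ c', x (σ.posS m s a c') = chi R (c = c')) := fun s =>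
    ⟨_, fun m _ => feasible_forall (by omega) (hu.one_le m)
      (fun a => feasible_exists (by omega) (hu.one_le m)
        (fun c => feasible_forall (by omega) (hu.one_le m)
          (fun c' => (feasible_input (by omega) (σ.posS m s a c')).eq
            (feasible_const (by omega) (chi R (c = c'))) (by omega) (hu.one_le m))
          (card_fin_le m) (hu.card_fin_le m))
        (card_fin_le m) (hu.card_fin_le m))
      (card_tuples_le m) (hu.card_tuples_le m)⟩
  obtain ⟨c, hc⟩ := PolyFeasible.exists_uniform key
  exact ⟨_, fun m _ => feasible_forall (by omega) (hu.one_le m) (fun s => hc s m ())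
    (le_pow_self _ _) (fun _ => le_two_pow_mul (hu.one_le m) _)⟩

variable (I : ∀ m, ArbInterp σ R m)

theorem polyFeasible_interp_fn (u : ℕ → ℕ) (B : ∀ m, Set ((RStructure σ R m → R) × ℕ))
    (s : σ.vocab.Fn) :
    PolyFeasible b (fun _ => RStructure.tuple) B u
      (J := fun m => (σ.vocab.fnAr s → Fin m) × Fin m)
      fun m p D => chi R ((D.interp (I m)).fn s p.1 = p.2) :=
  ⟨1, fun m p => by
    have h := feasible_input (io := RStructure.tuple) (B := B m) (d := 0) (u := u m) (b := b)
      (show 2 ≤ m + 2 by omega) (σ.posS m s p.1 p.2)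
    simp only [RStructure.tuple_posS] at h
    exact h⟩

theorem polyFeasible_interp_nm (u : ℕ → ℕ) (B : ∀ m, Set ((RStructure σ R m → R) × ℕ))
    (s : σ.vocab.Nm) :
    PolyFeasible b (fun _ => RStructure.tuple) B u
      fun m (a : σ.vocab.nmAr s → Fin m) D => (D.interp (I m)).nm s a :=
  ⟨1, fun m a => by
    cases s with
    | inl s =>
      have h := feasible_input (io := RStructure.tuple) (B := B m) (d := 0) (u := u m) (b := b)
        (show 2 ≤ m + 2 by omega) (σ.posF m s a)
      have he : (fun D : RStructure σ R m => (D.interp (I m)).nm (.inl s) a) =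
          fun D => D.tuple (σ.posF m s a) := funext fun D => (D.tuple_posF s a).symm
      exact Eq.mpr (congrArg (Feasible b RStructure.tuple (B m) (m + 2) 0 (u m) 1) he) h
    | inr s => exact feasible_const (by omega) (I m s a)⟩

instance (s : σ.vocab.Fn) : Fintype (σ.vocab.fnAr s) := inferInstanceAs (Fintype (Fin _))

instance (s : σ.vocab.Nm) : Fintype (σ.vocab.nmAr s) := inferInstanceAs (Fintype (Fin _))

instance {Q : Type} [Fintype Q] : ∀ s : (σ.vocab.extend Q).Nm,
    Fintype ((σ.vocab.extend Q).nmAr s)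
  | .inl (.inl _) => inferInstanceAs (Fintype (Fin _))
  | .inl (.inr _) => inferInstanceAs (Fintype (Fin _))
  | .inr _ => inferInstanceAs (Fintype Q)

/-- The function defined by a recursion. -/
noncomputable def GFR.fn {X : Type} (b : Bool) (g : GFR σ R i X) (D : RStructure σ R m)
    (I : ArbInterp σ R m) : (Fin g.p → Fin m) → (Block i g.w g.r → Fin m) → R :=
  (existsUnique_isRecSolution b (D.interp I) (auxInterp I) g.t).choose

theorem GFR.isRecSolution_fn {X : Type} (b : Bool) (g : GFR σ R i X) (D : RStructure σ R m)
    (I : ArbInterp σ R m) :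
    IsRecSolution b (D.interp I) (auxInterp I) g.t (g.fn b D I) :=
  (existsUnique_isRecSolution b (D.interp I) (auxInterp I) g.t).choose_spec.1

theorem GFR.holds_iff {X : Type} (b : Bool) (g : GFR σ R i X) (D : RStructure σ R m)
    (I : ArbInterp σ R m) (ν : X → Fin m) :
    GFR.Holds b D I X g ν ↔ g.ψ.Holds
      ((D.interp I).extend fun q => g.fn b D I (q ∘ Sum.inl) (q ∘ Sum.inr)) noExtra ν := by
  constructor
  · rintro ⟨f, hf, h⟩
    rwa [(existsUnique_isRecSolution b (D.interp I) (auxInterp I) g.t).unique hf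
      (g.isRecSolution_fn b D I)] at h
  · exact fun h => ⟨_, g.isRecSolution_fn b D I, h⟩

theorem GFR.polyFeasible (hb : b = true → 1 ≤ i) {X : Type} (g : GFR σ R i X) :
    PolyFeasible b (Y := RStructure σ R) (fun _ => RStructure.tuple) (fun _ => ∅)
      (fun m => lg m ^ i) fun m (ν : X → Fin m) D => chi R (GFR.Holds b D (I m) X g ν) := by
  classical
  have hu := depthUnit_lg_pow hb
  obtain ⟨c, hc⟩ := g.t.guardedFeasible (N := fun m => auxInterp (I m))
    (f := fun m D => g.fn b D (I m)) hu (polyFeasible_interp_fn I _ _)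
    (polyFeasible_interp_nm I _ _)
  have hrank : ∀ m, ∃ rank : (Block i g.w g.r → Fin m) → ℕ,
      (∀ y z, Guard y z → rank z < rank y) ∧ ∀ y, rank y < (lg m * g.w + 1) ^ i := by
    intro m
    refine exists_rank_guard m i g.w g.r (lg m * g.w) ?_
    rw [pow_mul]
    exact Nat.pow_le_pow_left ((Nat.le_add_right m 2).trans (le_two_pow_lg m)) _
  choose rank hguard hlt using hrank
  let dv : ∀ m, (Fin g.p → Fin m) × (Block i g.w g.r → Fin m) → ℕ := fun m a =>
    c * lg m ^ i + rank m a.2 * c + 1 * c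
  let fv : ∀ m, (Fin g.p → Fin m) × (Block i g.w g.r → Fin m) → RStructure σ R m → R :=
    fun m a D => g.fn b D (I m) a.1 a.2
  have hdv : ∀ m a, dv m a ≤ (c + (g.w + 1) ^ i * c) * lg m ^ i := by
    intro m a
    have h1 : rank m a.2 + 1 ≤ (lg m * g.w + 1) ^ i := hlt m a.2
    have h2 : (lg m * g.w + 1) ^ i ≤ ((g.w + 1) * lg m) ^ i :=
      Nat.pow_le_pow_left (by have := one_le_lg m; nlinarith) i
    rw [mul_pow] at h2
    have h3 := Nat.mul_le_mul_right c (h1.trans h2)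
    simp only [dv]
    nlinarith
  let B : ∀ m, Set ((RStructure σ R m → R) × ℕ) := fun m => Set.range fun a => (fv m a, dv m a)
  obtain ⟨c', hc'⟩ := g.ψ.polyFeasible (V := σ.vocab.extend (Fin g.p ⊕ Block i g.w g.r))
    (B := B) (u := fun m => lg m ^ i) (io := fun _ => RStructure.tuple) (b := b)
    (M := fun m D => (D.interp (I m)).extend
      fun q => g.fn b D (I m) (q ∘ Sum.inl) (q ∘ Sum.inr))
    (e := fun _ _ => noExtra) hu (polyFeasible_interp_fn I _ B)
    (fun s => by
      cases s with
      | inl s => exact polyFeasible_interp_nm I _ B s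
      | inr s => exact ⟨_, fun m a => feasible_base ⟨(a ∘ Sum.inl, a ∘ Sum.inr), rfl⟩
          ((hdv m _).trans (Nat.le_add_left _ _))⟩) fun _ e => e.elim
  refine ⟨Fintype.card (Fin g.p) + Fintype.card (Block i g.w g.r) + (c + 1) + c' + 1,
    fun m ν => ?_⟩
  have hiff : ∀ D : RStructure σ R m, GFR.Holds b D (I m) X g ν = (g.ψ.truth
      ((D.interp (I m)).extend fun q => g.fn b D (I m) (q ∘ Sum.inl) (q ∘ Sum.inr))
        noExtra ν).down :=
    fun D => propext (g.holds_iff b D (I m) ν)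
  simp only [hiff]
  have key := cost_of_rank (B := ∅) (fv m) (dv m) (fun a => rank m a.2)
    (s := (m + 2) ^ c) (fun a => ?_) ((hc' m ν).subset Set.subset_union_right)
  · refine key.mono ?_ ?_
    · have h1 : Fintype.card ((Fin g.p → Fin m) × (Block i g.w g.r → Fin m)) ≤
          (m + 2) ^ (Fintype.card (Fin g.p) + Fintype.card (Block i g.w g.r)) := by
        rw [Fintype.card_prod, pow_add]
        exact Nat.mul_le_mul (card_tuples_le m) (card_tuples_le m)
      set k := Fintype.card (Fin g.p) + Fintype.card (Block i g.w g.r)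
      have hpos : ∀ j, 1 ≤ (m + 2) ^ j := fun j => Nat.one_le_pow _ _ (by omega)
      have h2 : (m + 2) ^ c + 1 ≤ (m + 2) ^ (c + 1) := by
        rw [pow_succ]
        nlinarith [hpos c]
      have h3 := Nat.mul_le_mul h1 h2
      rw [← pow_add] at h3
      have h4 : (m + 2) ^ (k + (c + 1)) ≤ (m + 2) ^ (k + (c + 1) + c') :=
        Nat.pow_le_pow_right (by omega) (by omega)
      have h5 : (m + 2) ^ c' ≤ (m + 2) ^ (k + (c + 1) + c') :=
        Nat.pow_le_pow_right (by omega) (by omega)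
      have h6 := Nat.mul_le_mul_left ((m + 2) ^ (k + (c + 1) + c')) (show 2 ≤ m + 2 by omega)
      rw [pow_succ]
      linarith
    · exact Nat.add_le_add_left (Nat.mul_le_mul_right _ (by omega)) 0
  · have he : fv m a = fun D => g.t.eval b (D.interp (I m)) (auxInterp (I m)) (g.fn b D (I m))
        a.1 a.2 fun d => d.elim := funext fun D => g.isRecSolution_fn b D (I m) a.1 a.2
    rw [he]
    refine Cost.mono (hc m a.1 a.2 (fun d => d.elim) (fun d => d.elim)
      (c * lg m ^ i + rank m a.2 * c) _ (Nat.le_add_right _ _) fun z hz => ?_) le_rfl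
      (by simp only [dv]; omega)
    refine ⟨dv m (a.1, z), ?_, .inr ⟨(a.1, z), hguard m _ _ hz, rfl⟩⟩
    have := Nat.mul_le_mul_right c (hguard m _ _ hz)
    simp only [dv]
    rw [Nat.succ_mul] at this
    omega

/-- Every definable set is decided by circuits of polynomial size and of polylogarithmic depth. -/
theorem exists_circuit_of_definable [Nontrivial R] (hb : b = true → 1 ≤ i) {S : Set (RStar R)}
    (hS : S ∈ Definable R i b) :
    ∃ c, ∀ n, ∃ C : Circuit R n, (∀ x, C.eval x = chi R (⟨n, x⟩ ∈ S)) ∧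
      C.size ≤ n + (n + 2) ^ c ∧ C.depth ≤ c * lg n ^ i ∧ (b = true → C.BoundedFanIn) := by
  classical
  obtain ⟨σ, φ, I, hS⟩ := hS
  have hu := depthUnit_lg_pow hb
  obtain ⟨c₁, h₁⟩ := φ.polyFeasible (M := fun m D => D.interp (I m))
    (e := fun m D => GFR.Holds b D (I m)) hu (polyFeasible_interp_fn I _ _)
    (polyFeasible_interp_nm I _ _) fun X g => g.polyFeasible I hb
  obtain ⟨c₂, h₂⟩ := polyFeasible_isEncoding (R := R) σ hu
  refine ⟨c₁ + c₂ + 12, fun n => ?_⟩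
  have hpos : ∀ m j, 1 ≤ (m + 2) ^ j := fun m j => Nat.one_le_pow _ _ (by omega)
  by_cases hn : ∃ m, σ.len m = n
  · obtain ⟨m, rfl⟩ := hn
    have hm : m ≤ σ.len m := σ.len_strictMono.le_apply
    obtain ⟨Γ₁, e₁, s₁, g₁, hg₁, f₁, d₁⟩ := h₂ m () SLP.nil (by simp)
    obtain ⟨Γ₂, e₂, s₂, g₂, hg₂, f₂, d₂⟩ := h₁ m (fun x => x.elim) Γ₁ (by simp)
    beta_reduce at s₁ d₁ f₁ s₂ d₂ f₂
    let B : Set (((Fin (σ.len m) → R) → R) × ℕ) :=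
      {(fun x => chi R (∃ D : RStructure σ R m, D.tuple = x), 0 + (c₁ + c₂) * lg m ^ i),
        (Γ₂.fn g₂, 0 + (c₁ + c₂) * lg m ^ i)}
    have hB : ∀ p ∈ B, Γ₂.Has id p.1 p.2 := by
      rintro p (rfl | rfl)
      · exact (show Γ₁.Has id _ _ from ⟨g₁, hg₁, f₁, d₁⟩).ext e₂ (by
          rw [Nat.add_mul]; omega)
      · exact ⟨g₂, hg₂, fun _ => rfl, d₂.trans (by rw [Nat.add_mul]; omega)⟩
    obtain ⟨Γ₃, e₃, s₃, g₃, hg₃, f₃, d₃⟩ := Feasible.mul (b := b) (io := id) (B := B)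
      (d := (c₁ + c₂) * lg m ^ i) (u := 1) (c := 0) (c' := 0) (S := 2)
      (feasible_base (.inl rfl) (by omega)) (feasible_base (.inr rfl) (by omega)) le_rfl le_rfl
      Γ₂ hB
    obtain ⟨C, hsize, heval, hdepth, hfan⟩ := Γ₃.exists_circuit hg₃
    refine ⟨C, fun x => ?_, ?_, ?_, hfan⟩
    · rw [heval]
      refine (f₃ x).trans ?_
      beta_reduce
      by_cases hx : ∃ D : RStructure σ R m, D.tuple = x
      · rw [chi_true hx, one_mul]
        obtain ⟨D, rfl⟩ := hx
        rw [f₂]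
        congr 1
        refine propext ?_
        rw [hS]
        constructor
        · exact fun h => ⟨m, D, rfl, h⟩
        · rintro ⟨m', D', he, h⟩
          obtain rfl : m' = m := σ.len_strictMono.injective (congrArg Sigma.fst he)
          have ht : D'.tuple = D.tuple := eq_of_heq (Sigma.mk.inj he).2
          exact RStructure.tuple_injective ht ▸ h
      · rw [chi_false hx, zero_mul, chi_false]
        rw [hS]
        rintro ⟨m', D', he, h⟩
        obtain rfl : m' = m := σ.len_strictMono.injective (congrArg Sigma.fst he)
        exact hx ⟨D', eq_of_heq (Sigma.mk.inj he).2⟩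
    · have h0 : (SLP.nil : SLP R b (σ.len m)).size = 0 := rfl
      have hle : ∀ j, j ≤ c₁ + c₂ → (m + 2) ^ j ≤ (σ.len m + 2) ^ (c₁ + c₂) := fun j hj =>
        (Nat.pow_le_pow_right (by omega) hj).trans (Nat.pow_le_pow_left (by omega) _)
      have h1 := hle c₁ (by omega)
      have h2 := hle c₂ (by omega)
      have h3 := hpos (σ.len m) (c₁ + c₂)
      have h4 : 2 ^ 12 ≤ (σ.len m + 2) ^ 12 := Nat.pow_le_pow_left (by omega) 12
      rw [pow_add _ _ 12]
      have h5 := Nat.mul_le_mul_left ((σ.len m + 2) ^ (c₁ + c₂)) h4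
      omega
    · have h1 : 1 ≤ lg m ^ i := Nat.one_le_pow _ _ (one_le_lg m)
      have h2 : lg m ^ i ≤ lg (σ.len m) ^ i := Nat.pow_le_pow_left (lg_mono hm) i
      have h3 := Nat.mul_le_mul_left (c₁ + c₂ + 12) h2
      have h4 : (c₁ + c₂ + 12) * lg m ^ i = (c₁ + c₂) * lg m ^ i + 12 * lg m ^ i := Nat.add_mul _ _ _
      omega
  · obtain ⟨Γ, -, s, g, hg, f, d⟩ := cost_const (b := b) (io := (id : (Fin n → R) → Fin n → R))
      (B := ∅) 0 SLP.nil (by simp)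
    obtain ⟨C, hsize, heval, hdepth, hfan⟩ := Γ.exists_circuit hg
    refine ⟨C, fun x => ?_, ?_, ?_, hfan⟩
    · rw [heval, chi_false]
      · exact f x
      · rw [hS]
        rintro ⟨m, D, he, -⟩
        exact hn ⟨m, congrArg Sigma.fst he⟩
    · have h0 : (SLP.nil : SLP R b n).size = 0 := rfl
      have h4 : (n + 2) ^ 1 ≤ (n + 2) ^ (c₁ + c₂ + 12) :=
        Nat.pow_le_pow_right (by omega) (by omega)
      rw [pow_one] at h4
      omega
    · have h1 : 1 ≤ lg n ^ i := Nat.one_le_pow _ _ (one_le_lg n)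
      nlinarith

end

/-! ## Asymptotics -/

theorem isBigO_pow_of_le {f : ℕ → ℕ} {c : ℕ} (h : ∀ n, f n ≤ n + (n + 2) ^ c) :
    ∃ k : ℕ, (fun n => (f n : ℝ)) =O[atTop] fun n : ℕ => (n : ℝ) ^ k := by
  refine ⟨2 * c + 1, IsBigO.of_bound 2 ?_⟩
  filter_upwards [eventually_ge_atTop 2] with n hn
  rw [Real.norm_natCast, norm_pow, Real.norm_natCast]
  have h1 : (n + 2) ^ c ≤ n ^ (2 * c + 1) := by
    calc (n + 2) ^ c ≤ (n ^ 2) ^ c := Nat.pow_le_pow_left (by nlinarith) c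
      _ = n ^ (2 * c) := by rw [← pow_mul]
      _ ≤ _ := Nat.pow_le_pow_right (by omega) (by omega)
  have h2 : n ≤ n ^ (2 * c + 1) := Nat.le_self_pow (by omega) n
  have h3 : f n ≤ 2 * n ^ (2 * c + 1) := by have := h n; omega
  exact_mod_cast h3

theorem one_le_logb {n : ℕ} (hn : 2 ≤ n) : 1 ≤ Real.logb 2 n := by
  rw [Real.le_logb_iff_rpow_le one_lt_two (by positivity), Real.rpow_one]
  exact_mod_cast hn

theorem lg_le_logb {n : ℕ} (hn : 2 ≤ n) : (lg n : ℝ) ≤ 3 * Real.logb 2 n := by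
  have h1 : (Nat.log 2 (n + 2) : ℝ) ≤ Real.logb 2 ((n + 2 : ℕ) : ℝ) := by
    exact_mod_cast Real.natLog_le_logb (n + 2) 2
  have h2 : Real.logb 2 ((n + 2 : ℕ) : ℝ) ≤ Real.logb 2 (2 * n) := by
    refine Real.logb_le_logb_of_le one_lt_two (by positivity) ?_
    exact_mod_cast (by omega : n + 2 ≤ 2 * n)
  have h0 : (n : ℝ) ≠ 0 := by positivity
  rw [Real.logb_mul two_ne_zero h0, Real.logb_self_eq_one one_lt_two] at h2
  have h3 := one_le_logb hn
  rw [lg]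
  push_cast
  linarith

theorem isBigO_logb_of_le {f : ℕ → ℕ} {c i : ℕ} (h : ∀ n, f n ≤ c * lg n ^ i) :
    (fun n => (f n : ℝ)) =O[atTop] fun n : ℕ => Real.logb 2 (n : ℝ) ^ i := by
  refine IsBigO.of_bound (c * 3 ^ i) ?_
  filter_upwards [eventually_ge_atTop 2] with n hn
  rw [Real.norm_natCast, norm_pow, Real.norm_of_nonneg (zero_le_one.trans (one_le_logb hn))]
  calc (f n : ℝ) ≤ c * (lg n : ℝ) ^ i := by exact_mod_cast h n
    _ ≤ c * (3 * Real.logb 2 n) ^ i := by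
      gcongr
      exact lg_le_logb hn
    _ = _ := by rw [mul_pow]; ring

theorem exists_forall_le_of_eventually {f g : ℕ → ℕ} {c : ℝ} (hg : ∀ n, 2 ≤ n → 1 ≤ g n)
    (h : ∀ᶠ n in atTop, (f n : ℝ) ≤ c * g n) : ∃ K : ℕ, ∀ n, 2 ≤ n → f n ≤ K * g n := by
  obtain ⟨N, hN⟩ := eventually_atTop.mp h
  refine ⟨⌈c⌉₊ + ∑ n ∈ Finset.range N, f n, fun n hn => ?_⟩
  rw [add_mul]
  rcases lt_or_ge n N with hlt | hge
  · have h1 : f n ≤ ∑ n ∈ Finset.range N, f n :=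
      Finset.single_le_sum (fun _ _ => Nat.zero_le _) (Finset.mem_range.mpr hlt)
    have h2 := Nat.mul_le_mul h1 (hg n hn)
    omega
  · have h1 : (f n : ℝ) ≤ ⌈c⌉₊ * g n := (hN n hge).trans
      (mul_le_mul_of_nonneg_right (Nat.le_ceil c) (Nat.cast_nonneg _))
    have h2 : f n ≤ ⌈c⌉₊ * g n := by exact_mod_cast h1
    omega

theorem exists_le_pow_of_isBigO {f : ℕ → ℕ} {k : ℕ}
    (h : (fun n => (f n : ℝ)) =O[atTop] fun n : ℕ => (n : ℝ) ^ k) :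
    ∃ r, 0 < r ∧ ∀ n, 2 ≤ n → f n ≤ n ^ r := by
  obtain ⟨c, hc⟩ := h.bound
  obtain ⟨K, hK⟩ := exists_forall_le_of_eventually (f := f) (g := fun n => n ^ k) (c := c)
    (fun n hn => Nat.one_le_pow _ _ (by omega)) (hc.mono fun n hn => by simpa using hn)
  refine ⟨K + k + 1, Nat.succ_pos _, fun n hn => (hK n hn).trans ?_⟩
  calc K * n ^ k ≤ n ^ K * n ^ k :=
        Nat.mul_le_mul_right _ (Nat.lt_two_pow_self.le.trans (Nat.pow_le_pow_left hn K))
    _ = n ^ (K + k) := (pow_add _ _ _).symm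
    _ ≤ _ := Nat.pow_le_pow_right (by omega) (Nat.le_succ _)

theorem exists_le_log_of_isBigO {f : ℕ → ℕ} {i : ℕ}
    (h : (fun n => (f n : ℝ)) =O[atTop] fun n : ℕ => Real.logb 2 (n : ℝ) ^ i) :
    ∃ w, ∀ n, 2 ≤ n → f n ≤ w * Nat.log 2 n ^ i := by
  obtain ⟨c, hc⟩ := h.bound
  refine exists_forall_le_of_eventually (f := f) (g := fun n => Nat.log 2 n ^ i)
    (c := |c| * 2 ^ i) (fun n hn => Nat.one_le_pow _ _ (Nat.log_pos one_lt_two hn)) ?_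
  filter_upwards [hc, eventually_ge_atTop 2] with n h1 hn
  have h0 := zero_le_one.trans (one_le_logb hn)
  rw [Real.norm_natCast, norm_pow, Real.norm_of_nonneg h0] at h1
  have h2 : Real.logb 2 n ≤ 2 * Nat.log 2 n := by
    have h3 : (1 : ℝ) ≤ Nat.log 2 n := by exact_mod_cast Nat.log_pos one_lt_two hn
    have h4 : Real.logb 2 n ≤ Nat.log 2 n + 1 := by
      rw [Real.logb_le_iff_le_rpow one_lt_two (by positivity)]
      exact_mod_cast (Nat.lt_pow_succ_log_self one_lt_two n).le
    linarith
  calc (f n : ℝ) ≤ c * Real.logb 2 n ^ i := h1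
    _ ≤ |c| * Real.logb 2 n ^ i := by gcongr; exact le_abs_self c
    _ ≤ |c| * (2 * Nat.log 2 n) ^ i := by gcongr
    _ = _ := by push_cast; rw [mul_pow]; ring

theorem exists_circuits_of_definable {R : Type u} [CommRing R] [LinearOrder R] [Nontrivial R]
    {b : Bool} {i : ℕ} (hb : b = true → 1 ≤ i) {S : Set (RStar R)} (hS : S ∈ Definable R i b) :
    ∃ C : ∀ n, Circuit R n, Decides C S ∧ PolySize C ∧ PolylogDepth i C ∧
      (b = true → ∀ n, (C n).BoundedFanIn) := by
  obtain ⟨c, h⟩ := exists_circuit_of_definable hb hS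
  choose C heval hsize hdepth hfan using h
  refine ⟨C, fun n x => ⟨fun hx => ?_, fun hx => ?_⟩, isBigO_pow_of_le hsize,
    isBigO_logb_of_le hdepth, fun hb n => hfan n hb⟩
  · rw [heval, chi_true hx]
  · rw [heval, chi_false hx]

/-! ## The recursion that simulates a circuit -/

section Circuits

variable {R : Type u} {n : ℕ}

/-- The predecessors that a node adds up. -/
def Node.addSet {N : ℕ} : Node R n N → Finset (Fin N)
  | .add P => P
  | .output a => {a}
  | _ => ∅

/-- The predecessors that a node multiplies. -/
def Node.mulSet {N : ℕ} : Node R n N → Finset (Fin N)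
  | .mul P => P
  | _ => ∅

/-- The left predecessor of a comparison node. -/
def Node.leftSet {N : ℕ} : Node R n N → Finset (Fin N)
  | .lt a _ => {a}
  | _ => ∅

/-- The right predecessor of a comparison node. -/
def Node.rightSet {N : ℕ} : Node R n N → Finset (Fin N)
  | .lt _ b => {b}
  | _ => ∅

theorem Node.value_eq [CommRing R] [LinearOrder R] {N : ℕ} (x : Fin n → R) (v : Fin N → R)
    (nd : Node R n N) (hi : ∀ i, nd ≠ .input i) (hc : ∀ r, nd ≠ .const r) :
    nd.value x v = ∑ p ∈ nd.addSet, v p +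
      (chi R (∃ P, nd = .mul P) * ∏ p ∈ nd.mulSet, v p +
        chi R (∑ p ∈ nd.leftSet, v p < ∑ p ∈ nd.rightSet, v p)) := by
  cases nd <;> simp_all [Node.value, Node.addSet, Node.mulSet, Node.leftSet, Node.rightSet, chi]

namespace Circuit

/-- There is a path from an input node to `g`. -/
def Reachable (C : Circuit R n) (g : Fin C.size) : Prop :=
  ∃ i g₀ k, C.node g₀ = .input i ∧ C.Path g₀ g k

/-- All paths from input nodes to `g` have length at most `k`. -/
def HeightLE (C : Circuit R n) (g : Fin C.size) (k : ℕ) : Prop :=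
  ∀ i g₀ k', C.node g₀ = .input i → C.Path g₀ g k' → k' ≤ k

theorem heightLE_out (C : Circuit R n) : C.HeightLE C.out C.depth := fun i g₀ _ h p =>
  le_csSup C.bddAbove_pathLengths ⟨i, g₀, h, p⟩

theorem HeightLE.pred {C : Circuit R n} {g p : Fin C.size} {k : ℕ} (h : C.HeightLE g (k + 1))
    (hp : p ∈ (C.node g).preds) : C.HeightLE p k := fun i g₀ _ h₀ h' =>
  Nat.succ_le_succ_iff.mp (h i g₀ _ h₀ (h'.cons hp))

theorem Reachable.of_pred {C : Circuit R n} {g p : Fin C.size} (h : C.Reachable p)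
    (hp : p ∈ (C.node g).preds) : C.Reachable g := by
  obtain ⟨i, g₀, k, h₀, h'⟩ := h
  exact ⟨i, g₀, _, h₀, h'.cons hp⟩

theorem reachable_input {C : Circuit R n} {g : Fin C.size} {i : Fin n} (h : C.node g = .input i) :
    C.Reachable g := ⟨i, g, 0, h, .nil⟩

theorem not_reachable_const {C : Circuit R n} {g : Fin C.size} {r : R} (h : C.node g = .const r) :
    ¬ C.Reachable g := by
  rintro ⟨i, g₀, k, h₀, h'⟩
  cases h' with
  | nil => rw [h] at h₀; cases h₀
  | cons _ hp => rw [h] at hp; simp [Node.preds] at hp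

theorem Reachable.eq_input_of_heightLE {C : Circuit R n} {g : Fin C.size} (h : C.Reachable g)
    (h0 : C.HeightLE g 0) : ∃ i, C.node g = .input i := by
  obtain ⟨i, g₀, k, h₀, h'⟩ := h
  obtain rfl : k = 0 := Nat.le_zero.mp (h0 i g₀ k h₀ h')
  cases h'
  exact ⟨i, h₀⟩

variable [CommRing R] [LinearOrder R]

theorem Node.value_congr {N : ℕ} {x : Fin n → R} {v v' : Fin N → R} {nd : Node R n N}
    (h : ∀ p ∈ nd.preds, v p = v' p) : nd.value x v = nd.value x v' := by
  cases nd with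
  | input i => rfl
  | const r => rfl
  | add P => exact Finset.sum_congr rfl h
  | mul P => exact Finset.prod_congr rfl h
  | lt a b =>
    simp only [Node.value]
    rw [h a (by simp [Node.preds]), h b (by simp [Node.preds])]
  | output a => exact h a (by simp [Node.preds])

theorem val_eq_of_not_reachable (C : Circuit R n) (x x' : Fin n → R) (g : Fin C.size)
    (hg : ¬ C.Reachable g) : C.val x g = C.val x' g := by
  induction g using WellFoundedLT.induction with
  | _ g ih =>
    have h : (C.node g).value x (C.val x) = (C.node g).value x (C.val x') :=
      Node.value_congr fun p hp => ih p (C.topological g p hp) fun hr => hg (hr.of_pred hp)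
    rw [C.val_eq, C.val_eq, h]
    cases hn : C.node g with
    | input i => exact absurd (reachable_input hn) hg
    | _ => rfl

/-- A layered evaluation of the circuit is correct once there are enough layers. -/
theorem eq_val_of_layers (C : Circuit R n) (x : Fin n → R) (v : ℕ → Fin C.size → R) (K : ℕ)
    (hc : ∀ k ≤ K, ∀ g, ¬ C.Reachable g → v k g = C.val x g)
    (hi : ∀ k ≤ K, ∀ g i, C.node g = .input i → v k g = x i)
    (hs : ∀ k < K, ∀ g, C.Reachable g → (∀ i, C.node g ≠ .input i) →
      v (k + 1) g = (C.node g).value x (v k)) :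
    ∀ k ≤ K, ∀ g, C.HeightLE g k → v k g = C.val x g := by
  intro k
  induction k with
  | zero =>
    intro hk g hg
    by_cases hr : C.Reachable g
    · obtain ⟨i, h⟩ := hr.eq_input_of_heightLE hg
      rw [hi _ hk g i h, C.val_eq, h]
      rfl
    · exact hc _ hk g hr
  | succ k ih =>
    intro hk g hg
    by_cases hr : C.Reachable g
    · by_cases h : ∃ i, C.node g = .input i
      · obtain ⟨i, h⟩ := h
        rw [hi _ hk g i h, C.val_eq, h]
        rfl
      · rw [hs k (by omega) g hr (not_exists.mp h), C.val_eq]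
        exact Node.value_congr fun p hp => ih (by omega) p (hg.pred hp)
    · exact hc _ hk g hr

end Circuit

end Circuits

/-- A representation of the gates of a circuit, at all times of an evaluation that proceeds in `K`
steps, by tuples over the universe. -/
structure Simulation {R : Type u} {m : ℕ} (C : Circuit R m) (i w r : ℕ) where
  gate : Fin C.size → Fin r → Fin m
  gate_injective : Function.Injective gate
  K : ℕ
  depth_le : C.depth ≤ K
  time : ℕ → Fin i × Fin w → Fin m
  time_pred : ∀ k < K, ∀ k' < K, time (k + 1) = time (k' + 1) → time k = time k'

namespace Simulation

section

variable {R : Type u} {m i w r : ℕ} {C : Circuit R m} (s : Simulation C i w r)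

/-- The tuple that represents the gate `g` at time `k`. -/
def enc (k : ℕ) (g : Fin C.size) : Block i w r → Fin m := Sum.elim (s.time k) (s.gate g)

/-- `y` represents a gate, and `z` represents one of its predecessors at the previous time. -/
def Pred (T : Node R m C.size → Finset (Fin C.size)) (y z : Block i w r → Fin m) : Prop :=
  ∃ k < s.K, ∃ g p, y ∘ Sum.inl = s.time (k + 1) ∧ y ∘ Sum.inr = s.gate g ∧ C.Reachable g ∧
    p ∈ T (C.node g) ∧ z = s.enc k p

/-- `y` represents an input node, and `z` its number. -/
def IsInput (y z : Block i w r → Fin m) : Prop :=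
  ∃ g j, y ∘ Sum.inr = s.gate g ∧ C.node g = .input j ∧ z = fun _ => j

/-- `y` represents a multiplication node. -/
def IsMul (y : Block i w r → Fin m) : Prop :=
  ∃ g P, y ∘ Sum.inr = s.gate g ∧ C.Reachable g ∧ C.node g = .mul P

theorem pred_enc {T : Node R m C.size → Finset (Fin C.size)} {k : ℕ} (hk : k < s.K)
    {g : Fin C.size} (hg : C.Reachable g) (z : Block i w r → Fin m) :
    s.Pred T (s.enc (k + 1) g) z ↔ ∃ p ∈ T (C.node g), z = s.enc k p := by
  constructor
  · rintro ⟨k', hk', g', p, h1, h2, -, hp, rfl⟩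
    obtain rfl : g = g' := s.gate_injective h2
    refine ⟨p, hp, ?_⟩
    rw [enc, enc, s.time_pred k hk k' hk' h1]
  · rintro ⟨p, hp, rfl⟩
    exact ⟨k, hk, g, p, rfl, rfl, hg, hp, rfl⟩

theorem not_pred_enc {T : Node R m C.size → Finset (Fin C.size)} {k : ℕ} {g : Fin C.size}
    (hg : ¬ C.Reachable g ∨ T (C.node g) = ∅) (z : Block i w r → Fin m) :
    ¬ s.Pred T (s.enc k g) z := by
  rintro ⟨k', hk', g', p, h1, h2, hr, hp, rfl⟩
  obtain rfl : g = g' := s.gate_injective h2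
  rcases hg with hg | hg
  · exact hg hr
  · rw [hg] at hp
    simp at hp

theorem isInput_enc {k : ℕ} {g : Fin C.size} (z : Block i w r → Fin m) :
    s.IsInput (s.enc k g) z ↔ ∃ j, C.node g = .input j ∧ z = fun _ => j := by
  constructor
  · rintro ⟨g', j, h, h1, h2⟩
    obtain rfl : g = g' := s.gate_injective h
    exact ⟨j, h1, h2⟩
  · rintro ⟨j, h1, h2⟩
    exact ⟨g, j, rfl, h1, h2⟩

theorem isMul_enc {k : ℕ} {g : Fin C.size} :
    s.IsMul (s.enc k g) ↔ C.Reachable g ∧ ∃ P, C.node g = .mul P := by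
  constructor
  · rintro ⟨g', P, h, h1, h2⟩
    obtain rfl : g = g' := s.gate_injective h
    exact ⟨h1, P, h2⟩
  · rintro ⟨h1, P, h2⟩
    exact ⟨g, P, rfl, h1, h2⟩

theorem enc_injective (k : ℕ) : Function.Injective (s.enc k) := fun _ _ h =>
  s.gate_injective (funext fun l => congrFun h (.inr l))

theorem Pred.eq_or_eq_or_eq {s : Simulation C i w r} {T : Node R m C.size → Finset (Fin C.size)}
    (hT : ∀ g, (T (C.node g)).card ≤ 2) {y a c d : Block i w r → Fin m} (ha : s.Pred T y a)
    (hc : s.Pred T y c) (hd : s.Pred T y d) : a = c ∨ a = d ∨ c = d := by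
  obtain ⟨k, hk, g, p, h1, h2, -, hp, rfl⟩ := ha
  obtain ⟨k₁, hk₁, g₁, p₁, h1₁, h2₁, -, hp₁, rfl⟩ := hc
  obtain ⟨k₂, hk₂, g₂, p₂, h1₂, h2₂, -, hp₂, rfl⟩ := hd
  obtain rfl : g = g₁ := s.gate_injective (h2.symm.trans h2₁)
  obtain rfl : g = g₂ := s.gate_injective (h2.symm.trans h2₂)
  have e₁ := s.time_pred k hk k₁ hk₁ (h1.symm.trans h1₁)
  have e₂ := s.time_pred k hk k₂ hk₂ (h1.symm.trans h1₂)
  simp only [enc, ← e₁, ← e₂]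
  by_contra hne
  simp only [not_or] at hne
  have hlt : 2 < (T (C.node g)).card := Finset.two_lt_card_iff.mpr
    ⟨p, p₁, p₂, hp, hp₁, hp₂, fun h => hne.1 (by rw [h]), fun h => hne.2.1 (by rw [h]),
      fun h => hne.2.2 (by rw [h])⟩
  exact absurd (hT g) (not_le.mpr hlt)

end

variable {R : Type u} [CommRing R] {m i w r : ℕ} {C : Circuit R m} (s : Simulation C i w r)

theorem sum_pred {T : Node R m C.size → Finset (Fin C.size)} {k : ℕ} (hk : k < s.K)
    {g : Fin C.size} (hg : C.Reachable g) (F : (Block i w r → Fin m) → R) :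
    ∑ z, chi R (s.Pred T (s.enc (k + 1) g) z) * F z = ∑ p ∈ T (C.node g), F (s.enc k p) := by
  classical
  rw [← Finset.sum_image (s := T (C.node g)) (g := s.enc k) (f := F)
    fun _ _ _ _ h => s.enc_injective k h]
  rw [← Finset.sum_filter_add_sum_filter_not Finset.univ (· ∈ (T (C.node g)).image (s.enc k))]
  rw [Finset.sum_eq_zero (s := Finset.univ.filter (· ∉ (T (C.node g)).image (s.enc k))), add_zero,
    Finset.filter_mem_eq_inter, Finset.univ_inter]
  · refine Finset.sum_congr rfl fun z hz => ?_
    obtain ⟨p, hp, rfl⟩ := Finset.mem_image.mp hz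
    rw [chi_true ((s.pred_enc hk hg _).mpr ⟨p, hp, rfl⟩), one_mul]
  · intro z hz
    rw [chi_false, zero_mul]
    rw [s.pred_enc hk hg]
    rintro ⟨p, hp, rfl⟩
    exact (Finset.mem_filter.mp hz).2 (Finset.mem_image_of_mem _ hp)

theorem prod_pred {T : Node R m C.size → Finset (Fin C.size)} {k : ℕ} (hk : k < s.K)
    {g : Fin C.size} (hg : C.Reachable g) (F : (Block i w r → Fin m) → R) :
    ∏ z, (chi R (s.Pred T (s.enc (k + 1) g) z) * F z +
      chi R (¬ s.Pred T (s.enc (k + 1) g) z) * 1) = ∏ p ∈ T (C.node g), F (s.enc k p) := by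
  classical
  rw [← Finset.prod_image (s := T (C.node g)) (g := s.enc k) (f := F)
    fun _ _ _ _ h => s.enc_injective k h]
  rw [← Finset.prod_filter_mul_prod_filter_not Finset.univ (· ∈ (T (C.node g)).image (s.enc k))]
  rw [Finset.prod_eq_one (s := Finset.univ.filter (· ∉ (T (C.node g)).image (s.enc k))), mul_one,
    Finset.filter_mem_eq_inter, Finset.univ_inter]
  · refine Finset.prod_congr rfl fun z hz => ?_
    obtain ⟨p, hp, rfl⟩ := Finset.mem_image.mp hz
    have h := (s.pred_enc hk hg _).mpr ⟨p, hp, rfl⟩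
    rw [chi_true h, chi_false (not_not.mpr h), one_mul, zero_mul, add_zero]
  · intro z hz
    have h : ¬ s.Pred T (s.enc (k + 1) g) z := by
      rw [s.pred_enc hk hg]
      rintro ⟨p, hp, rfl⟩
      exact (Finset.mem_filter.mp hz).2 (Finset.mem_image_of_mem _ hp)
    rw [chi_false h, chi_true h, zero_mul, zero_add, one_mul]

theorem sum_not_pred {T : Node R m C.size → Finset (Fin C.size)} {k : ℕ} {g : Fin C.size}
    (hg : ¬ C.Reachable g ∨ T (C.node g) = ∅) (F : (Block i w r → Fin m) → R) :
    ∑ z, chi R (s.Pred T (s.enc k g) z) * F z = 0 :=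
  Finset.sum_eq_zero fun z _ => by rw [chi_false (s.not_pred_enc hg z), zero_mul]

theorem sum_input_eq_zero {k : ℕ} {g : Fin C.size} (hg : ∀ j, C.node g ≠ .input j)
    (x : Fin m → R) : ∑ j, chi R (s.IsInput (s.enc k g) fun _ => j) * x j = 0 := by
  refine Finset.sum_eq_zero fun j _ => ?_
  rw [chi_false, zero_mul]
  rw [s.isInput_enc]
  rintro ⟨j, h, -⟩
  exact hg j h

theorem sum_input (hr : 0 < r) {k : ℕ} {g : Fin C.size} {j₀ : Fin m} (hg : C.node g = .input j₀)
    (x : Fin m → R) : ∑ j, chi R (s.IsInput (s.enc k g) fun _ => j) * x j = x j₀ := by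
  rw [← sum_chi_mul j₀ x]
  refine Finset.sum_congr rfl fun j _ => ?_
  congr 2
  rw [s.isInput_enc, hg]
  refine propext ⟨?_, fun h => ⟨j₀, rfl, h ▸ rfl⟩⟩
  rintro ⟨j', h, h'⟩
  cases h
  exact (congrFun h' (.inr ⟨0, hr⟩)).symm

variable [LinearOrder R]

open Classical in
/-- The value of the gate that is represented by `y`, if it does not depend on the input. -/
noncomputable def constVal (y : Block i w r → Fin m) : R :=
  if h : ∃ g, y ∘ Sum.inr = s.gate g ∧ ¬ C.Reachable g then C.val 0 h.choose else 0

theorem constVal_enc_of_not_reachable {k : ℕ} {g : Fin C.size} (hg : ¬ C.Reachable g)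
    (x : Fin m → R) : s.constVal (s.enc k g) = C.val x g := by
  have h : ∃ g', s.enc k g ∘ Sum.inr = s.gate g' ∧ ¬ C.Reachable g' := ⟨g, rfl, hg⟩
  have he : g = h.choose := s.gate_injective h.choose_spec.1
  rw [constVal, dif_pos h, ← he]
  exact C.val_eq_of_not_reachable _ _ _ hg

theorem constVal_enc_of_reachable {k : ℕ} {g : Fin C.size} (hg : C.Reachable g) :
    s.constVal (s.enc k g) = 0 := by
  rw [constVal, dif_neg]
  rintro ⟨g', h, hg'⟩
  obtain rfl : g = g' := s.gate_injective h
  exact hg' hg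

/-- The right hand side of the recursion that simulates the circuit. -/
noncomputable def body (x : Fin m → R) (F : (Block i w r → Fin m) → R)
    (y : Block i w r → Fin m) : R :=
  (s.constVal y + ∑ j, chi R (s.IsInput y fun _ => j) * x j) +
    ((∑ z, chi R (s.Pred Node.addSet y z) * F z) +
      (chi R (s.IsMul y) *
          (∏ z, (chi R (s.Pred Node.mulSet y z) * F z + chi R (¬ s.Pred Node.mulSet y z) * 1)) +
        chi R ((∑ z, chi R (s.Pred Node.leftSet y z) * F z) <
          ∑ z, chi R (s.Pred Node.rightSet y z) * F z)))

/-- The simulation computes the value of the circuit. -/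
theorem eq_eval (hr : 0 < r) (x : Fin m → R) (F : ℕ → (Block i w r → Fin m) → R)
    (hF : ∀ k y, F (k + 1) y = s.body x (F k) y) : F (s.K + 1) (s.enc s.K C.out) = C.eval x := by
  refine C.eq_val_of_layers x (fun k g => F (k + 1) (s.enc k g)) s.K ?_ ?_ ?_ s.K le_rfl C.out
    fun i g₀ k h p => (C.heightLE_out i g₀ k h p).trans s.depth_le
  · intro k _ g hg
    have h0 : ∀ j, C.node g ≠ .input j := fun j h => hg (Circuit.reachable_input h)
    rw [hF, body, s.constVal_enc_of_not_reachable hg x, s.sum_input_eq_zero h0,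
      s.sum_not_pred (.inl hg), s.sum_not_pred (.inl hg), s.sum_not_pred (.inl hg),
      chi_false fun h => hg (s.isMul_enc.mp h).1, chi_false (lt_irrefl _)]
    ring
  · intro k _ g j hg
    have hreach := Circuit.reachable_input hg
    rw [hF, body, s.constVal_enc_of_reachable hreach, s.sum_input hr hg,
      s.sum_not_pred (.inr (by rw [hg]; rfl)), s.sum_not_pred (.inr (by rw [hg]; rfl)),
      s.sum_not_pred (.inr (by rw [hg]; rfl)), chi_false (lt_irrefl _), chi_false]
    · ring
    · rw [s.isMul_enc, hg]
      rintro ⟨-, P, h⟩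
      cases h
  · intro k hk g hg hg'
    have hc : ∀ c, C.node g ≠ .const c := fun c h => Circuit.not_reachable_const h hg
    rw [hF, body, s.constVal_enc_of_reachable hg, s.sum_input_eq_zero hg', s.sum_pred hk hg,
      s.sum_pred hk hg, s.sum_pred hk hg, s.prod_pred hk hg, Node.value_eq _ _ _ hg' hc, zero_add,
      zero_add]
    congr 4
    rw [s.isMul_enc]
    exact propext ⟨fun h => h.2, fun h => ⟨hg, h⟩⟩

end Simulation

/-! ## The sentence that simulates a circuit -/

/-- An enumeration of the variables of a block. -/
def blockEquiv (i w r : ℕ) : Fin (i * w + r) ≃ Block i w r :=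
  finSumFinEquiv.symm.trans (Equiv.sumCongr finProdFinEquiv.symm (Equiv.refl _))

/-- An enumeration of the variables of two blocks. -/
def pairEquiv (i w r : ℕ) : Fin ((i * w + r) + (i * w + r)) ≃ Block i w r ⊕ Block i w r :=
  finSumFinEquiv.symm.trans (Equiv.sumCongr (blockEquiv i w r) (blockEquiv i w r))

/-- One unary function for the input and eight auxiliary functions for the circuit. -/
abbrev simSignature (i w r : ℕ) : Signature where
  numS := 0
  arS s := s.elim0
  numF := 1
  arF _ := 1
  numA := 8
  arA _ := (i * w + r) + (i * w + r)
  nondegenerate := .inr ⟨0, one_pos⟩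

section blockSums

variable {R : Type u} [CommRing R] {m i w r : ℕ}

theorem sum_blockEquiv (G : (Block i w r → Fin m) → R) :
    ∑ a : Fin (i * w + r) → Fin m, G (a ∘ (blockEquiv i w r).symm) = ∑ z, G z :=
  Equiv.sum_comp (Equiv.arrowCongr (blockEquiv i w r) (Equiv.refl (Fin m))) G

theorem prod_blockEquiv (G : (Block i w r → Fin m) → R) :
    ∏ a : Fin (i * w + r) → Fin m, G (a ∘ (blockEquiv i w r).symm) = ∏ z, G z :=
  Equiv.prod_comp (Equiv.arrowCongr (blockEquiv i w r) (Equiv.refl (Fin m))) G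

theorem sum_fin_one (G : Fin m → R) : ∑ a : Fin 1 → Fin m, G (a 0) = ∑ j, G j :=
  Equiv.sum_comp (Equiv.funUnique (Fin 1) (Fin m)) G

theorem chi_eq_one_iff [Nontrivial R] {p : Prop} : chi R p = 1 ↔ p := by
  by_cases h : p <;> simp [chi, h]

end blockSums

namespace Simulation

variable {R : Type u} [CommRing R] [LinearOrder R] {m i w r : ℕ} {C : Circuit R m}
  (s : Simulation C i w r)

/-- The auxiliary functions that describe the circuit. -/
noncomputable def aux (j : Fin 8) (y z : Block i w r → Fin m) : R :=
  ![s.constVal y, chi R (s.IsInput y z), chi R (s.IsMul y), chi R (s.Pred Node.addSet y z),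
    chi R (s.Pred Node.mulSet y z), chi R (s.Pred Node.leftSet y z),
    chi R (s.Pred Node.rightSet y z), chi R (s.enc s.K C.out = y)] j

theorem aux_zero (y z : Block i w r → Fin m) : s.aux 0 y z = s.constVal y := rfl
theorem aux_one (y z : Block i w r → Fin m) : s.aux 1 y z = chi R (s.IsInput y z) := rfl
theorem aux_two (y z : Block i w r → Fin m) : s.aux 2 y z = chi R (s.IsMul y) := rfl
theorem aux_three (y z : Block i w r → Fin m) : s.aux 3 y z = chi R (s.Pred Node.addSet y z) := rfl
theorem aux_four (y z : Block i w r → Fin m) : s.aux 4 y z = chi R (s.Pred Node.mulSet y z) := rfl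
theorem aux_five (y z : Block i w r → Fin m) : s.aux 5 y z = chi R (s.Pred Node.leftSet y z) := rfl
theorem aux_six (y z : Block i w r → Fin m) : s.aux 6 y z = chi R (s.Pred Node.rightSet y z) := rfl
theorem aux_seven (y z : Block i w r → Fin m) : s.aux 7 y z = chi R (s.enc s.K C.out = y) := rfl

/-- The interpretation of the auxiliary symbols by the description of the circuit. -/
noncomputable def arb : ArbInterp (simSignature i w r) R m := fun j a =>
  s.aux j (fun l => a ((pairEquiv i w r).symm (.inl l))) fun l => a ((pairEquiv i w r).symm (.inr l))

end Simulation

section Terms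

variable {R : Type u} {i w r : ℕ} {E : Type → Type v} {X : Type}

/-- The application of an auxiliary symbol to two blocks of variables. -/
def auxTerm (j : Fin 8) (y z : Block i w r → X) : NumTerm (simSignature i w r).vocab R E X :=
  .app (.inr j) fun q => .var (Sum.elim y z (pairEquiv i w r q))

/-- The input at the position `x`. -/
def inputTerm (i w r : ℕ) (x : X) : NumTerm (simSignature i w r).vocab R E X :=
  .app (.inl (0 : Fin 1)) fun _ => .var x

/-- The summand of a gate for inputs and constants. -/
def leafTerm (y : Block i w r → X) : NumTerm (simSignature i w r).vocab R E X :=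
  .add (auxTerm 0 y y)
    (.sum 1 (.mul (auxTerm 1 (Sum.inl ∘ y) fun _ => .inr 0) (inputTerm i w r (.inr 0))))

/-- The variables of a block that is bound by an aggregation. -/
def boundBlock : Block i w r → X ⊕ Fin (i * w + r) := fun l => .inr ((blockEquiv i w r).symm l)

/-- The sum of `t` over the predecessors described by the auxiliary symbol `j`. -/
def sumTerm (j : Fin 8) (y : Block i w r → X)
    (t : NumTerm (simSignature i w r).vocab R E (X ⊕ Fin (i * w + r))) :
    NumTerm (simSignature i w r).vocab R E X :=
  .sum (i * w + r) (.mul (auxTerm j (Sum.inl ∘ y) boundBlock) t)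

/-- The evaluation of the circuit in `k` steps. -/
def layerTerm [One R] [Zero R] :
    ℕ → ∀ {X : Type}, (Block i w r → X) → NumTerm (simSignature i w r).vocab R E X
  | 0, _, _ => .const 0
  | k + 1, _, y => .add (leafTerm y) (.add (sumTerm 3 y (layerTerm k boundBlock))
      (.add
        (.mul (auxTerm 2 y y) (.prod (i * w + r) (.add
          (.mul (auxTerm 4 (Sum.inl ∘ y) boundBlock) (layerTerm k boundBlock))
          (.mul (.chi (.not (.numEq (auxTerm 4 (Sum.inl ∘ y) boundBlock) (.const 1))))
            (.const 1)))))
        (.chi (.numLt (sumTerm 5 y (layerTerm k boundBlock))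
          (sumTerm 6 y (layerTerm k boundBlock))))))

/-- The circuit, evaluated in `k` steps, accepts. -/
def layerFormula [One R] [Zero R] (i w r k : ℕ) :
    Formula (simSignature i w r).vocab R E X :=
  .numEq (.sum (i * w + r) (.mul (auxTerm 7 boundBlock boundBlock) (layerTerm k boundBlock)))
    (.const 1)

/-- The condition `ξ` for a guarded aggregation over predecessors. -/
def predFormula [One R] (i w r : ℕ) (j : Fin 8) :
    Formula (simSignature i w r).auxVocab R NoExtra (Block i w r ⊕ Block i w r) :=
  .numEq (.app j fun q => .var (pairEquiv i w r q)) (.const 1)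

/-- The guarded aggregation over the predecessors described by the auxiliary symbol `j`. -/
def guardedTerm [One R] {P D : Type} (A : Aggregator) (j : Fin 8) :
    RecTerm (simSignature i w r).vocab (simSignature i w r).auxVocab R P (Block i w r) D :=
  .guarded A (predFormula i w r j) (.call (.inr ()))

/-- The recursion that evaluates the circuit. -/
def recTerm [One R] (i w r : ℕ) :
    RecTerm (simSignature i w r).vocab (simSignature i w r).auxVocab R (Fin 0) (Block i w r)
      Empty :=
  .add (.pure (leafTerm fun l => .inl (.inr l))) (.add (guardedTerm .sum 3)
    (.add (.mul (.pure (auxTerm 2 (fun l => .inl (.inr l)) fun l => .inl (.inr l)))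
        (guardedTerm .prod 4))
      (.chi (.numLt (guardedTerm .sum 5) (guardedTerm .sum 6)))))

/-- The circuit, evaluated by recursion, accepts. -/
def recGFR [One R] (i w r : ℕ) (hw : 0 < w) (X : Type) : GFR (simSignature i w r) R i X where
  p := 0
  w := w
  w_pos := hw
  r := r
  t := recTerm i w r
  ψ := .numEq (.sum (i * w + r) (.mul
      (.app (.inl (.inr (7 : Fin 8)))
        fun q => .var (Sum.elim boundBlock boundBlock (pairEquiv i w r q)))
      (.app (.inr ()) (Sum.elim Fin.elim0 fun l => .var (boundBlock l)))))
    (.const 1)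

end Terms

theorem card_addSet_le {R : Type u} {m : ℕ} {C : Circuit R m} (h : C.BoundedFanIn) (g : Fin C.size) :
    (C.node g).addSet.card ≤ 2 := by
  cases hn : C.node g with
  | add P => exact h g P (.inl hn)
  | _ => simp [Node.addSet]

theorem card_mulSet_le {R : Type u} {m : ℕ} {C : Circuit R m} (h : C.BoundedFanIn) (g : Fin C.size) :
    (C.node g).mulSet.card ≤ 2 := by
  cases hn : C.node g with
  | mul P => exact h g P (.inr hn)
  | _ => simp [Node.mulSet]

section Semantics

variable {R : Type u} [CommRing R] [LinearOrder R] {m i w r : ℕ} {C : Circuit R m}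
  (s : Simulation C i w r) (D : RStructure (simSignature i w r) R m) {X : Type}
  {E : Type → Type v} (e : ∀ X : Type, E X → (X → Fin m) → Prop)

/-- The input tuple that is represented by a structure. -/
def RStructure.input (D : RStructure (simSignature i w r) R m) : Fin m → R := fun j =>
  D.nm (0 : Fin 1) fun _ => j

theorem eval_auxTerm (j : Fin 8) (y z : Block i w r → X) (ν : X → Fin m) :
    (auxTerm j y z).eval (D.interp s.arb) e ν = s.aux j (ν ∘ y) (ν ∘ z) := by
  simp only [auxTerm, NumTerm.eval, IdxTerm.eval, RStructure.interp, Simulation.arb,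
    Equiv.apply_symm_apply, Sum.elim_inl, Sum.elim_inr]
  rfl

theorem eval_inputTerm (I : ArbInterp (simSignature i w r) R m) (x : X) (ν : X → Fin m) :
    (inputTerm i w r x).eval (D.interp I) e ν = D.input (ν x) := by
  simp only [inputTerm, NumTerm.eval, IdxTerm.eval]
  rfl

theorem elim_comp_boundBlock (ν : X → Fin m) (a : Fin (i * w + r) → Fin m) :
    Sum.elim ν a ∘ (boundBlock : Block i w r → X ⊕ _) = a ∘ (blockEquiv i w r).symm := rfl

theorem elim_comp_inl_comp {Z A : Type} (ν : X → Fin m) (a : A → Fin m) (y : Z → X) :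
    Sum.elim ν a ∘ Sum.inl ∘ y = ν ∘ y := rfl

theorem eval_leafTerm (y : Block i w r → X) (ν : X → Fin m) :
    (leafTerm y).eval (D.interp s.arb) e ν =
      s.constVal (ν ∘ y) + ∑ j, chi R (s.IsInput (ν ∘ y) fun _ => j) * D.input j := by
  simp only [leafTerm, NumTerm.eval, eval_auxTerm, eval_inputTerm, Simulation.aux_zero,
    Simulation.aux_one, elim_comp_inl_comp, Sum.elim_inr]
  congr 1
  exact sum_fin_one fun j => chi R (s.IsInput (ν ∘ y) fun _ => j) * D.input j

theorem eval_sumTerm (j : Fin 8) (y : Block i w r → X)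
    (t : NumTerm (simSignature i w r).vocab R E (X ⊕ Fin (i * w + r)))
    (F : (Block i w r → Fin m) → R) (ν : X → Fin m)
    (ht : ∀ a, t.eval (D.interp s.arb) e (Sum.elim ν a) = F (a ∘ (blockEquiv i w r).symm)) :
    (sumTerm j y t).eval (D.interp s.arb) e ν = ∑ z, s.aux j (ν ∘ y) z * F z := by
  simp only [sumTerm, NumTerm.eval, eval_auxTerm, ht, elim_comp_inl_comp, elim_comp_boundBlock]
  exact sum_blockEquiv fun z => s.aux j (ν ∘ y) z * F z

theorem eval_layerTerm [Nontrivial R] (k : ℕ) (y : Block i w r → X) (ν : X → Fin m) :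
    (layerTerm k y).eval (D.interp s.arb) e ν = (s.body D.input)^[k] (fun _ => 0) (ν ∘ y) := by
  induction k generalizing X with
  | zero => simp only [layerTerm, NumTerm.eval, Function.iterate_zero, id]
  | succ k ih =>
    have hb : ∀ (ν : X → Fin m) a, (layerTerm k boundBlock).eval (D.interp s.arb) e
        (Sum.elim ν a) = (s.body D.input)^[k] (fun _ => 0) (a ∘ (blockEquiv i w r).symm) :=
      fun ν a => ih boundBlock (Sum.elim ν a)
    rw [Function.iterate_succ_apply']
    simp only [layerTerm, NumTerm.eval, Formula.truth, eval_leafTerm,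
      eval_sumTerm s D e _ _ _ _ _ (hb ν), eval_auxTerm, hb, elim_comp_inl_comp,
      elim_comp_boundBlock, Simulation.aux_two, Simulation.aux_three, Simulation.aux_four,
      Simulation.aux_five, Simulation.aux_six, chi_eq_one_iff, Simulation.body]
    rw [prod_blockEquiv fun z => chi R (s.Pred Node.mulSet (ν ∘ y) z) *
      (s.body D.input)^[k] (fun _ => 0) z + chi R (¬ s.Pred Node.mulSet (ν ∘ y) z) * 1]

theorem holds_layerFormula [Nontrivial R] (hr : 0 < r) (ν : X → Fin m) :
    (layerFormula i w r (s.K + 1)).Holds (D.interp s.arb) e ν ↔ C.eval D.input = 1 := by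
  rw [← s.eq_eval hr D.input (fun k => (s.body D.input)^[k] fun _ => 0)
    fun k y => by rw [Function.iterate_succ_apply']]
  simp only [layerFormula, Formula.Holds, Formula.truth, NumTerm.eval, eval_auxTerm,
    eval_layerTerm, elim_comp_boundBlock, Simulation.aux_seven]
  rw [sum_blockEquiv fun z => chi R (s.enc s.K C.out = z) *
    (s.body D.input)^[s.K + 1] (fun _ => 0) z, sum_chi_mul]

theorem holds_predFormula [Nontrivial R] (j : Fin 8) (y z : Block i w r → Fin m) :
    (predFormula i w r j).Holds (auxInterp s.arb) noExtra (Sum.elim y z) ↔ s.aux j y z = 1 := by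
  simp only [predFormula, Formula.Holds, Formula.truth, NumTerm.eval, IdxTerm.eval, auxInterp,
    Simulation.arb, Equiv.apply_symm_apply, Sum.elim_inl, Sum.elim_inr]

theorem amongTwoLargest_iff {φ : (Block i w r → Fin m) → Prop}
    (h : ∀ a c d, φ a → φ c → φ d → a = c ∨ a = d ∨ c = d) (z : Block i w r → Fin m) :
    AmongTwoLargest φ z ↔ φ z := by
  refine ⟨fun hz => hz.1, fun hz => ⟨hz, fun a c hac hza hzc => ?_⟩⟩
  have irrefl : ∀ a : Block i w r → Fin m, ¬ BlockLT a a := by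
    rintro a ⟨l, -, hl⟩
    exact lt_irrefl _ hl
  by_contra hn
  simp only [not_or, not_not] at hn
  rcases h z a c hz hn.1 hn.2 with rfl | rfl | h
  · exact irrefl _ hza
  · exact irrefl _ hzc
  · exact hac h

theorem inRange_predFormula [Nontrivial R] {b : Bool} {j : Fin 8}
    {T : Node R m C.size → Finset (Fin C.size)}
    (hj : ∀ y z, s.aux j y z = chi R (s.Pred T y z))
    (hG : ∀ T y z, s.Pred T y z → Guard y z)
    (hT : b = true → ∀ g, (T (C.node g)).card ≤ 2) (y : Block i w r → Fin m) :
    InRange b (auxInterp s.arb) (predFormula i w r j) y = s.Pred T y := by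
  have h : (fun z => Guard y z ∧
      (predFormula i w r j).Holds (auxInterp s.arb) noExtra (Sum.elim y z)) = s.Pred T y := by
    funext z
    rw [holds_predFormula, hj, chi_eq_one_iff]
    exact propext ⟨fun h => h.2, fun h => ⟨hG T y z h, h⟩⟩
  funext z
  cases b with
  | false => exact congrFun h z
  | true =>
    simp only [InRange]
    rw [h]
    exact propext (amongTwoLargest_iff (fun _ _ _ ha hc hd => ha.eq_or_eq_or_eq (hT rfl) hc hd) z)

theorem eval_recTerm [Nontrivial R] {b : Bool} (hG : ∀ T y z, s.Pred T y z → Guard y z)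
    (hb : b = true → C.BoundedFanIn) (f : (Fin 0 → Fin m) → (Block i w r → Fin m) → R)
    (x : Fin 0 → Fin m) (y : Block i w r → Fin m) (ζ : Empty → Block i w r → Fin m) :
    (recTerm i w r).eval b (D.interp s.arb) (auxInterp s.arb) f x y ζ =
      s.body D.input (f x) y := by
  have h3 := inRange_predFormula (b := b) s s.aux_three hG fun h => card_addSet_le (hb h)
  have h4 := inRange_predFormula (b := b) s s.aux_four hG fun h => card_mulSet_le (hb h)
  have h5 := inRange_predFormula (b := b) s s.aux_five hG fun _ g => by
    cases C.node g <;> simp [Node.leftSet]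
  have h6 := inRange_predFormula (b := b) s s.aux_six hG fun _ g => by
    cases C.node g <;> simp [Node.rightSet]
  simp only [recTerm, guardedTerm, RecTerm.eval, RecFormula.truth, Aggregator.relEval, h3, h4, h5,
    h6, eval_leafTerm, eval_auxTerm, Simulation.aux_two, Simulation.body]
  rfl

theorem holds_recGFR [Nontrivial R] {b : Bool} (hG : ∀ T y z, s.Pred T y z → Guard y z)
    (hb : b = true → C.BoundedFanIn) (hr : 0 < r) (hw : 0 < w) (ν : X → Fin m) :
    GFR.Holds b D s.arb X (recGFR i w r hw X) ν ↔ C.eval D.input = 1 := by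
  have key : ∀ f : (Fin 0 → Fin m) → (Block i w r → Fin m) → R,
      IsRecSolution b (D.interp s.arb) (auxInterp s.arb) (recTerm i w r) f →
      ((recGFR i w r hw X).ψ.Holds
        ((D.interp s.arb).extend fun q => f (q ∘ Sum.inl) (q ∘ Sum.inr)) noExtra ν ↔
          C.eval D.input = 1) := by
    intro f hf
    have hf' : ∀ y, f Fin.elim0 y = s.body D.input (f Fin.elim0) y := fun y =>
      (hf Fin.elim0 y).trans (eval_recTerm s D hG hb f _ y _)
    rw [← s.eq_eval hr D.input (fun _ => f Fin.elim0) fun _ => hf']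
    have hx : ∀ x : Fin 0 → Fin m, x = Fin.elim0 := fun x => Subsingleton.elim _ _
    have hsum : ∑ a : Fin (i * w + r) → Fin m, s.aux 7 (a ∘ (blockEquiv i w r).symm)
        (a ∘ (blockEquiv i w r).symm) * f Fin.elim0 (a ∘ (blockEquiv i w r).symm) =
          f Fin.elim0 (s.enc s.K C.out) := by
      simp only [Simulation.aux_seven]
      rw [sum_blockEquiv fun z => chi R (s.enc s.K C.out = z) * f Fin.elim0 z, sum_chi_mul]
    rw [← hsum]
    simp only [recGFR, Formula.Holds, Formula.truth, NumTerm.eval, IdxTerm.eval, Interp.extend,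
      RStructure.interp, Simulation.arb, Equiv.apply_symm_apply, Sum.elim_inl, Sum.elim_inr]
    refine Eq.congr (Finset.sum_congr rfl fun a _ => ?_) rfl
    rw [hx ((fun q => _) ∘ Sum.inl)]
    rfl
  constructor
  · rintro ⟨f, hf, h⟩
    exact (key f hf).mp h
  · intro h
    obtain ⟨f, hf, -⟩ :=
      existsUnique_isRecSolution b (D.interp s.arb) (auxInterp s.arb) (recTerm (R := R) i w r)
    exact ⟨f, hf, (key f hf).mpr h⟩

end Semantics

/-! ## Sets decided by circuits are definable -/

section

variable {R : Type u} {m i w r : ℕ} {C : Circuit R m}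

theorem exists_gate (hsize : C.size ≤ m ^ r) :
    ∃ f : Fin C.size → Fin r → Fin m, Function.Injective f := by
  obtain ⟨f⟩ := Function.Embedding.nonempty_of_card_le (α := Fin C.size) (β := Fin r → Fin m)
    (by simpa using hsize)
  exact ⟨f, f.injective⟩

theorem exists_simulation_of_depth_le (hm : 0 < m) (w : ℕ) {K : ℕ} (hsize : C.size ≤ m ^ r)
    (hK : C.depth ≤ K) : ∃ s : Simulation C 0 w r, s.K = K := by
  obtain ⟨f, hf⟩ := exists_gate hsize
  exact ⟨⟨f, hf, K, hK, fun _ _ => ⟨0, hm⟩, fun _ _ _ _ _ => rfl⟩, rfl⟩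

theorem exists_simulation_guard (hm : 0 < m) {L : ℕ} (hL : 2 ^ L ≤ m ^ w) (hsize : C.size ≤ m ^ r)
    (hK : C.depth < (L + 1) ^ i) :
    ∃ s : Simulation C i w r, ∀ T y z, s.Pred T y z → Guard y z := by
  obtain ⟨f, hf⟩ := exists_gate hsize
  have hcard : Fintype.card (Lex (Fin i → Fin (L + 1))) = (L + 1) ^ i := by
    rw [Fintype.card_lex]
    simp
  let iso := Fintype.orderIsoFinOfCardEq (Lex (Fin i → Fin (L + 1))) hcard
  have hlt : ∀ a : Fin (L + 1), 2 ^ a.1 - 1 < m ^ w := fun a =>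
    (Nat.sub_lt Nat.one_le_two_pow one_pos).trans_le
      ((Nat.pow_le_pow_right two_pos (Nat.lt_succ_iff.mp a.2)).trans hL)
  let time : ℕ → Fin i × Fin w → Fin m := fun k p =>
    if h : k < (L + 1) ^ i then
      (tupleEquiv m w).symm ⟨2 ^ (ofLex (iso ⟨k, h⟩) p.1).1 - 1, hlt _⟩ p.2
    else ⟨0, hm⟩
  have hnum : ∀ k (h : k < (L + 1) ^ i) j, num (fun l => time k (j, l)) =
      2 ^ (ofLex (iso ⟨k, h⟩) j).1 - 1 := by
    intro k h j
    have : (fun l => time k (j, l)) =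
        (tupleEquiv m w).symm ⟨2 ^ (ofLex (iso ⟨k, h⟩) j).1 - 1, hlt _⟩ := by
      funext l
      simp [time, h]
    rw [this, num, Equiv.apply_symm_apply]
  have hinj : ∀ k (h : k < (L + 1) ^ i) k' (h' : k' < (L + 1) ^ i), time k = time k' → k = k' := by
    intro k h k' h' he
    have h1 : iso ⟨k, h⟩ = iso ⟨k', h'⟩ := by
      refine ofLex.injective (funext fun j => Fin.ext ?_)
      have h2 := hnum k h j
      rw [he, hnum k' h' j] at h2
      have h3 : 1 ≤ 2 ^ (ofLex (iso ⟨k, h⟩) j).1 := Nat.one_le_two_pow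
      have h4 : 1 ≤ 2 ^ (ofLex (iso ⟨k', h'⟩) j).1 := Nat.one_le_two_pow
      exact Nat.pow_right_injective le_rfl (by dsimp only; omega)
    simpa using iso.injective h1
  refine ⟨⟨f, hf, C.depth, le_rfl, time, fun k hk k' hk' he => ?_⟩, ?_⟩
  · have := hinj _ (by omega) _ (by omega) he
    rw [Nat.succ_injective this]
  · rintro T y z ⟨k, hk, g, p, hy, -, -, -, rfl⟩
    replace hk : k < C.depth := hk
    have hk0 : k < (L + 1) ^ i := by omega
    have hk1 : k + 1 < (L + 1) ^ i := by omega
    have hdy : ∀ j, digit y j = 2 ^ (ofLex (iso ⟨k + 1, hk1⟩) j).1 - 1 := fun j => by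
      rw [← hnum (k + 1) hk1 j, digit]
      exact congrArg num (funext fun l => congrFun hy (j, l))
    have hdz : ∀ j, digit (Sum.elim (time k) (f p)) j = 2 ^ (ofLex (iso ⟨k, hk0⟩) j).1 - 1 :=
      fun j => hnum k hk0 j
    obtain ⟨j, hj, hj'⟩ : iso ⟨k, hk0⟩ < iso ⟨k + 1, hk1⟩ :=
      iso.lt_iff_lt.mpr (Fin.mk_lt_mk.mpr (Nat.lt_succ_self k))
    replace hj' : (ofLex (iso ⟨k, hk0⟩) j).1 + 1 ≤ (ofLex (iso ⟨k + 1, hk1⟩) j).1 := hj'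
    have h1 := Nat.pow_le_pow_right two_pos hj'
    have h2 : 1 ≤ 2 ^ (ofLex (iso ⟨k, hk0⟩) j).1 := Nat.one_le_two_pow
    rw [pow_succ] at h1
    refine ⟨j, ?_, ?_, fun l hl => ?_⟩
    · rw [hdy]
      refine (add_le_add (hdz j).le (hdz j).le).trans ?_
      omega
    · rw [hdy]
      refine (hdz j).trans_lt ?_
      omega
    · rw [hdy]
      refine (hdz l).trans_le ?_
      have : ofLex (iso ⟨k, hk0⟩) l = ofLex (iso ⟨k + 1, hk1⟩) l := hj l hl
      rw [this]

end

section Unravel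

variable {R : Type u} [CommRing R] [LinearOrder R] {V : Vocab} {E : Type → Type v} {X : Type}
  {m n : ℕ}

theorem exists_bigOp_term {A : Type*} (o : Bool) (P : Finset A)
    (F : A → Interp V R m → (∀ X : Type, E X → (X → Fin m) → Prop) → (X → Fin m) → R)
    (h : ∀ p ∈ P, ∃ t : NumTerm V R E X, ∀ M e ν, t.eval M e ν = F p M e ν) :
    ∃ t : NumTerm V R E X, ∀ M e ν, t.eval M e ν = bigOp o P fun p => F p M e ν := by
  classical
  induction P using Finset.induction_on with
  | empty =>
    refine ⟨.const (if o then 1 else 0), fun M e ν => ?_⟩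
    rw [bigOp_empty, NumTerm.eval]
  | insert a P ha ih =>
    obtain ⟨t₁, h₁⟩ := h a (Finset.mem_insert_self a P)
    obtain ⟨t₂, h₂⟩ := ih fun p hp => h p (Finset.mem_insert_of_mem hp)
    cases o with
    | false =>
      refine ⟨.add t₁ t₂, fun M e ν => ?_⟩
      rw [NumTerm.eval, h₁, h₂]
      simp [bigOp, Finset.sum_insert ha]
    | true =>
      refine ⟨.mul t₁ t₂, fun M e ν => ?_⟩
      rw [NumTerm.eval, h₁, h₂]
      simp [bigOp, Finset.prod_insert ha]

/-- A single circuit can be written as a number term. -/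
theorem Circuit.exists_term (C : Circuit R n) (inp : Fin n → NumTerm V R E X) (g : Fin C.size) :
    ∃ t : NumTerm V R E X, ∀ (M : Interp V R m) e ν,
      t.eval M e ν = C.val (fun j => (inp j).eval M e ν) g := by
  induction g using WellFoundedLT.induction with
  | _ g ih =>
    simp only [C.val_eq _ g]
    have ih' := fun p hp => ih p (C.topological g p hp)
    cases hn : C.node g with
    | input j => exact ⟨inp j, fun _ _ _ => rfl⟩
    | const c =>
      refine ⟨.const c, fun _ _ _ => ?_⟩
      rw [NumTerm.eval]
      rfl
    | add P => exact exists_bigOp_term false P _ fun p hp => ih' p (by rw [hn]; exact hp)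
    | mul P => exact exists_bigOp_term true P _ fun p hp => ih' p (by rw [hn]; exact hp)
    | lt a c =>
      obtain ⟨t₁, h₁⟩ := ih' a (by rw [hn]; simp [Node.preds])
      obtain ⟨t₂, h₂⟩ := ih' c (by rw [hn]; simp [Node.preds])
      refine ⟨.chi (.numLt t₁ t₂), fun M e ν => ?_⟩
      simp only [NumTerm.eval, Formula.truth, h₁, h₂, Node.value, chi]
    | output a => exact ih' a (by rw [hn]; simp [Node.preds])

end Unravel

section Encoding

variable {R : Type u} [CommRing R] {m i w r : ℕ}

theorem RStar_ext {R : Type u} {n n' : ℕ} {x : Fin n → R} {x' : Fin n' → R} (h : n = n')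
    (hx : ∀ j : Fin n', x (Fin.cast h.symm j) = x' j) : (⟨n, x⟩ : RStar R) = ⟨n', x'⟩ := by
  subst h
  exact congrArg (Sigma.mk n) (funext hx)

theorem len_simSignature (i w r m : ℕ) : (simSignature i w r).len m = m := by
  have h1 : ∑ s, m ^ ((simSignature i w r).arS s + 1) = 0 :=
    Finset.sum_eq_zero fun s _ => s.elim0
  have h2 : ∑ s, m ^ (simSignature i w r).arF s = m := (Fin.sum_univ_one _).trans (pow_one m)
  rw [Signature.len, h1, h2, zero_add]

theorem encode_eq_input (D : RStructure (simSignature i w r) R m) : D.encode = ⟨m, D.input⟩ := by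
  rw [D.encode_eq]
  refine RStar_ext (len_simSignature i w r m) fun j => ?_
  have h : Fin.cast (len_simSignature i w r m).symm j =
      (simSignature i w r).posF m (0 : Fin 1) fun _ => j := by
    refine Fin.ext ?_
    have h1 : num (fun _ : Fin 1 => j) = j := by
      rw [num_eq_sum]
      simp
    have h2 : ∑ s, m ^ ((simSignature i w r).arS s + 1) = 0 :=
      Finset.sum_eq_zero fun s _ => s.elim0
    simp only [Signature.posF, Fin.val_natAdd, finSigmaFinEquiv_apply, h2, Fin.val_cast]
    simpa [num] using h1.symm
  rw [h, RStructure.tuple_posF]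
  rfl

end Encoding

section

variable {R : Type u} [CommRing R] [LinearOrder R] [Nontrivial R] {i : ℕ} {b : Bool}
  {C : ∀ n, Circuit R n}

/-- On structures of size at least two, the circuits can be simulated. -/
theorem exists_sentence_of_two_le (hb : b = true → 1 ≤ i) (hsize : PolySize C)
    (hdepth : PolylogDepth i C) (hfan : b = true → ∀ n, (C n).BoundedFanIn) :
    ∃ (w r : ℕ) (φ : ∀ X : Type, Formula (simSignature i w r).vocab R (GFR (simSignature i w r) R i) X)
      (I : ∀ m, ArbInterp (simSignature i w r) R m), ∀ m, 2 ≤ m →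
        ∀ (D : RStructure (simSignature i w r) R m) (X : Type) (ν : X → Fin m),
          (φ X).Holds (D.interp (I m)) (GFR.Holds b D (I m)) ν ↔ (C m).eval D.input = 1 := by
  classical
  obtain ⟨k, hk⟩ := hsize
  obtain ⟨r, hr, hsize⟩ := exists_le_pow_of_isBigO hk
  obtain ⟨K, hK⟩ := exists_le_log_of_isBigO hdepth
  rcases Nat.eq_zero_or_pos i with rfl | hi
  · obtain rfl : b = false := by
      cases b
      · rfl
      · exact absurd (hb rfl) (by omega)
    have hs : ∀ m, 2 ≤ m → ∃ s : Simulation (C m) 0 1 r, s.K = K := fun m hm =>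
      exists_simulation_of_depth_le (by omega) 1 (hsize m hm) (by simpa using hK m hm)
    choose s hs using hs
    refine ⟨1, r, fun X => layerFormula 0 1 r (K + 1),
      fun m => if hm : 2 ≤ m then (s m hm).arb else fun _ _ => 0, fun m hm D X ν => ?_⟩
    simp only [hm, dif_pos]
    rw [← hs m hm]
    exact holds_layerFormula (s m hm) D _ hr ν
  · have hs : ∀ m, 2 ≤ m → ∃ s : Simulation (C m) i (K + 1) r,
        ∀ T y z, s.Pred T y z → Guard y z := by
      intro m hm
      have hlog : 1 ≤ Nat.log 2 m := Nat.log_pos one_lt_two hm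
      refine exists_simulation_guard (L := Nat.log 2 m * (K + 1)) (by omega) ?_ (hsize m hm) ?_
      · rw [pow_mul]
        exact Nat.pow_le_pow_left (Nat.pow_log_le_self 2 (by omega)) _
      · refine (hK m hm).trans_lt ?_
        have hpos : 0 < Nat.log 2 m ^ i := Nat.pow_pos hlog
        calc K * Nat.log 2 m ^ i < (K + 1) * Nat.log 2 m ^ i :=
              Nat.mul_lt_mul_of_pos_right (Nat.lt_succ_self K) hpos
          _ ≤ (K + 1) ^ i * Nat.log 2 m ^ i :=
              Nat.mul_le_mul_right _ (Nat.le_self_pow (by omega) _)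
          _ = (Nat.log 2 m * (K + 1)) ^ i := by rw [mul_pow, mul_comm]
          _ ≤ _ := Nat.pow_le_pow_left (Nat.le_succ _) i
    choose s hG using hs
    refine ⟨K + 1, r, fun X => .extra (recGFR i (K + 1) r (Nat.succ_pos K) X),
      fun m => if hm : 2 ≤ m then (s m hm).arb else fun _ _ => 0, fun m hm D X ν => ?_⟩
    simp only [hm, dif_pos, Formula.Holds, Formula.truth]
    exact holds_recGFR (s m hm) D (hG m hm) (fun h => hfan h m) hr _ ν

/-- Sets decided by circuits of polynomial size and of polylogarithmic depth are definable. -/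
theorem definable_of_circuits (hb : b = true → 1 ≤ i) {S : Set (RStar R)} (hC : Decides C S)
    (hsize : PolySize C) (hdepth : PolylogDepth i C)
    (hfan : b = true → ∀ n, (C n).BoundedFanIn) : S ∈ Definable R i b := by
  classical
  have hdec : ∀ n x, (C n).eval x = 1 ↔ (⟨n, x⟩ : RStar R) ∈ S := by
    intro n x
    refine ⟨fun h => ?_, fun h => (hC n x).1 h⟩
    by_contra hx
    exact one_ne_zero (h.symm.trans ((hC n x).2 hx))
  obtain ⟨w, r, φ, I, hφ⟩ := exists_sentence_of_two_le hb hsize hdepth hfan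
  let σ := simSignature i w r
  obtain ⟨t, ht⟩ := (C 1).exists_term (V := σ.vocab) (E := GFR σ R i) (X := Empty ⊕ Unit) (m := 1)
    (fun _ => inputTerm i w r (.inr ())) (C 1).out
  let same : Formula σ.vocab R (GFR σ R i) (Empty ⊕ Unit) := .idxEq (.var (.inr ())) (.var (.inr ()))
  let empty : Sentence σ R i := .all (.not same)
  let big : Sentence σ R i := .ex (.ex (.idxLt (.var (.inl (.inr ()))) (.var (.inr ()))))
  let φ₀ : Sentence σ R i := if (⟨0, Fin.elim0⟩ : RStar R) ∈ S then empty else .ex (.not same)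
  let φ₁ : Sentence σ R i := .ex (.numEq t (.const 1))
  let θ : Sentence σ R i := .or (.and empty φ₀)
    (.or (.and (.and (.not empty) (.not big)) φ₁) (.and big (φ Empty)))
  have key : ∀ (m : ℕ) (D : RStructure σ R m), Models b D (I m) θ ↔ (⟨m, D.input⟩ : RStar R) ∈ S := by
    intro m D
    have hsame : ∀ ν : Empty ⊕ Unit → Fin m,
        (same.truth (D.interp (I m)) (GFR.Holds b D (I m)) ν).down := fun ν => by
      simp only [same, Formula.truth]
    have hempty : ∀ ν : Empty → Fin m,
        (empty.truth (D.interp (I m)) (GFR.Holds b D (I m)) ν).down ↔ m = 0 := by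
      intro ν
      simp only [empty, Formula.truth, hsame, not_true]
      refine ⟨fun h => ?_, ?_⟩
      · by_contra hm
        exact h ⟨0, Nat.pos_of_ne_zero hm⟩
      · rintro rfl a
        exact a.elim0
    have hbig : ∀ ν : Empty → Fin m,
        (big.truth (D.interp (I m)) (GFR.Holds b D (I m)) ν).down ↔ 2 ≤ m := by
      intro ν
      simp only [big, Formula.truth, IdxTerm.eval, Sum.elim_inl, Sum.elim_inr]
      refine ⟨?_, fun h => ⟨⟨0, by omega⟩, ⟨1, by omega⟩, by simp⟩⟩
      rintro ⟨a, c, h⟩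
      have := a.2
      have := c.2
      rw [Fin.lt_def] at h
      omega
    simp only [Models, Formula.Holds, θ, Formula.truth, hempty, hbig]
    match m, D with
    | 0, D =>
      have hD : D.input = Fin.elim0 := funext fun j => j.elim0
      rw [hD]
      by_cases h : (⟨0, Fin.elim0⟩ : RStar R) ∈ S
      · simp only [φ₀, h, if_true]
        simpa using (hempty _).mpr rfl
      · simp only [φ₀, h, if_false, Formula.truth]
        simp
    | 1, D =>
      simp only [φ₁, Formula.truth, ht, eval_inputTerm]
      have hx : ∀ (a : Fin 1), (fun _ : Fin 1 => D.input a) = D.input := fun a =>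
        funext fun j => congrArg D.input (Subsingleton.elim a j)
      simp only [Sum.elim_inr, hx, NumTerm.eval]
      rw [← hdec]
      simp [Circuit.eval]
    | m + 2, D =>
      have h := hφ (m + 2) (by omega) D Empty fun x => x.elim
      rw [Formula.Holds, hdec] at h
      rw [← h]
      simp
  refine ⟨σ, θ, I, ?_⟩
  rintro ⟨n, x⟩
  constructor
  · intro h
    let D : RStructure σ R n := ⟨fun s => s.elim0, fun _ a => x (a (0 : Fin 1))⟩
    exact ⟨n, D, encode_eq_input D, (key n D).mpr h⟩
  · rintro ⟨m, D, h, hD⟩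
    rw [← h, encode_eq_input D]
    exact (key m D).mp hD

end

end RCirc

theorem mainTheorem2 (R : Type*) [CommRing R] [IsDomain R] [Infinite R] [LinearOrder R] :
    (∀ i : ℕ, RCirc.AC R i = RCirc.FOArbGFR R i) ∧
    (∀ i : ℕ, 1 ≤ i → RCirc.NC R i = RCirc.FOArbGFRBound R i) := by
  refine ⟨fun i => Set.ext fun S => ⟨?_, fun hS => ?_⟩,
    fun i hi => Set.ext fun S => ⟨?_, fun hS => ?_⟩⟩
  · rintro ⟨C, hC, hsize, hdepth⟩
    exact RCirc.definable_of_circuits (by simp) hC hsize hdepth (by simp)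
  · obtain ⟨C, hC, hsize, hdepth, -⟩ := RCirc.exists_circuits_of_definable (by simp) hS
    exact ⟨C, hC, hsize, hdepth⟩
  · rintro ⟨C, hC, hsize, hdepth, hfan⟩
    exact RCirc.definable_of_circuits (fun _ => hi) hC hsize hdepth fun _ => hfan
  · obtain ⟨C, hC, hsize, hdepth, hfan⟩ := RCirc.exists_circuits_of_definable (fun _ => hi) hS
    exact ⟨C, hC, hsize, hdepth, hfan rfl⟩
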